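/- **Circuits.** Let $n\ge 0$, and number the wires $0,\dots,n-1$ from top to bottom. A real Clifford circuit on $n$ qubits is a scalar $\pm1$ together with a finite word, read from left to right (leftmost gate applied first), in gates $H^p$, $Z^p$ ($0\le p<n$) and $\mathrm{CZ}^p$ ($0\le p<n-1$), where $G^p$ denotes the gate $G$ whose topmost wire is $p$; here $H=\frac1{\sqrt2}\begin{bmatrix}1&1\\1&-1\end{bmatrix}$, $Z=\mathrm{diag}(1,-1)$, $\mathrm{CZ}=\mathrm{diag}(1,1,1,-1)$ on wires $p,p+1$. Circuit diagrams are considered up to exchanging neighbouring gates on disjoint wires. The real Pauli group consists of the operators $\pm P_1\otimes\dots\otimes P_n$ with $P_i\in\{I,X,Z,XZ\}$, and the real Clifford group $\mathcal C_n$ is its normalizer in the orthogonal group $O(2^n)$. **Derived gates** (topmost wire $0$). $X=H^0Z^0H^0$ and $\mathrm{CXZ}=H^0\mathrm{CZ}^0H^0\mathrm{CZ}^0$ are shorthands, which may be replaced by their definitions. Moreover $A_1=A_3=1$, $A_2=H^0$; $B_1=B_5=H^1\mathrm{CZ}^0H^1H^0\mathrm{CZ}^0H^1H^0\mathrm{CZ}^0$,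 $B_2=B_6=\mathrm{CZ}^0H^1H^0\mathrm{CZ}^0$, $B_3=B_7=H^0\mathrm{CZ}^0H^1H^0\mathrm{CZ}^0$, $B_4=B_8=H^1\mathrm{CZ}^0H^1\mathrm{CZ}^0H^1H^0\mathrm{CZ}^0$; $C_1=1$, $C_2=X^0$; $D_1=\mathrm{CZ}^0H^1H^0\mathrm{CZ}^0H^1H^0\mathrm{CZ}^0H^1$, $D_2=H^0\mathrm{CZ}^0H^1H^0\mathrm{CZ}^0H^1$, $D_3=H^1H^0\mathrm{CZ}^0H^1H^0\mathrm{CZ}^0H^1$, $D_4=H^0\mathrm{CZ}^0H^1H^0\mathrm{CZ}^0H^1\mathrm{CZ}^0$; $E_1=1$, $E_2=Z^0$. In typed circuits every wire segment is single or double, and gates compose only along wires of equal type. All wires of the gates $A_i,\dots,E_i$ are single, except that the output of $A_3$, the bottom input of $B_5,\dots,B_8$ and the top output of $B_4,\dots,B_7$ are double. $H,Z,X$ preserve the type of their wire; $\mathrm{CZ}$, $\mathrm{CXZ}$ preserve the type of their top wire and have a single bottom wire. All typed circuits considered have single outer wires. **Normal forms.** A $Z$-circuit on $n$ wires is a well-typed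 circuit $A^mB^{m-1}\cdots B^0C^0$ with $0\le m<n$, each letter being any gate of that kind; an $X$-circuit on $n$ wires is $D^0D^1\cdots D^{n-2}E^{n-1}$. A normal circuit on $n$ wires is $\pm L_nM_nL_{n-1}M_{n-1}\cdots L_1M_1$, with $L_i$ a $Z$-circuit and $M_i$ an $X$-circuit on the top $i$ wires. **Dirty normal forms.** Label wire segments of a normal circuit: all wires have label $1$ at the left; after a gate $A$ its wire has label $2$; after $B$ its top wire has label $2$, its bottom wire label $1$; after $C$ its wire has label $3$; after $D$ its top wire has label $1$, its bottom wire label $4$; after $E$ there is no label. A dirty normal form is a well-typed circuit obtained from a normal circuit by inserting gates (called dirty) as follows: $H$ on a wire labelled $1$ or a double wire labelled $2$; $Z$ on a wire with any label; $X$ on a wire labelled $1$ or $2$; $\mathrm{CZ}$ with bottom wire labelled $1$ and top wire labelled $1$, $3$, or single labelled $2$; $\mathrm{CXZ}$ with bottom wire labelled $1$ and top wire double labelled $2$. **Typed relations.** There are 139 of them (each admits exactly one typing). The 137 push relations are: $Z^0A_1^0 = A_1^0Z^0$; $Z^0A_2^0 = A_2^0X^0$; $Z^0A_3^0 = A_3^0Z^0$;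 $H^0A_1^0 = A_2^0$; $H^0A_2^0 = A_1^0$; $H^0A_3^0 = A_3^0H^0$; $\mathrm{CZ}^0A_1^0 = A_1^0\mathrm{CZ}^0$; $\mathrm{CZ}^0A_2^0 = A_1^1B_2^0\mathrm{CZ}^0H^1$; $\mathrm{CZ}^0A_3^0 = A_1^1B_4^0H^0\mathrm{CXZ}^0H^1Z^0$; $\mathrm{CZ}^0A_1^1B_1^0 = A_1^1B_1^0H^1\mathrm{CZ}^0H^1$; $\mathrm{CZ}^0A_2^1B_1^0 = A_2^1B_3^0$; $\mathrm{CZ}^0A_1^1B_2^0 = A_2^0H^1\mathrm{CZ}^0$; $\mathrm{CZ}^0A_2^1B_2^0 = A_3^1B_8^0\mathrm{CZ}^0H^1\mathrm{CZ}^0X^0Z^1$; $\mathrm{CZ}^0A_1^1B_3^0 = A_1^1B_3^0H^1\mathrm{CZ}^0H^1X^1$; $\mathrm{CZ}^0A_2^1B_3^0 = A_2^1B_1^0$; $\mathrm{CZ}^0A_1^1B_4^0 = A_3^0H^1\mathrm{CXZ}^0Z^0H^0$; $\mathrm{CZ}^0A_2^1B_4^0 = A_3^1B_6^0\mathrm{CXZ}^0H^1\mathrm{CXZ}^0Z^0X^1$;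 $\mathrm{CZ}^0A_3^1B_5^0 = A_3^1B_7^0H^1\mathrm{CXZ}^0H^1$; $\mathrm{CZ}^0A_3^1B_6^0 = A_2^1B_4^0H^1\mathrm{CXZ}^0H^1H^0$; $\mathrm{CZ}^0A_3^1B_7^0 = A_3^1B_5^0H^1\mathrm{CXZ}^0H^1X^1$; $\mathrm{CZ}^0A_3^1B_8^0 = A_2^1B_2^0\mathrm{CZ}^0H^1\mathrm{CZ}^0X^0Z^1$; $H^1B_5^0 = B_5^0H^0$; $H^1B_6^0 = B_6^0\mathrm{CXZ}^0H^1\mathrm{CXZ}^0Z^0X^1$; $H^1B_7^0 = B_7^0\mathrm{CXZ}^0H^1\mathrm{CXZ}^0Z^0X^1$; $H^1B_8^0 = B_8^0\mathrm{CZ}^0H^1\mathrm{CZ}^0X^0Z^1$; $X^1B_1^0 = B_1^0X^0$; $X^1B_2^0 = B_2^0X^0$; $X^1B_3^0 = B_3^0X^0$; $X^1B_4^0 = B_4^0X^0$; $X^1B_5^0 = B_5^0X^0$; $X^1B_6^0 = B_6^0X^0$; $X^1B_7^0 = B_7^0X^0$; $X^1B_8^0 = B_8^0X^0$; $H^0B_1^0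 = B_1^0H^1$; $H^0B_2^0 = B_3^0$; $H^0B_3^0 = B_2^0$; $H^0B_4^0 = B_4^0H^1X^0$; $H^0B_5^0 = B_5^0H^1$; $H^0B_6^0 = B_7^0$; $H^0B_7^0 = B_6^0$; $H^0B_8^0 = B_8^0H^1X^0$; $Z^0B_1^0 = B_1^0X^1$; $Z^0B_2^0 = B_2^0X^0Z^1$; $Z^0B_3^0 = B_3^0X^1$; $Z^0B_4^0 = B_4^0X^0Z^1$; $Z^0B_5^0 = B_5^0X^1$; $Z^0B_6^0 = B_6^0X^0Z^1$; $Z^0B_7^0 = B_7^0X^1$; $Z^0B_8^0 = B_8^0X^0Z^1$; $Z^1B_1^0 = B_1^0Z^0$; $Z^1B_2^0 = B_2^0Z^0X^1$; $Z^1B_3^0 = B_3^0Z^0X^1$; $Z^1B_4^0 = B_4^0Z^1X^0Z^0X^1$; $Z^1B_5^0 = B_5^0Z^0$; $Z^1B_6^0 = B_6^0Z^0X^1$; $Z^1B_7^0 = B_7^0Z^0X^1$; $Z^1B_8^0 = B_8^0Z^1X^0Z^0X^1$; $Z^0C_1^0 = C_1^0Z^0$; $X^0C_1^0 = C_2^0$;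 $\mathrm{CZ}^0C_1^0 = C_1^0\mathrm{CZ}^0$; $Z^0C_2^0 = -C_2^0Z^0$; $X^0C_2^0 = C_1^0$; $\mathrm{CZ}^0C_2^0 = C_2^0\mathrm{CZ}^0Z^1$; $\mathrm{CZ}^1B_1^0 = B_1^0\mathrm{CZ}^0H^1\mathrm{CZ}^1H^1\mathrm{CZ}^0H^1\mathrm{CZ}^1H^1$; $\mathrm{CZ}^1B_2^0 = B_2^0\mathrm{CZ}^0H^1\mathrm{CZ}^1H^1\mathrm{CZ}^0$; $\mathrm{CZ}^1B_3^0 = B_3^0\mathrm{CZ}^0H^1\mathrm{CZ}^1H^1\mathrm{CZ}^0$; $\mathrm{CZ}^1B_4^0 = B_4^0H^2\mathrm{CZ}^1H^1H^2\mathrm{CZ}^1H^1\mathrm{CXZ}^0H^1\mathrm{CZ}^1H^1H^2\mathrm{CZ}^1H^2\mathrm{CXZ}^1Z^2$; $\mathrm{CXZ}^1B_5^0 = B_5^0H^2\mathrm{CZ}^1H^2H^1\mathrm{CZ}^1H^1\mathrm{CXZ}^0H^1\mathrm{CZ}^1H^1H^2\mathrm{CZ}^1H^2$; $\mathrm{CXZ}^1B_6^0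 = B_6^0H^2\mathrm{CZ}^1H^2H^1\mathrm{CZ}^1H^1\mathrm{CXZ}^0H^1\mathrm{CZ}^1H^1H^2\mathrm{CZ}^1H^2H^1\mathrm{CZ}^1H^1$; $\mathrm{CXZ}^1B_7^0 = B_7^0H^2\mathrm{CZ}^1H^2H^1\mathrm{CZ}^1H^1\mathrm{CXZ}^0H^1\mathrm{CZ}^1H^1H^2\mathrm{CZ}^1H^2H^1\mathrm{CZ}^1H^1$; $\mathrm{CXZ}^1B_8^0 = B_8^0H^2\mathrm{CZ}^1H^2H^1\mathrm{CZ}^1H^1\mathrm{CZ}^0H^1\mathrm{CZ}^1H^1H^2\mathrm{CZ}^1H^2H^1\mathrm{CZ}^1H^1\mathrm{CZ}^1Z^2$; $\mathrm{CZ}^0B_1^1B_1^0 = B_1^1B_1^0H^2H^1\mathrm{CZ}^1H^2H^1$; $\mathrm{CZ}^0B_1^1B_2^0 = B_3^1B_2^0H^2\mathrm{CZ}^1H^2$; $\mathrm{CZ}^0B_1^1B_3^0 = B_1^1B_3^0H^2H^1\mathrm{CZ}^1H^2H^1$; $\mathrm{CZ}^0B_1^1B_4^0 = B_3^1B_4^0H^2\mathrm{CZ}^1H^2$;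 $\mathrm{CZ}^0B_2^1B_1^0 = B_2^1B_3^0H^1\mathrm{CZ}^1H^1$; $\mathrm{CZ}^0B_2^1B_2^0 = B_4^1B_8^0X^0\mathrm{CZ}^1$; $\mathrm{CZ}^0B_2^1B_3^0 = B_2^1B_1^0H^1\mathrm{CZ}^1H^1$; $\mathrm{CZ}^0B_2^1B_4^0 = B_4^1B_6^0X^0\mathrm{CZ}^1$; $\mathrm{CZ}^0B_3^1B_1^0 = B_3^1B_1^0H^2H^1\mathrm{CZ}^1H^2H^1$; $\mathrm{CZ}^0B_3^1B_2^0 = B_1^1B_2^0H^2\mathrm{CZ}^1H^2$; $\mathrm{CZ}^0B_3^1B_3^0 = B_3^1B_3^0H^2H^1\mathrm{CZ}^1H^2H^1$; $\mathrm{CZ}^0B_3^1B_4^0 = B_1^1B_4^0H^2\mathrm{CZ}^1H^2$; $\mathrm{CZ}^0B_4^1B_5^0 = B_4^1B_7^0H^1\mathrm{CZ}^1H^1$; $\mathrm{CZ}^0B_4^1B_6^0 = B_2^1B_4^0X^0\mathrm{CZ}^1$; $\mathrm{CZ}^0B_4^1B_7^0 = B_4^1B_5^0H^1\mathrm{CZ}^1H^1$;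 $\mathrm{CZ}^0B_4^1B_8^0 = B_2^1B_2^0X^0\mathrm{CZ}^1$; $\mathrm{CZ}^0B_5^1B_5^0 = B_5^1B_5^0H^2H^1\mathrm{CZ}^1H^2H^1$; $\mathrm{CZ}^0B_5^1B_6^0 = B_7^1B_6^0H^2\mathrm{CZ}^1H^2$; $\mathrm{CZ}^0B_5^1B_7^0 = B_5^1B_7^0H^2H^1\mathrm{CZ}^1H^2H^1$; $\mathrm{CZ}^0B_5^1B_8^0 = B_7^1B_8^0H^2\mathrm{CZ}^1H^2$; $\mathrm{CZ}^0B_6^1B_5^0 = B_6^1B_7^0H^1\mathrm{CZ}^1H^1$; $\mathrm{CZ}^0B_6^1B_6^0 = B_8^1B_4^0X^0\mathrm{CZ}^1$; $\mathrm{CZ}^0B_6^1B_7^0 = B_6^1B_5^0H^1\mathrm{CZ}^1H^1$; $\mathrm{CZ}^0B_6^1B_8^0 = B_8^1B_2^0X^0\mathrm{CZ}^1$; $\mathrm{CZ}^0B_7^1B_5^0 = B_7^1B_5^0H^2H^1\mathrm{CZ}^1H^2H^1$; $\mathrm{CZ}^0B_7^1B_6^0 = B_5^1B_6^0H^2\mathrm{CZ}^1H^2$;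 $\mathrm{CZ}^0B_7^1B_7^0 = B_7^1B_7^0H^2H^1\mathrm{CZ}^1H^2H^1$; $\mathrm{CZ}^0B_7^1B_8^0 = B_5^1B_8^0H^2\mathrm{CZ}^1H^2$; $\mathrm{CZ}^0B_8^1B_1^0 = B_8^1B_3^0H^1\mathrm{CZ}^1H^1$; $\mathrm{CZ}^0B_8^1B_2^0 = B_6^1B_8^0X^0\mathrm{CZ}^1$; $\mathrm{CZ}^0B_8^1B_3^0 = B_8^1B_1^0H^1\mathrm{CZ}^1H^1$; $\mathrm{CZ}^0B_8^1B_4^0 = B_6^1B_6^0X^0\mathrm{CZ}^1$; $Z^0D_1^0 = D_1^0Z^1$; $Z^0D_2^0 = D_2^0Z^1$; $Z^0D_3^0 = D_3^0Z^1$; $Z^0D_4^0 = D_4^0Z^1$; $Z^1D_1^0 = D_1^0H^0Z^0H^0$; $Z^1D_2^0 = D_2^0Z^0Z^1$; $Z^1D_3^0 = D_3^0H^0Z^0H^0$; $Z^1D_4^0 = D_4^0Z^1Z^0$; $H^1D_1^0 = D_1^0H^0$; $H^1D_2^0 = D_3^0$; $H^1D_3^0 = D_2^0$; $H^1D_4^0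 = D_4^0Z^1H^0$; $\mathrm{CZ}^0D_1^0 = D_3^0$; $\mathrm{CZ}^0D_2^0 = D_4^0Z^1$; $\mathrm{CZ}^0D_3^0 = D_1^0$; $\mathrm{CZ}^0D_4^0 = D_2^0Z^1$; $Z^0E_1^0 = E_2^0$; $Z^0E_2^0 = E_1^0$; $\mathrm{CZ}^1D_1^0D_1^1 = D_1^0D_1^1H^0H^1\mathrm{CZ}^0H^0H^1$; $\mathrm{CZ}^1D_1^0D_2^1 = D_3^0D_2^1H^0\mathrm{CZ}^0H^0$; $\mathrm{CZ}^1D_1^0D_3^1 = D_1^0D_3^1H^0H^1\mathrm{CZ}^0H^0H^1$; $\mathrm{CZ}^1D_1^0D_4^1 = D_3^0D_4^1H^0\mathrm{CZ}^0H^0$; $\mathrm{CZ}^1D_2^0D_1^1 = D_2^0D_3^1H^1\mathrm{CZ}^0H^1$; $\mathrm{CZ}^1D_2^0D_2^1 = D_4^0D_4^1\mathrm{CZ}^0Z^2$; $\mathrm{CZ}^1D_2^0D_3^1 = D_2^0D_1^1H^1\mathrm{CZ}^0H^1$; $\mathrm{CZ}^1D_2^0D_4^1 = D_4^0D_2^1\mathrm{CZ}^0Z^2$;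 $\mathrm{CZ}^1D_3^0D_1^1 = D_3^0D_1^1H^0H^1\mathrm{CZ}^0H^0H^1$; $\mathrm{CZ}^1D_3^0D_2^1 = D_1^0D_2^1H^0\mathrm{CZ}^0H^0$; $\mathrm{CZ}^1D_3^0D_3^1 = D_3^0D_3^1H^0H^1\mathrm{CZ}^0H^0H^1$; $\mathrm{CZ}^1D_3^0D_4^1 = D_1^0D_4^1H^0\mathrm{CZ}^0H^0$; $\mathrm{CZ}^1D_4^0D_1^1 = D_4^0D_3^1H^1\mathrm{CZ}^0H^1$; $\mathrm{CZ}^1D_4^0D_2^1 = D_2^0D_4^1\mathrm{CZ}^0Z^2$; $\mathrm{CZ}^1D_4^0D_3^1 = D_4^0D_1^1H^1\mathrm{CZ}^0H^1$; $\mathrm{CZ}^1D_4^0D_4^1 = D_2^0D_2^1\mathrm{CZ}^0Z^2$. The two expansion relations are: $1 = A_1^0C_1^0E_1^0$; $C_1^1 = B_1^0C_1^0D_1^0$. (The first is on one single wire, the second on two wires.) A left-to-right rewriting step applies a relation from left to right, at any offset of the wires, to a part of a well-typed circuit. **Statement.** For every $n\ge0$: 1. Every $U\in\mathcal C_n$ is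 the operator of exactly one normal circuit (its normal form). 2. Every real Clifford circuit on $n$ qubits can be rewritten, in finitely many left-to-right steps with the 139 typed relations, into the normal form of its operator. 3. Every dirty normal form on $n$ wires can be rewritten, in finitely many left-to-right steps with the 137 push relations, into the normal form of its operator. 4. The generators $-1,H,Z,\mathrm{CZ}$ and the typed relations (with types forgotten and derived gates replaced by their definitions) present the real Clifford groups: every real Clifford circuit on $n$ qubits denotes an element of $\mathcal C_n$, every element of $\mathcal C_n$ is denoted by such a circuit, and two such circuits denote the same operator if and only if they are related by a finite sequence of applications of the relations in either direction (at any offset, within any circuit). -/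

import Mathlib

namespace RealStab

/-! ## Untyped circuits over the scalar `-1` and the gates `H`, `Z`, `CZ`

Wires are numbered `0, 1, 2, …` from top to bottom. A gate is placed by giving its topmost wire; a
two-wire gate placed at `p` acts on the adjacent wires `p` and `p + 1`. A circuit is a scalar
`±1` together with the list of its gates, read from left to right. -/

/-- The generating gates. -/
inductive Prim
  | H | Z | CZ
  deriving DecidableEq

/-- The number of wires of a generating gate. -/
def Prim.arity : Prim → ℕ
  | .H => 1
  | .Z => 1
  | .CZ => 2

/-- A circuit over `-1`, `H`, `Z`, `CZ`. -/
abbrev PrimCircuit := ℤˣ × List (Prim × ℕ)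

/-- All gates of the circuit lie on the wires `0, …, n - 1`. -/
def PrimCircuit.OnWires (n : ℕ) (c : PrimCircuit) : Prop :=
  ∀ g ∈ c.2, g.2 + g.1.arity ≤ n

/-- Move a list of placed gates down by `k` wires. -/
def shift {G : Type} (k : ℕ) (l : List (G × ℕ)) : List (G × ℕ) :=
  l.map fun g => (g.1, k + g.2)

/-! ## Operators -/

/-- Real operators on `n` qubits, in the computational basis. -/
abbrev Op (n : ℕ) := Matrix (Fin n → Fin 2) (Fin n → Fin 2) ℝ

/-- The tensor product `M 0 ⊗ ⋯ ⊗ M (n - 1)`. -/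
def tensor {n : ℕ} (M : Fin n → Matrix (Fin 2) (Fin 2) ℝ) : Op n :=
  fun x y => ∏ i, M i (x i) (y i)

/-- The Pauli matrix `X`. -/
def matX : Matrix (Fin 2) (Fin 2) ℝ := !![0, 1; 1, 0]

/-- The Pauli matrix `Z`. -/
def matZ : Matrix (Fin 2) (Fin 2) ℝ := !![1, 0; 0, -1]

/-- The Hadamard matrix. -/
noncomputable def matH : Matrix (Fin 2) (Fin 2) ℝ := (1 / Real.sqrt 2) • !![1, 1; 1, -1]

/-- The operator of a generating gate placed at wire `p`; `CZ` is `diag(1, 1, 1, -1)` on the wires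
`p`, `p + 1`. -/
noncomputable def Prim.op (n : ℕ) : Prim × ℕ → Op n
  | (.H, p) => tensor fun i => if (i : ℕ) = p then matH else 1
  | (.Z, p) => tensor fun i => if (i : ℕ) = p then matZ else 1
  | (.CZ, p) => Matrix.diagonal fun x =>
      if ∀ i : Fin n, (i : ℕ) = p ∨ (i : ℕ) = p + 1 → x i = 1 then -1 else 1

/-- The operator of a list of gates; the leftmost gate is applied first. -/
noncomputable def opOfList (n : ℕ) : List (Prim × ℕ) → Op n
  | [] => 1
  | g :: l => opOfList n l * Prim.op n g

/-- The operator of a circuit. -/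
noncomputable def PrimCircuit.op (n : ℕ) (c : PrimCircuit) : Op n :=
  (((c.1 : ℤˣ) : ℤ) : ℝ) • opOfList n c.2

/-- The real Pauli group on `n` qubits. -/
def pauliGroup (n : ℕ) : Set (Op n) :=
  {P | ∃ (s : ℤˣ) (f : Fin n → Matrix (Fin 2) (Fin 2) ℝ),
    (∀ i, f i = 1 ∨ f i = matX ∨ f i = matZ ∨ f i = matX * matZ) ∧
      P = (((s : ℤˣ) : ℤ) : ℝ) • tensor f}

/-- The real Clifford group on `n` qubits: the normalizer of the Pauli group in the orthogonal
group. -/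
def cliffordGroup (n : ℕ) : Set (Op n) :=
  {U | U ∈ Matrix.orthogonalGroup (Fin n → Fin 2) ℝ ∧
    ∀ P ∈ pauliGroup n, U * P * U⁻¹ ∈ pauliGroup n}

/-! ## Typed circuits -/

/-- The type of a wire. -/
inductive WireType
  | single | double
  deriving DecidableEq

/-- Typed gates: `H`, `Z`, `X`, `CZ`, `CXZ`, whose parameter is the type of the (top) wire, and the
typed derived generators of kind `A`, `B`, `C`, `D`, `E`. -/
inductive Gate
  | H (t : WireType) | Z (t : WireType) | X (t : WireType) | CZ (t : WireType) | CXZ (t : WireType)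
  | A1 | A2 | A3
  | B1 | B2 | B3 | B4 | B5 | B6 | B7 | B8
  | C1 | C2
  | D1 | D2 | D3 | D4
  | E1 | E2
  deriving DecidableEq

/-- The gates `H`, `Z`, `X`, `CZ`, `CXZ` are dirty, those of kind `A`, `B`, `C`, `D`, `E` clean. -/
inductive Kind
  | dirty | A | B | C | D | E
  deriving DecidableEq

namespace Gate

open WireType

/-- The kind of a gate. -/
def kind : Gate → Kind
  | H _ | Z _ | X _ | CZ _ | CXZ _ => .dirty
  | A1 | A2 | A3 => .A
  | B1 | B2 | B3 | B4 | B5 | B6 | B7 | B8 => .B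
  | C1 | C2 => .C
  | D1 | D2 | D3 | D4 => .D
  | E1 | E2 => .E

/-- The types of the input wires, from top to bottom. -/
def inp : Gate → List WireType
  | H t | Z t | X t => [t]
  | CZ t | CXZ t => [t, single]
  | A1 | A2 | A3 => [single]
  | B1 | B2 | B3 | B4 => [single, single]
  | B5 | B6 | B7 | B8 => [single, double]
  | C1 | C2 => [single]
  | D1 | D2 | D3 | D4 => [single, single]
  | E1 | E2 => [single]

/-- The types of the output wires, from top to bottom. -/
def out : Gate → List WireType
  | H t | Z t | X t => [t]
  | CZ t | CXZ t => [t, single]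
  | A1 | A2 => [single]
  | A3 => [double]
  | B1 | B2 | B3 | B8 => [single, single]
  | B4 | B5 | B6 | B7 => [double, single]
  | C1 | C2 => [single]
  | D1 | D2 | D3 | D4 => [single, single]
  | E1 | E2 => [single]

/-- The definition of a gate as an untyped circuit. -/
def expand : Gate → List (Prim × ℕ)
  | H _ => [(.H, 0)]
  | Z _ => [(.Z, 0)]
  | X _ => [(.H, 0), (.Z, 0), (.H, 0)]
  | CZ _ => [(.CZ, 0)]
  | CXZ _ => [(.H, 0), (.CZ, 0), (.H, 0), (.CZ, 0)]
  | A1 | A3 => []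
  | A2 => [(.H, 0)]
  | B1 | B5 => [(.H, 1), (.CZ, 0), (.H, 1), (.H, 0), (.CZ, 0), (.H, 1), (.H, 0), (.CZ, 0)]
  | B2 | B6 => [(.CZ, 0), (.H, 1), (.H, 0), (.CZ, 0)]
  | B3 | B7 => [(.H, 0), (.CZ, 0), (.H, 1), (.H, 0), (.CZ, 0)]
  | B4 | B8 => [(.H, 1), (.CZ, 0), (.H, 1), (.CZ, 0), (.H, 1), (.H, 0), (.CZ, 0)]
  | C1 => []
  | C2 => [(.H, 0), (.Z, 0), (.H, 0)]
  | D1 => [(.CZ, 0), (.H, 1), (.H, 0), (.CZ, 0), (.H, 1), (.H, 0), (.CZ, 0), (.H, 1)]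
  | D2 => [(.H, 0), (.CZ, 0), (.H, 1), (.H, 0), (.CZ, 0), (.H, 1)]
  | D3 => [(.H, 1), (.H, 0), (.CZ, 0), (.H, 1), (.H, 0), (.CZ, 0), (.H, 1)]
  | D4 => [(.H, 0), (.CZ, 0), (.H, 1), (.H, 0), (.CZ, 0), (.H, 1), (.CZ, 0)]
  | E1 => []
  | E2 => [(.Z, 0)]

/-- A generating gate, viewed as a typed gate on wires of single type. -/
def ofPrim : Prim → Gate
  | .H => H single
  | .Z => Z single
  | .CZ => CZ single

end Gate

/-- A list of placed typed gates. -/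
abbrev GateList := List (Gate × ℕ)

/-- A circuit of typed gates, with its scalar. -/
abbrev Circuit := ℤˣ × GateList

/-- `HasType σ l τ`: the gates of `l` can be composed from left to right, the wires having the types
`σ` on the left and `τ` on the right. -/
inductive HasType : List WireType → GateList → List WireType → Prop
  | nil (σ : List WireType) : HasType σ [] σ
  | cons (σ ρ τ : List WireType) (g : Gate) (l : GateList) :
      HasType (σ ++ g.out ++ ρ) l τ → HasType (σ ++ g.inp ++ ρ) ((g, σ.length) :: l) τ

/-- A well-formed typed circuit on `n` wires whose outer wires all are of single type. -/
def WellTyped (n : ℕ) (l : GateList) : Prop :=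
  HasType (List.replicate n .single) l (List.replicate n .single)

/-- Forget the types and replace every gate by its definition. -/
def forget (l : GateList) : List (Prim × ℕ) :=
  l.flatMap fun g => shift g.2 g.1.expand

/-- The operator of a typed circuit. -/
noncomputable def Circuit.op (n : ℕ) (c : Circuit) : Op n :=
  PrimCircuit.op n (c.1, forget c.2)

/-- A circuit over `-1`, `H`, `Z`, `CZ`, viewed as a typed circuit with wires of single type. -/
def PrimCircuit.toCircuit (c : PrimCircuit) : Circuit :=
  (c.1, c.2.map fun g => (Gate.ofPrim g.1, g.2))

/-! ## Normal forms -/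

/-- The gates `b₁, …, b_m` placed at the wires `m - 1, …, 0`. -/
def ascending : List Gate → GateList
  | [] => []
  | b :: bs => (b, bs.length) :: ascending bs

/-- The gates `d₁, …, d_m` placed at the wires `i, …, i + m - 1`. -/
def descending (i : ℕ) : List Gate → GateList
  | [] => []
  | d :: ds => (d, i) :: descending (i + 1) ds

/-- `Z`-circuits: an `A` gate on some wire `m`, then `B` gates on the wires `(m - 1, m), …, (0, 1)`,
then a `C` gate on wire `0`, with matching types. -/
def IsZCircuit (n : ℕ) (l : GateList) : Prop :=
  ∃ (a : Gate) (bs : List Gate) (c : Gate),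
    a.kind = .A ∧ (∀ b ∈ bs, b.kind = .B) ∧ c.kind = .C ∧ bs.length < n ∧
      l = (a, bs.length) :: ascending bs ++ [(c, 0)] ∧ WellTyped n l

/-- `X`-circuits: `D` gates on the wires `(0, 1), …, (n - 2, n - 1)`, then an `E` gate on wire
`n - 1`. -/
def IsXCircuit (n : ℕ) (l : GateList) : Prop :=
  ∃ (ds : List Gate) (e : Gate),
    (∀ d ∈ ds, d.kind = .D) ∧ e.kind = .E ∧ ds.length + 1 = n ∧
      l = descending 0 ds ++ [(e, ds.length)]

/-- The gates of a normal circuit: `L_n M_n L_{n-1} M_{n-1} ⋯ L_1 M_1`, where `L_i` is a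
`Z`-circuit and `M_i` an `X`-circuit on the `i` topmost wires. -/
inductive IsNormalList : ℕ → GateList → Prop
  | zero : IsNormalList 0 []
  | succ (n : ℕ) (L M N : GateList) :
      IsZCircuit (n + 1) L → IsXCircuit (n + 1) M → IsNormalList n N →
        IsNormalList (n + 1) (L ++ M ++ N)

/-- Normal circuits on `n` wires, with an arbitrary scalar `±1`. -/
def IsNormal (n : ℕ) (c : Circuit) : Prop := IsNormalList n c.2

/-- `N` is a normal form of the operator `U`. -/
def IsNormalFormOf (n : ℕ) (N : Circuit) (U : Op n) : Prop :=
  IsNormal n N ∧ N.op n = U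

/-! ## Dirty normal forms -/

/-- The labels of the wire segments of a normal form; `final` is for segments without label. -/
inductive Label
  | l1 | l2 | l3 | l4 | final
  deriving DecidableEq

/-- The labels of the wires after a clean gate; dirty gates do not change labels. -/
def relabel (f : ℕ → Label) (g : Gate × ℕ) : ℕ → Label :=
  match g.1.kind with
  | .dirty => f
  | .A => Function.update f g.2 .l2
  | .B => Function.update (Function.update f g.2 .l2) (g.2 + 1) .l1
  | .C => Function.update f g.2 .l3
  | .D => Function.update (Function.update f g.2 .l1) (g.2 + 1) .l4
  | .E => Function.update f g.2 .final

/-- The labels of the wires of an `n`-wire circuit to the right of the gates of `l`; at the very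
left all wires are labelled 1. -/
def labels (n : ℕ) (l : GateList) : ℕ → Label :=
  l.foldl relabel fun j => if j < n then .l1 else .final

/-- Where a dirty gate can be placed, given the labels. -/
def Allowed (f : ℕ → Label) : Gate × ℕ → Prop
  | (.H t, p) => f p = .l1 ∨ (f p = .l2 ∧ t = .double)
  | (.Z _, p) => f p = .l1 ∨ f p = .l2 ∨ f p = .l3 ∨ f p = .l4
  | (.X _, p) => f p = .l1 ∨ f p = .l2
  | (.CZ t, p) => f (p + 1) = .l1 ∧ (f p = .l1 ∨ f p = .l3 ∨ (f p = .l2 ∧ t = .single))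
  | (.CXZ t, p) => f (p + 1) = .l1 ∧ f p = .l2 ∧ t = .double
  | _ => False

/-- Dirty normal forms: normal forms to which dirty gates were added at allowed places. -/
def IsDirtyNormal (n : ℕ) (c : Circuit) : Prop :=
  IsNormalList n (c.2.filter fun g => g.1.kind ≠ .dirty) ∧ WellTyped n c.2 ∧
    ∀ (u v : GateList) (g : Gate × ℕ), c.2 = u ++ g :: v → g.1.kind = .dirty →
      Allowed (labels n u) g

/-! ## The typed relations -/

/-- A relation `lhs = sgn · rhs` between typed circuits on `width` wires. -/
structure CircuitRelation where
  width : ℕ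
  lhs : GateList
  sgn : ℤˣ
  rhs : GateList

/-- A relation without scalar. -/
def eqn (w : ℕ) (l r : GateList) : CircuitRelation := ⟨w, l, 1, r⟩

/-- Dirty gates on wires of single type. -/
abbrev h (p : ℕ) : Gate × ℕ := (.H .single, p)
abbrev z (p : ℕ) : Gate × ℕ := (.Z .single, p)
abbrev x (p : ℕ) : Gate × ℕ := (.X .single, p)
abbrev cz (p : ℕ) : Gate × ℕ := (.CZ .single, p)
abbrev cxz (p : ℕ) : Gate × ℕ := (.CXZ .single, p)

/-- Dirty gates on a (top) wire of double type. -/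
abbrev hd (p : ℕ) : Gate × ℕ := (.H .double, p)
abbrev zd (p : ℕ) : Gate × ℕ := (.Z .double, p)
abbrev xd (p : ℕ) : Gate × ℕ := (.X .double, p)
abbrev cxzd (p : ℕ) : Gate × ℕ := (.CXZ .double, p)

section

open Gate

/-- The 137 typed relations that push a dirty gate through clean gates. -/
def pushRelations : List CircuitRelation := [
  -- `Z` or `H` in front of an `A` gate
  eqn 1 [z 0, (A1, 0)] [(A1, 0), z 0],
  eqn 1 [z 0, (A2, 0)] [(A2, 0), x 0],
  eqn 1 [z 0, (A3, 0)] [(A3, 0), zd 0],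
  eqn 1 [h 0, (A1, 0)] [(A2, 0)],
  eqn 1 [h 0, (A2, 0)] [(A1, 0)],
  eqn 1 [h 0, (A3, 0)] [(A3, 0), hd 0],
  -- `CZ` whose top wire enters an `A` gate
  eqn 2 [cz 0, (A1, 0)] [(A1, 0), cz 0],
  eqn 2 [cz 0, (A2, 0)] [(A1, 1), (B2, 0), cz 0, h 1],
  eqn 2 [cz 0, (A3, 0)] [(A1, 1), (B4, 0), hd 0, cxzd 0, h 1, zd 0],
  -- `CZ` whose bottom wire enters an `A` gate that is followed by a `B` gate
  eqn 2 [cz 0, (A1, 1), (B1, 0)] [(A1, 1), (B1, 0), h 1, cz 0, h 1],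
  eqn 2 [cz 0, (A2, 1), (B1, 0)] [(A2, 1), (B3, 0)],
  eqn 2 [cz 0, (A1, 1), (B2, 0)] [(A2, 0), h 1, cz 0],
  eqn 2 [cz 0, (A2, 1), (B2, 0)] [(A3, 1), (B8, 0), cz 0, h 1, cz 0, x 0, z 1],
  eqn 2 [cz 0, (A1, 1), (B3, 0)] [(A1, 1), (B3, 0), h 1, cz 0, h 1, x 1],
  eqn 2 [cz 0, (A2, 1), (B3, 0)] [(A2, 1), (B1, 0)],
  eqn 2 [cz 0, (A1, 1), (B4, 0)] [(A3, 0), h 1, cxzd 0, zd 0, hd 0],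
  eqn 2 [cz 0, (A2, 1), (B4, 0)] [(A3, 1), (B6, 0), cxzd 0, h 1, cxzd 0, zd 0, x 1],
  eqn 2 [cz 0, (A3, 1), (B5, 0)] [(A3, 1), (B7, 0), h 1, cxzd 0, h 1],
  eqn 2 [cz 0, (A3, 1), (B6, 0)] [(A2, 1), (B4, 0), h 1, cxzd 0, h 1, hd 0],
  eqn 2 [cz 0, (A3, 1), (B7, 0)] [(A3, 1), (B5, 0), h 1, cxzd 0, h 1, x 1],
  eqn 2 [cz 0, (A3, 1), (B8, 0)] [(A2, 1), (B2, 0), cz 0, h 1, cz 0, x 0, z 1],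
  -- `H` on the bottom wire of a `B` gate
  eqn 2 [hd 1, (B5, 0)] [(B5, 0), hd 0],
  eqn 2 [hd 1, (B6, 0)] [(B6, 0), cxzd 0, h 1, cxzd 0, zd 0, x 1],
  eqn 2 [hd 1, (B7, 0)] [(B7, 0), cxzd 0, h 1, cxzd 0, zd 0, x 1],
  eqn 2 [hd 1, (B8, 0)] [(B8, 0), cz 0, h 1, cz 0, x 0, z 1],
  -- `X` on the bottom wire of a `B` gate
  eqn 2 [x 1, (B1, 0)] [(B1, 0), x 0],
  eqn 2 [x 1, (B2, 0)] [(B2, 0), x 0],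
  eqn 2 [x 1, (B3, 0)] [(B3, 0), x 0],
  eqn 2 [x 1, (B4, 0)] [(B4, 0), xd 0],
  eqn 2 [xd 1, (B5, 0)] [(B5, 0), xd 0],
  eqn 2 [xd 1, (B6, 0)] [(B6, 0), xd 0],
  eqn 2 [xd 1, (B7, 0)] [(B7, 0), xd 0],
  eqn 2 [xd 1, (B8, 0)] [(B8, 0), x 0],
  -- `H` on the top wire of a `B` gate
  eqn 2 [h 0, (B1, 0)] [(B1, 0), h 1],
  eqn 2 [h 0, (B2, 0)] [(B3, 0)],
  eqn 2 [h 0, (B3, 0)] [(B2, 0)],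
  eqn 2 [h 0, (B4, 0)] [(B4, 0), h 1, xd 0],
  eqn 2 [h 0, (B5, 0)] [(B5, 0), h 1],
  eqn 2 [h 0, (B6, 0)] [(B7, 0)],
  eqn 2 [h 0, (B7, 0)] [(B6, 0)],
  eqn 2 [h 0, (B8, 0)] [(B8, 0), h 1, x 0],
  -- `Z` on the top wire of a `B` gate
  eqn 2 [z 0, (B1, 0)] [(B1, 0), x 1],
  eqn 2 [z 0, (B2, 0)] [(B2, 0), x 0, z 1],
  eqn 2 [z 0, (B3, 0)] [(B3, 0), x 1],
  eqn 2 [z 0, (B4, 0)] [(B4, 0), xd 0, z 1],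
  eqn 2 [z 0, (B5, 0)] [(B5, 0), x 1],
  eqn 2 [z 0, (B6, 0)] [(B6, 0), xd 0, z 1],
  eqn 2 [z 0, (B7, 0)] [(B7, 0), x 1],
  eqn 2 [z 0, (B8, 0)] [(B8, 0), x 0, z 1],
  -- `Z` on the bottom wire of a `B` gate
  eqn 2 [z 1, (B1, 0)] [(B1, 0), z 0],
  eqn 2 [z 1, (B2, 0)] [(B2, 0), z 0, x 1],
  eqn 2 [z 1, (B3, 0)] [(B3, 0), z 0, x 1],
  eqn 2 [z 1, (B4, 0)] [(B4, 0), z 1, xd 0, zd 0, x 1],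
  eqn 2 [zd 1, (B5, 0)] [(B5, 0), zd 0],
  eqn 2 [zd 1, (B6, 0)] [(B6, 0), zd 0, x 1],
  eqn 2 [zd 1, (B7, 0)] [(B7, 0), zd 0, x 1],
  eqn 2 [zd 1, (B8, 0)] [(B8, 0), z 1, x 0, z 0, x 1],
  -- dirty gates in front of a `C` gate
  eqn 1 [z 0, (C1, 0)] [(C1, 0), z 0],
  eqn 1 [x 0, (C1, 0)] [(C2, 0)],
  eqn 2 [cz 0, (C1, 0)] [(C1, 0), cz 0],
  { width := 1, lhs := [z 0, (C2, 0)], sgn := -1, rhs := [(C2, 0), z 0] },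
  eqn 1 [x 0, (C2, 0)] [(C1, 0)],
  eqn 2 [cz 0, (C2, 0)] [(C2, 0), cz 0, z 1],
  -- `CZ` or `CXZ` whose top wire is the bottom wire of a `B` gate
  eqn 3 [cz 1, (B1, 0)] [(B1, 0), cz 0, h 1, cz 1, h 1, cz 0, h 1, cz 1, h 1],
  eqn 3 [cz 1, (B2, 0)] [(B2, 0), cz 0, h 1, cz 1, h 1, cz 0],
  eqn 3 [cz 1, (B3, 0)] [(B3, 0), cz 0, h 1, cz 1, h 1, cz 0],
  eqn 3 [cz 1, (B4, 0)] [(B4, 0), h 2, cz 1, h 1, h 2, cz 1, h 1, cxzd 0, h 1, cz 1, h 1, h 2, cz 1, h 2, cxz 1, z 2],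
  eqn 3 [cxzd 1, (B5, 0)] [(B5, 0), h 2, cz 1, h 2, h 1, cz 1, h 1, cxzd 0, h 1, cz 1, h 1, h 2, cz 1, h 2],
  eqn 3 [cxzd 1, (B6, 0)] [(B6, 0), h 2, cz 1, h 2, h 1, cz 1, h 1, cxzd 0, h 1, cz 1, h 1, h 2, cz 1, h 2, h 1, cz 1, h 1],
  eqn 3 [cxzd 1, (B7, 0)] [(B7, 0), h 2, cz 1, h 2, h 1, cz 1, h 1, cxzd 0, h 1, cz 1, h 1, h 2, cz 1, h 2, h 1, cz 1, h 1],
  eqn 3 [cxzd 1, (B8, 0)] [(B8, 0), h 2, cz 1, h 2, h 1, cz 1, h 1, cz 0, h 1, cz 1, h 1, h 2, cz 1, h 2, h 1, cz 1, h 1, cz 1, z 2],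
  -- `CZ` in front of two `B` gates
  eqn 3 [cz 0, (B1, 1), (B1, 0)] [(B1, 1), (B1, 0), h 2, h 1, cz 1, h 2, h 1],
  eqn 3 [cz 0, (B1, 1), (B2, 0)] [(B3, 1), (B2, 0), h 2, cz 1, h 2],
  eqn 3 [cz 0, (B1, 1), (B3, 0)] [(B1, 1), (B3, 0), h 2, h 1, cz 1, h 2, h 1],
  eqn 3 [cz 0, (B1, 1), (B4, 0)] [(B3, 1), (B4, 0), h 2, cz 1, h 2],
  eqn 3 [cz 0, (B2, 1), (B1, 0)] [(B2, 1), (B3, 0), h 1, cz 1, h 1],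
  eqn 3 [cz 0, (B2, 1), (B2, 0)] [(B4, 1), (B8, 0), x 0, cz 1],
  eqn 3 [cz 0, (B2, 1), (B3, 0)] [(B2, 1), (B1, 0), h 1, cz 1, h 1],
  eqn 3 [cz 0, (B2, 1), (B4, 0)] [(B4, 1), (B6, 0), xd 0, cz 1],
  eqn 3 [cz 0, (B3, 1), (B1, 0)] [(B3, 1), (B1, 0), h 2, h 1, cz 1, h 2, h 1],
  eqn 3 [cz 0, (B3, 1), (B2, 0)] [(B1, 1), (B2, 0), h 2, cz 1, h 2],
  eqn 3 [cz 0, (B3, 1), (B3, 0)] [(B3, 1), (B3, 0), h 2, h 1, cz 1, h 2, h 1],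
  eqn 3 [cz 0, (B3, 1), (B4, 0)] [(B1, 1), (B4, 0), h 2, cz 1, h 2],
  eqn 3 [cz 0, (B4, 1), (B5, 0)] [(B4, 1), (B7, 0), h 1, cz 1, h 1],
  eqn 3 [cz 0, (B4, 1), (B6, 0)] [(B2, 1), (B4, 0), xd 0, cz 1],
  eqn 3 [cz 0, (B4, 1), (B7, 0)] [(B4, 1), (B5, 0), h 1, cz 1, h 1],
  eqn 3 [cz 0, (B4, 1), (B8, 0)] [(B2, 1), (B2, 0), x 0, cz 1],
  eqn 3 [cz 0, (B5, 1), (B5, 0)] [(B5, 1), (B5, 0), h 2, h 1, cz 1, h 2, h 1],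
  eqn 3 [cz 0, (B5, 1), (B6, 0)] [(B7, 1), (B6, 0), h 2, cz 1, h 2],
  eqn 3 [cz 0, (B5, 1), (B7, 0)] [(B5, 1), (B7, 0), h 2, h 1, cz 1, h 2, h 1],
  eqn 3 [cz 0, (B5, 1), (B8, 0)] [(B7, 1), (B8, 0), h 2, cz 1, h 2],
  eqn 3 [cz 0, (B6, 1), (B5, 0)] [(B6, 1), (B7, 0), h 1, cz 1, h 1],
  eqn 3 [cz 0, (B6, 1), (B6, 0)] [(B8, 1), (B4, 0), xd 0, cz 1],
  eqn 3 [cz 0, (B6, 1), (B7, 0)] [(B6, 1), (B5, 0), h 1, cz 1, h 1],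
  eqn 3 [cz 0, (B6, 1), (B8, 0)] [(B8, 1), (B2, 0), x 0, cz 1],
  eqn 3 [cz 0, (B7, 1), (B5, 0)] [(B7, 1), (B5, 0), h 2, h 1, cz 1, h 2, h 1],
  eqn 3 [cz 0, (B7, 1), (B6, 0)] [(B5, 1), (B6, 0), h 2, cz 1, h 2],
  eqn 3 [cz 0, (B7, 1), (B7, 0)] [(B7, 1), (B7, 0), h 2, h 1, cz 1, h 2, h 1],
  eqn 3 [cz 0, (B7, 1), (B8, 0)] [(B5, 1), (B8, 0), h 2, cz 1, h 2],
  eqn 3 [cz 0, (B8, 1), (B1, 0)] [(B8, 1), (B3, 0), h 1, cz 1, h 1],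
  eqn 3 [cz 0, (B8, 1), (B2, 0)] [(B6, 1), (B8, 0), x 0, cz 1],
  eqn 3 [cz 0, (B8, 1), (B3, 0)] [(B8, 1), (B1, 0), h 1, cz 1, h 1],
  eqn 3 [cz 0, (B8, 1), (B4, 0)] [(B6, 1), (B6, 0), xd 0, cz 1],
  -- `Z` in front of a `D` gate
  eqn 2 [z 0, (D1, 0)] [(D1, 0), z 1],
  eqn 2 [z 0, (D2, 0)] [(D2, 0), z 1],
  eqn 2 [z 0, (D3, 0)] [(D3, 0), z 1],
  eqn 2 [z 0, (D4, 0)] [(D4, 0), z 1],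
  eqn 2 [z 1, (D1, 0)] [(D1, 0), h 0, z 0, h 0],
  eqn 2 [z 1, (D2, 0)] [(D2, 0), z 0, z 1],
  eqn 2 [z 1, (D3, 0)] [(D3, 0), h 0, z 0, h 0],
  eqn 2 [z 1, (D4, 0)] [(D4, 0), z 1, z 0],
  -- `H` in front of a `D` gate
  eqn 2 [h 1, (D1, 0)] [(D1, 0), h 0],
  eqn 2 [h 1, (D2, 0)] [(D3, 0)],
  eqn 2 [h 1, (D3, 0)] [(D2, 0)],
  eqn 2 [h 1, (D4, 0)] [(D4, 0), z 1, h 0],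
  -- `CZ` in front of a `D` gate
  eqn 2 [cz 0, (D1, 0)] [(D3, 0)],
  eqn 2 [cz 0, (D2, 0)] [(D4, 0), z 1],
  eqn 2 [cz 0, (D3, 0)] [(D1, 0)],
  eqn 2 [cz 0, (D4, 0)] [(D2, 0), z 1],
  -- `Z` in front of an `E` gate
  eqn 1 [z 0, (E1, 0)] [(E2, 0)],
  eqn 1 [z 0, (E2, 0)] [(E1, 0)],
  -- `CZ` in front of two `D` gates
  eqn 3 [cz 1, (D1, 0), (D1, 1)] [(D1, 0), (D1, 1), h 0, h 1, cz 0, h 0, h 1],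
  eqn 3 [cz 1, (D1, 0), (D2, 1)] [(D3, 0), (D2, 1), h 0, cz 0, h 0],
  eqn 3 [cz 1, (D1, 0), (D3, 1)] [(D1, 0), (D3, 1), h 0, h 1, cz 0, h 0, h 1],
  eqn 3 [cz 1, (D1, 0), (D4, 1)] [(D3, 0), (D4, 1), h 0, cz 0, h 0],
  eqn 3 [cz 1, (D2, 0), (D1, 1)] [(D2, 0), (D3, 1), h 1, cz 0, h 1],
  eqn 3 [cz 1, (D2, 0), (D2, 1)] [(D4, 0), (D4, 1), cz 0, z 2],
  eqn 3 [cz 1, (D2, 0), (D3, 1)] [(D2, 0), (D1, 1), h 1, cz 0, h 1],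
  eqn 3 [cz 1, (D2, 0), (D4, 1)] [(D4, 0), (D2, 1), cz 0, z 2],
  eqn 3 [cz 1, (D3, 0), (D1, 1)] [(D3, 0), (D1, 1), h 0, h 1, cz 0, h 0, h 1],
  eqn 3 [cz 1, (D3, 0), (D2, 1)] [(D1, 0), (D2, 1), h 0, cz 0, h 0],
  eqn 3 [cz 1, (D3, 0), (D3, 1)] [(D3, 0), (D3, 1), h 0, h 1, cz 0, h 0, h 1],
  eqn 3 [cz 1, (D3, 0), (D4, 1)] [(D1, 0), (D4, 1), h 0, cz 0, h 0],
  eqn 3 [cz 1, (D4, 0), (D1, 1)] [(D4, 0), (D3, 1), h 1, cz 0, h 1],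
  eqn 3 [cz 1, (D4, 0), (D2, 1)] [(D2, 0), (D4, 1), cz 0, z 2],
  eqn 3 [cz 1, (D4, 0), (D3, 1)] [(D4, 0), (D1, 1), h 1, cz 0, h 1],
  eqn 3 [cz 1, (D4, 0), (D4, 1)] [(D2, 0), (D2, 1), cz 0, z 2] ]

/-- The two typed relations that create clean gates: a wire is `A1 C1 E1`, and a `C1` gate with a
free wire above it is `B1 C1 D1`. -/
def expansionRelations : List CircuitRelation := [
  eqn 1 [] [(A1, 0), (C1, 0), (E1, 0)],
  eqn 2 [(C1, 1)] [(B1, 0), (C1, 0), (D1, 0)] ]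

end

/-- The typed relations. -/
def typedRelations : List CircuitRelation := pushRelations ++ expansionRelations

set_option maxRecDepth 4000 in
theorem typedRelations_length : typedRelations.length = 139 := rfl

/-! ## Rewriting -/

/-- One rewriting step on `n` wires with the relations `R`: a relation applied from left to right
to some adjacent wires inside a circuit, the exchange of two neighbouring gates on disjoint wires
(which does not change the circuit diagram), or the replacement of one of the shorthands `X`, `CXZ`
by its definition. -/
inductive Step (R : List CircuitRelation) (n : ℕ) : Circuit → Circuit → Prop
  | rel (r : CircuitRelation) (k : ℕ) (s : ℤˣ) (u v : GateList) : r ∈ R → k + r.width ≤ n →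
      Step R n (s, u ++ shift k r.lhs ++ v) (s * r.sgn, u ++ shift k r.rhs ++ v)
  | exchange (a b : Gate × ℕ) (s : ℤˣ) (u v : GateList) :
      a.2 + a.1.inp.length ≤ b.2 ∨ b.2 + b.1.inp.length ≤ a.2 →
      Step R n (s, u ++ [a, b] ++ v) (s, u ++ [b, a] ++ v)
  | unfoldX (t : WireType) (p : ℕ) (s : ℤˣ) (u v : GateList) :
      Step R n (s, u ++ [(.X t, p)] ++ v) (s, u ++ [(.H t, p), (.Z t, p), (.H t, p)] ++ v)
  | unfoldCXZ (t : WireType) (p : ℕ) (s : ℤˣ) (u v : GateList) :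
      Step R n (s, u ++ [(.CXZ t, p)] ++ v)
        (s, u ++ [(.H t, p), (.CZ t, p), (.H t, p), (.CZ t, p)] ++ v)

/-- Rewriting of well-formed typed circuits in finitely many steps. -/
def Rewrites (R : List CircuitRelation) (n : ℕ) : Circuit → Circuit → Prop :=
  Relation.ReflTransGen fun c d => WellTyped n c.2 ∧ WellTyped n d.2 ∧ Step R n c d

/-- One application of a relation to untyped circuits on `n` wires, where types are forgotten and
derived gates are replaced by their definitions, or the exchange of two neighbouring gates on
disjoint wires. -/
inductive PrimStep (R : List CircuitRelation) (n : ℕ) : PrimCircuit → PrimCircuit → Prop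
  | rel (r : CircuitRelation) (k : ℕ) (s : ℤˣ) (u v : List (Prim × ℕ)) : r ∈ R → k + r.width ≤ n →
      PrimStep R n (s, u ++ shift k (forget r.lhs) ++ v)
        (s * r.sgn, u ++ shift k (forget r.rhs) ++ v)
  | exchange (a b : Prim × ℕ) (s : ℤˣ) (u v : List (Prim × ℕ)) :
      a.2 + a.1.arity ≤ b.2 ∨ b.2 + b.1.arity ≤ a.2 →
      PrimStep R n (s, u ++ [a, b] ++ v) (s, u ++ [b, a] ++ v)

/-- Equality of untyped circuits on `n` wires modulo the relations `R`. -/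
def EqualModulo (R : List CircuitRelation) (n : ℕ) : PrimCircuit → PrimCircuit → Prop :=
  Relation.EqvGen (PrimStep R n)

end RealStab

namespace RealStab

open Matrix

/-! ## The action of the generating gates on vectors -/

/-! Uniqueness and existence of normal forms come from conjugating Pauli operators. Let `U` be
Clifford on `n + 1` wires and put `P = U⁻¹ Z_n U`, where `Z_n` is `Z` on the last wire. Then `P` is
a Pauli operator with `P² = 1` and `P ≠ ±1`. A `Z`-circuit encodes exactly such an operator: `A`
reads the last letter different from `I`, the `B` gates read the letters above it from bottom to
top, and `C` reads the sign. Meanwhile the wire labelled 2 carries the letter `Z` if it is single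
and `Y = XZ` if it is double. Since `Y² = -1` while `P² = 1`, the letter that reaches wire 0 is `Z`,
as the typing demands. So exactly one `Z`-circuit `L` satisfies `L P = Z_0 L` (`exists_isZCircuit`,
`IsZCircuit.unique`). Now `V = U L⁻¹` takes `Z_0` to `Z_n`, and `Q = V⁻¹ X_n V` is a Pauli operator
with `Q² = 1` that anticommutes with `Z_0`. Its first letter is thus `X` or `Y`. The `D` gates read
the other letters from top to bottom, `E` reads the sign, and exactly one `X`-circuit `M` satisfies
`M Q = X_n M` (`exists_isXCircuit`, `IsXCircuit.unique`). Every `X`-circuit takes `Z_0` to `Z_n`, so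
`V M⁻¹` commutes with both `X_n` and `Z_n`. It therefore has the form `T ⊗ 1` (`exists_addWire`),
and induction applies to `T`.

For rewriting, a normal list is viewed as an accepted path of an automaton whose states record the
labels and types of the wires. A dirty gate in front of such a path either slides past the first
clean gate or overlaps it. In the second case a push relation replaces the dirty gate and one or two
clean gates by clean gates leading to the same state, followed by admissible dirty gates. The
finitely many overlaps are checked by computation on at most three wires (`criticalABD_covered`,
`criticalC_covered`, `criticalE_covered`). The dirty gates that come out stand before a state of
smaller rank, so well-founded induction absorbs them (`State.absorbs_of_pushable`). This makes dirty
normal forms clean. An arbitrary circuit is treated by first appending the normal form of the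
identity, created by the two expansion relations (`rewrites_identityNormal`).

Each relation is sound by exact integer arithmetic (`typedRelations_checkEq`) and holds at every
offset by `SameOp.shift`. Conversely, two circuits with the same operator rewrite to normal forms of
that operator, and these coincide. This is completeness. -/

/-- The operator `M` on wire `p`, and the identity on the other wires. -/
def onWire (n p : ℕ) (M : Matrix (Fin 2) (Fin 2) ℝ) : Op n :=
  tensor fun i => if (i : ℕ) = p then M else 1

theorem onWire_apply {n : ℕ} (p : Fin n) (M : Matrix (Fin 2) (Fin 2) ℝ) (x y : Fin n → Fin 2) :
    onWire n p M x y = if y = Function.update x p (y p) then M (x p) (y p) else 0 := by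
  unfold onWire tensor
  split_ifs with hxy
  · rw [Finset.prod_eq_single p]
    · simp
    · intro i _ hi
      have hyi : y i = x i := by rw [hxy, Function.update_of_ne hi]
      simp only [Fin.val_inj, hi, if_false, hyi, one_apply_eq]
    · simp
  · have : ∃ i, i ≠ p ∧ x i ≠ y i := by
      by_contra! hc
      apply hxy
      ext i
      by_cases hi : i = p
      · subst hi; simp
      · simp [hi, hc i hi]
    obtain ⟨i, hi, hne⟩ := this
    apply Finset.prod_eq_zero (Finset.mem_univ i)
    simp [hi, Fin.val_inj, hne]

/-- A row of this operator is supported on the two indices obtained from `x` by choosing bit `p`, so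
the sum over all indices collapses. -/
theorem onWire_mulVec {n : ℕ} (p : Fin n) (M : Matrix (Fin 2) (Fin 2) ℝ)
    (f : (Fin n → Fin 2) → ℝ) (x : Fin n → Fin 2) :
    (onWire n p M *ᵥ f) x = ∑ j, M (x p) j * f (Function.update x p j) := by
  have hinj : Function.Injective fun j => Function.update x p j :=
    Function.update_injective x p
  rw [mulVec, dotProduct, ← Finset.sum_subset (Finset.subset_univ
    (Finset.univ.map ⟨fun j => Function.update x p j, hinj⟩)), Finset.sum_map]
  · refine Finset.sum_congr rfl fun j _ => ?_
    simp [onWire_apply]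
  · intro y _ hy
    rw [onWire_apply, if_neg, zero_mul]
    intro h
    exact hy (Finset.mem_map.2 ⟨y p, Finset.mem_univ _, h.symm⟩)

/-- Here and in the next two lemmas the signs are `if`s on bits, so that the same formulas reappear
for windows and for integer vectors and can be compared by transitivity. -/
theorem H_mulVec {n : ℕ} (p : Fin n) (f : (Fin n → Fin 2) → ℝ) (x : Fin n → Fin 2) :
    (Prim.op n (.H, p) *ᵥ f) x = (√2)⁻¹ *
      (f (Function.update x p 0) + (if x p = 0 then 1 else -1) * f (Function.update x p 1)) := by
  have h : Prim.op n (.H, p) = onWire n p matH := rfl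
  rw [h, onWire_mulVec, Fin.sum_univ_two]
  generalize x p = a
  fin_cases a <;> simp [matH] <;> ring

theorem Z_mulVec {n : ℕ} (p : Fin n) (f : (Fin n → Fin 2) → ℝ) (x : Fin n → Fin 2) :
    (Prim.op n (.Z, p) *ᵥ f) x = (if x p = 0 then 1 else -1) * f x := by
  have h : Prim.op n (.Z, p) = onWire n p matZ := rfl
  rw [h, onWire_mulVec, Fin.sum_univ_two]
  conv_rhs => rw [← Function.update_eq_self p x]
  simp only [Function.update_self]
  generalize x p = a
  fin_cases a <;> simp [matZ]

/-- The second wire has to exist: for `p = n - 1` the condition defining the gate would constrain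
wire `p` alone and the operator would be a `Z`. -/
theorem CZ_mulVec {n : ℕ} (p q : Fin n) (hpq : (q : ℕ) = p + 1) (f : (Fin n → Fin 2) → ℝ)
    (x : Fin n → Fin 2) :
    (Prim.op n (.CZ, p) *ᵥ f) x = (if x p = 0 then 1 else if x q = 0 then 1 else -1) * f x := by
  simp only [Prim.op, mulVec_diagonal]
  congr 1
  have key : (∀ i : Fin n, (i : ℕ) = p ∨ (i : ℕ) = p + 1 → x i = 1) ↔ x p = 1 ∧ x q = 1 := by
    constructor
    · exact fun h => ⟨h p (Or.inl rfl), h q (Or.inr hpq)⟩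
    · rintro ⟨h1, h2⟩ i (hi | hi)
      · rwa [Fin.ext hi]
      · rwa [Fin.ext (hi.trans hpq.symm)]
  simp only [key]
  generalize x p = a
  generalize x q = b
  fin_cases a <;> fin_cases b <;> simp

/-! ## Windows of wires -/

/-- All gates of the list lie on the wires `0, …, w - 1`. -/
def Fits (w : ℕ) (l : List (Prim × ℕ)) : Prop := ∀ g ∈ l, g.2 + g.1.arity ≤ w

instance (w : ℕ) (l : List (Prim × ℕ)) : Decidable (Fits w l) :=
  inferInstanceAs (Decidable (∀ g ∈ l, g.2 + g.1.arity ≤ w))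

/-- Replace the bits `k, …, k + w - 1` of `x` by those of `b`. -/
def overwrite {n w : ℕ} (k : ℕ) (x : Fin n → Fin 2) (b : Fin w → Fin 2) : Fin n → Fin 2 :=
  fun i => if h : k ≤ i ∧ (i : ℕ) < k + w then b ⟨i - k, by omega⟩ else x i

/-- The bits `k, …, k + w - 1` of `x`. -/
def window {n w k : ℕ} (h : k + w ≤ n) (x : Fin n → Fin 2) : Fin w → Fin 2 :=
  fun i => x ⟨k + i, by omega⟩

theorem overwrite_window {n w k : ℕ} (h : k + w ≤ n) (x : Fin n → Fin 2) :
    overwrite k x (window h x) = x := by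
  ext i
  simp only [overwrite, window]
  split_ifs with hi
  · congr 3; omega
  · rfl

theorem overwrite_apply {n w k : ℕ} (h : k + w ≤ n) (x : Fin n → Fin 2) (b : Fin w → Fin 2)
    (i : Fin w) : overwrite k x b ⟨k + i, by omega⟩ = b i := by
  have : k ≤ k + (i : ℕ) ∧ k + (i : ℕ) < k + w := ⟨by omega, by omega⟩
  simp [overwrite]

theorem update_overwrite {n w k : ℕ} (h : k + w ≤ n) (x : Fin n → Fin 2) (b : Fin w → Fin 2)
    (i : Fin w) (v : Fin 2) :
    Function.update (overwrite k x b) ⟨k + i, by omega⟩ v =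
      overwrite k x (Function.update b i v) := by
  ext j
  by_cases hj : j = ⟨k + i, by omega⟩
  · subst hj
    simp [overwrite]
  · rw [Function.update_of_ne hj]
    simp only [overwrite]
    split_ifs with hk
    · rw [Function.update_of_ne]
      intro hc
      apply hj
      ext
      have := congrArg Fin.val hc
      simp at this ⊢
      omega
    · rfl

/-- Locality of gates: once the bits outside the window are frozen to those of `x`, a vector on `n`
wires becomes a vector on `w` wires, and a gate inside the window only sees the latter. -/
theorem op_mulVec_overwrite {n w k : ℕ} (h : k + w ≤ n) (g : Prim × ℕ)
    (hg : g.2 + g.1.arity ≤ w) (f : (Fin n → Fin 2) → ℝ) (x : Fin n → Fin 2)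
    (b : Fin w → Fin 2) :
    (Prim.op n (g.1, k + g.2) *ᵥ f) (overwrite k x b) =
      (Prim.op w g *ᵥ fun b => f (overwrite k x b)) b := by
  obtain ⟨g, p⟩ := g
  cases g with
  | H =>
    simp only [Prim.arity] at hg
    have h1 := H_mulVec (⟨k + p, by omega⟩ : Fin n) f (overwrite k x b)
    have h2 := H_mulVec (⟨p, by omega⟩ : Fin w) (fun b => f (overwrite k x b)) b
    have e := update_overwrite h x b ⟨p, by omega⟩
    have e' := overwrite_apply h x b ⟨p, by omega⟩
    simp only [e, e'] at h1
    exact h1.trans h2.symm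
  | Z =>
    simp only [Prim.arity] at hg
    have h1 := Z_mulVec (⟨k + p, by omega⟩ : Fin n) f (overwrite k x b)
    have h2 := Z_mulVec (⟨p, by omega⟩ : Fin w) (fun b => f (overwrite k x b)) b
    have e' := overwrite_apply h x b ⟨p, by omega⟩
    simp only [e'] at h1
    exact h1.trans h2.symm
  | CZ =>
    simp only [Prim.arity] at hg
    have h1 := CZ_mulVec (⟨k + p, by omega⟩ : Fin n) ⟨k + (p + 1), by omega⟩ (by simp; omega) f
      (overwrite k x b)
    have h2 := CZ_mulVec (⟨p, by omega⟩ : Fin w) ⟨p + 1, by omega⟩ rfl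
      (fun b => f (overwrite k x b)) b
    have e1 := overwrite_apply h x b ⟨p, by omega⟩
    have e2 := overwrite_apply h x b ⟨p + 1, by omega⟩
    simp only [e1, e2] at h1
    exact h1.trans h2.symm

theorem shift_cons {G : Type} (k : ℕ) (g : G × ℕ) (l : List (G × ℕ)) :
    shift k (g :: l) = (g.1, k + g.2) :: shift k l := rfl

theorem shift_append {G : Type} (k : ℕ) (l l' : List (G × ℕ)) :
    shift k (l ++ l') = shift k l ++ shift k l' := List.map_append

theorem shift_shift {G : Type} (j k : ℕ) (l : List (G × ℕ)) :
    shift j (shift k l) = shift (j + k) l := by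
  simp [shift, Function.comp_def, add_assoc]

@[simp] theorem shift_zero {G : Type} (l : List (G × ℕ)) : shift 0 l = l := by
  simp [shift]

theorem opOfList_mulVec_overwrite {n w k : ℕ} (h : k + w ≤ n) (l : List (Prim × ℕ))
    (hl : Fits w l) (f : (Fin n → Fin 2) → ℝ) (x : Fin n → Fin 2) (b : Fin w → Fin 2) :
    (opOfList n (shift k l) *ᵥ f) (overwrite k x b) =
      (opOfList w l *ᵥ fun b => f (overwrite k x b)) b := by
  induction l generalizing f with
  | nil => simp [shift, opOfList]
  | cons g l ih =>
    rw [shift_cons, opOfList, opOfList, ← mulVec_mulVec, ← mulVec_mulVec,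
      ih fun g' hg' => hl g' (List.mem_cons_of_mem _ hg')]
    congr 2
    funext b
    exact op_mulVec_overwrite h g (hl g List.mem_cons_self) f x b

theorem opOfList_append (n : ℕ) (l l' : List (Prim × ℕ)) :
    opOfList n (l ++ l') = opOfList n l' * opOfList n l := by
  induction l with
  | nil => simp [opOfList]
  | cons g l ih => simp [opOfList, ih, mul_assoc]

/-- The lists `l` and `s · l'` have the same operator on `n` wires. -/
def SameOp (n : ℕ) (s : ℤˣ) (l l' : List (Prim × ℕ)) : Prop :=
  opOfList n l = ((s : ℤ) : ℝ) • opOfList n l'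

theorem SameOp.trans {n : ℕ} {s t : ℤˣ} {a b c : List (Prim × ℕ)} (h : SameOp n s a b)
    (h' : SameOp n t b c) : SameOp n (s * t) a c := by
  rw [SameOp, h, h', smul_smul]
  simp

theorem SameOp.congr {n : ℕ} {s : ℤˣ} {a b : List (Prim × ℕ)} (h : SameOp n s a b)
    (u v : List (Prim × ℕ)) : SameOp n s (u ++ a ++ v) (u ++ b ++ v) := by
  simp only [SameOp, opOfList_append] at *
  simp [h]

/-- An index `x` is `overwrite k x` of its own window, so both operators can be evaluated on `w`
wires. This carries an identity on few wires over to any offset among `n` wires. -/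
theorem SameOp.shift {n w k : ℕ} {s : ℤˣ} {l l' : List (Prim × ℕ)} (hs : SameOp w s l l')
    (h : k + w ≤ n) (hl : Fits w l) (hl' : Fits w l') :
    SameOp n s (shift k l) (RealStab.shift k l') := by
  apply Matrix.ext_of_mulVec_single
  intro y
  generalize (Pi.single y 1 : (Fin n → Fin 2) → ℝ) = f
  funext x
  rw [← overwrite_window h x, opOfList_mulVec_overwrite h l hl, hs, smul_mulVec, smul_mulVec,
    Pi.smul_apply, Pi.smul_apply, opOfList_mulVec_overwrite h l' hl']

/-! ## Exact computation with integer vectors -/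

/-- Vectors of `2 ^ w` integers, as binary trees. -/
def QVec : ℕ → Type
  | 0 => ℤ
  | w + 1 => QVec w × QVec w

namespace QVec

/-- Scalar multiplication. -/
def smul (c : ℤ) : (w : ℕ) → QVec w → QVec w
  | 0, v => Int.mul c v
  | w + 1, v => (smul c w v.1, smul c w v.2)

/-- Addition. -/
def add : (w : ℕ) → QVec w → QVec w → QVec w
  | 0, u, v => Int.add u v
  | w + 1, u, v => (add w u.1 v.1, add w u.2 v.2)

/-- Equality test. -/
def beq : (w : ℕ) → QVec w → QVec w → Bool
  | 0, u, v => Int.instDecidableEq u v |>.decide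
  | w + 1, u, v => beq w u.1 v.1 && beq w u.2 v.2

/-- The zero vector. -/
def zero : (w : ℕ) → QVec w
  | 0 => (0 : ℤ)
  | w + 1 => (zero w, zero w)

/-- The standard basis. -/
def basis : (w : ℕ) → List (QVec w)
  | 0 => [(1 : ℤ)]
  | w + 1 => (basis w).map (fun v => (v, zero w)) ++ (basis w).map fun v => (zero w, v)

/-- The function of a vector. -/
def eval : (w : ℕ) → QVec w → (Fin w → Fin 2) → ℝ
  | 0, v, _ => Int.cast (R := ℝ) v
  | w + 1, v, x => if x 0 = 0 then eval w v.1 (Fin.tail x) else eval w v.2 (Fin.tail x)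

/-- The action of `√2 • H`. -/
def actH : (w : ℕ) → ℕ → QVec w → QVec w
  | 0, _, v => v
  | w + 1, 0, v => (add w v.1 v.2, add w v.1 (smul (-1) w v.2))
  | w + 1, p + 1, v => (actH w p v.1, actH w p v.2)

/-- The action of `Z`. -/
def actZ : (w : ℕ) → ℕ → QVec w → QVec w
  | 0, _, v => v
  | w + 1, 0, v => (v.1, smul (-1) w v.2)
  | w + 1, p + 1, v => (actZ w p v.1, actZ w p v.2)

/-- The action of `CZ`. -/
def actCZ : (w : ℕ) → ℕ → QVec w → QVec w
  | 0, _, v => v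
  | w + 1, 0, v => (v.1, actZ w 0 v.2)
  | w + 1, p + 1, v => (actCZ w p v.1, actCZ w p v.2)

/-- The action of a list of gates, with `√2 • H` in place of `H`. -/
def run (w : ℕ) : List (Prim × ℕ) → QVec w → QVec w
  | [], v => v
  | (.H, p) :: l, v => run w l (actH w p v)
  | (.Z, p) :: l, v => run w l (actZ w p v)
  | (.CZ, p) :: l, v => run w l (actCZ w p v)

theorem eval_smul (c : ℤ) (w : ℕ) (v : QVec w) (x : Fin w → Fin 2) :
    eval w (smul c w v) x = c * eval w v x := by
  induction w with
  | zero => exact Int.cast_mul (α := ℝ) c v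
  | succ w ih => simp only [eval, smul, ih]; split_ifs <;> rfl

theorem eval_add (w : ℕ) (u v : QVec w) (x : Fin w → Fin 2) :
    eval w (add w u v) x = eval w u x + eval w v x := by
  induction w with
  | zero => exact Int.cast_add (R := ℝ) u v
  | succ w ih => simp only [eval, add, ih]; split_ifs <;> rfl

theorem eq_of_beq (w : ℕ) (u v : QVec w) (h : beq w u v = true) : u = v := by
  induction w with
  | zero => exact @of_decide_eq_true (@Eq ℤ u v) (Int.instDecidableEq u v) h
  | succ w ih =>
    simp only [beq, Bool.and_eq_true] at h
    exact Prod.ext (ih _ _ h.1) (ih _ _ h.2)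

theorem eval_zero (w : ℕ) (x : Fin w → Fin 2) : eval w (zero w) x = 0 := by
  induction w with
  | zero => exact Int.cast_zero (R := ℝ)
  | succ w ih => simp [eval, zero, ih]

/-- This is why testing an equality on the finite list `basis` suffices. -/
theorem exists_basis (w : ℕ) (y : Fin w → Fin 2) :
    ∃ v ∈ basis w, eval w v = Pi.single y 1 := by
  induction w with
  | zero =>
    refine ⟨(1 : ℤ), List.mem_singleton_self _, ?_⟩
    funext x
    rw [Subsingleton.elim x y, Pi.single_eq_same]
    exact Int.cast_one (R := ℝ)
  | succ w ih =>
    obtain ⟨v, hv, hv'⟩ := ih (Fin.tail y)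
    have key : ∀ x : Fin (w + 1) → Fin 2, x = y ↔ x 0 = y 0 ∧ Fin.tail x = Fin.tail y := by
      intro x
      constructor
      · rintro rfl; exact ⟨rfl, rfl⟩
      · rintro ⟨h1, h2⟩
        rw [← Fin.cons_self_tail x, ← Fin.cons_self_tail y, h1, h2]
    by_cases hy : y 0 = 0
    · refine ⟨(v, zero w), List.mem_append_left _ (List.mem_map_of_mem hv), ?_⟩
      funext x
      simp only [eval, hv', eval_zero, Pi.single_apply, key, hy]
      split_ifs <;> simp_all
    · refine ⟨(zero w, v), List.mem_append_right _ (List.mem_map_of_mem hv), ?_⟩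
      have hy1 : y 0 = 1 := by omega
      funext x
      have hx : x 0 = 1 ↔ ¬ x 0 = 0 := by omega
      simp only [eval, hv', eval_zero, Pi.single_apply, key, hy1, hx]
      split_ifs <;> simp_all

theorem tail_update_zero {w : ℕ} (x : Fin (w + 1) → Fin 2) (v : Fin 2) :
    Fin.tail (Function.update x 0 v) = Fin.tail x := by
  ext i; simp [Fin.tail]

theorem tail_update_succ {w : ℕ} (x : Fin (w + 1) → Fin 2) (i : Fin w) (v : Fin 2) :
    Fin.tail (Function.update x i.succ v) = Function.update (Fin.tail x) i v := by
  ext j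
  by_cases hj : j = i
  · subst hj; simp [Fin.tail]
  · simp [Fin.tail, hj]

theorem update_succ_zero {w : ℕ} (x : Fin (w + 1) → Fin 2) (i : Fin w) (v : Fin 2) :
    Function.update x i.succ v 0 = x 0 :=
  Function.update_of_ne (Fin.succ_ne_zero i).symm _ _

theorem eval_actH (w : ℕ) (p : Fin w) (v : QVec w) (x : Fin w → Fin 2) :
    eval w (actH w p v) x = eval w v (Function.update x p 0) +
      (if x p = 0 then 1 else -1) * eval w v (Function.update x p 1) := by
  induction w with
  | zero => exact p.elim0
  | succ w ih =>
    cases p using Fin.cases with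
    | zero =>
      simp only [eval, actH, Fin.val_zero, Function.update_self, tail_update_zero, eval_add,
        eval_smul]
      split_ifs <;> simp_all
    | succ p =>
      simp only [Fin.val_succ, eval, actH, ih, update_succ_zero, tail_update_succ]
      split_ifs <;> simp_all [Fin.tail]

theorem eval_actZ (w : ℕ) (p : Fin w) (v : QVec w) (x : Fin w → Fin 2) :
    eval w (actZ w p v) x = (if x p = 0 then 1 else -1) * eval w v x := by
  induction w with
  | zero => exact p.elim0
  | succ w ih =>
    cases p using Fin.cases with
    | zero =>
      simp only [eval, actZ, Fin.val_zero, eval_smul]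
      split_ifs <;> simp_all
    | succ p =>
      simp only [Fin.val_succ, eval, actZ, ih]
      split_ifs <;> simp_all [Fin.tail]

theorem eval_actCZ (w : ℕ) (p q : Fin w) (hpq : (q : ℕ) = p + 1) (v : QVec w)
    (x : Fin w → Fin 2) :
    eval w (actCZ w p v) x = (if x p = 0 then 1 else if x q = 0 then 1 else -1) * eval w v x := by
  induction w with
  | zero => exact p.elim0
  | succ w ih =>
    cases q using Fin.cases with
    | zero => simp at hpq
    | succ q =>
    cases p using Fin.cases with
    | zero =>
      cases w with
      | zero => exact q.elim0
      | succ w =>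
        have hq : q = 0 := by ext; simpa using hpq
        subst hq
        -- On the half where the top bit is 1, `CZ` acts as `Z` on the next wire.
        have := eval_actZ (w + 1) 0 v.2 (Fin.tail x)
        simp only [Fin.val_zero] at this
        have e : ∀ u : QVec (w + 2), eval (w + 2) u x =
          if x 0 = 0 then eval (w + 1) u.1 (Fin.tail x) else eval (w + 1) u.2 (Fin.tail x) :=
          fun u => rfl
        rw [e, e]
        simp only [actCZ, Fin.val_zero, this]
        split_ifs <;> simp_all [Fin.tail]
    | succ p =>
      simp only [Fin.val_succ, eval, actCZ]
      rw [ih p q (by simpa using hpq), ih p q (by simpa using hpq)]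
      split_ifs <;> simp_all [Fin.tail]

/-- The number of Hadamard gates. -/
def countH : List (Prim × ℕ) → ℕ
  | [] => 0
  | (.H, _) :: l => countH l + 1
  | (.Z, _) :: l => countH l
  | (.CZ, _) :: l => countH l

/-- Replacing `H` by `√2 • H` keeps all vectors integral; each Hadamard gate then owes one factor
`(√2)⁻¹`. -/
theorem opOfList_mulVec_eval (w : ℕ) (l : List (Prim × ℕ)) (hl : Fits w l) (v : QVec w) :
    opOfList w l *ᵥ eval w v = (√2)⁻¹ ^ countH l • eval w (run w l v) := by
  induction l generalizing v with
  | nil => simp [opOfList, countH, run]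
  | cons g l ih =>
    have hg := hl g List.mem_cons_self
    have ih := ih fun g' hg' => hl g' (List.mem_cons_of_mem _ hg')
    obtain ⟨g, p⟩ := g
    rw [opOfList, ← mulVec_mulVec]
    cases g with
    | H =>
      have : Prim.op w (.H, p) *ᵥ eval w v = (√2)⁻¹ • eval w (actH w p v) := by
        funext x
        have h1 := H_mulVec ⟨p, hg⟩ (eval w v) x
        have h2 := eval_actH w ⟨p, hg⟩ v x
        simp only at h1 h2
        rw [h1, Pi.smul_apply, h2, smul_eq_mul]
      rw [this, mulVec_smul, ih, smul_smul, countH, run, pow_succ']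
    | Z =>
      have : Prim.op w (.Z, p) *ᵥ eval w v = eval w (actZ w p v) := by
        funext x
        exact (Z_mulVec ⟨p, hg⟩ (eval w v) x).trans (eval_actZ w ⟨p, hg⟩ v x).symm
      rw [this, ih, countH, run]
    | CZ =>
      have hg' : p + 1 < w := hg
      have : Prim.op w (.CZ, p) *ᵥ eval w v = eval w (actCZ w p v) := by
        funext x
        exact (CZ_mulVec ⟨p, by omega⟩ ⟨p + 1, hg'⟩ rfl (eval w v) x).trans
          (eval_actCZ w ⟨p, by omega⟩ ⟨p + 1, hg'⟩ rfl v x).symm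
      rw [this, ih, countH, run]

end QVec

/-! ### Deciding equality of operators -/

/-- A decision procedure for `SameOp` on `w` wires. -/
def checkEq (w : ℕ) (s : ℤˣ) (l r : List (Prim × ℕ)) : Bool :=
  decide (Fits w l) && decide (Fits w r) &&
  decide (QVec.countH l % 2 = QVec.countH r % 2) &&
  (QVec.basis w).all fun v =>
    QVec.beq w (QVec.smul (2 ^ (QVec.countH r / 2)) w (QVec.run w l v))
      (QVec.smul (s * 2 ^ (QVec.countH l / 2)) w (QVec.run w r v))

/-- Splits the power into a part depending only on the parity of `a`, which cancels between sides of
equal parity, and a power of 2. -/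
theorem inv_sqrt_two_pow (a : ℕ) :
    (√2 : ℝ)⁻¹ ^ a = (√2)⁻¹ ^ (a % 2) * ((2 : ℝ) ^ (a / 2))⁻¹ := by
  conv_lhs => rw [← Nat.mod_add_div a 2]
  rw [pow_add, pow_mul, inv_pow _ 2, Real.sq_sqrt (by norm_num), inv_pow 2]

/-- If the sides have `a` and `b` Hadamard gates with `a ≡ b` mod 2, clearing denominators turns the
equality of operators into an integral one, with factors `2 ^ (b / 2)` on the left and `s * 2 ^ (a /
2)` on the right. That is the equality tested on basis vectors. -/
theorem sameOp_of_checkEq {w : ℕ} {s : ℤˣ} {l r : List (Prim × ℕ)}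
    (h : checkEq w s l r = true) : Fits w l ∧ Fits w r ∧ SameOp w s l r := by
  simp only [checkEq, Bool.and_eq_true, decide_eq_true_eq, List.all_eq_true] at h
  obtain ⟨⟨⟨hl, hr⟩, hpar⟩, hv⟩ := h
  refine ⟨hl, hr, Matrix.ext_of_mulVec_single fun y => ?_⟩
  obtain ⟨v, hvb, hv'⟩ := QVec.exists_basis w y
  rw [← hv', smul_mulVec, QVec.opOfList_mulVec_eval w l hl, QVec.opOfList_mulVec_eval w r hr]
  have := QVec.eq_of_beq _ _ _ (hv v hvb)
  funext x
  have := congrArg (fun u => QVec.eval w u x) this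
  simp only [QVec.eval_smul] at this
  push_cast at this
  simp only [Pi.smul_apply, smul_eq_mul]
  rw [inv_sqrt_two_pow, inv_sqrt_two_pow (QVec.countH r), hpar]
  have h1 : (2 : ℝ) ^ (QVec.countH l / 2) ≠ 0 := by positivity
  have h2 : (2 : ℝ) ^ (QVec.countH r / 2) ≠ 0 := by positivity
  field_simp
  linear_combination this

theorem checkEq.sameOp_shift {w : ℕ} {s : ℤˣ} {l r : List (Prim × ℕ)}
    (h : checkEq w s l r = true) {n k : ℕ} (hk : k + w ≤ n) :
    SameOp n s (shift k l) (shift k r) :=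
  have h := sameOp_of_checkEq h
  h.2.2.shift hk h.1 h.2.1

/-- Soundness of all relations: each is a computation with integer vectors of length at most 8, as
no relation uses more than three wires. -/
theorem typedRelations_checkEq :
    (typedRelations.all fun r => checkEq r.width r.sgn (forget r.lhs) (forget r.rhs)) = true := by
  decide +kernel

end RealStab

namespace RealStab

open Matrix

/-! ## Gates on disjoint wires commute -/

theorem tensor_mul {n : ℕ} (f g : Fin n → Matrix (Fin 2) (Fin 2) ℝ) :
    tensor f * tensor g = tensor fun i => f i * g i := by
  ext x y
  simp only [tensor, mul_apply, Finset.prod_univ_sum, Fintype.piFinset_univ,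
    Finset.prod_mul_distrib]

@[simp] theorem tensor_one (n : ℕ) : tensor (fun _ : Fin n => 1) = 1 := by
  ext x y
  simp only [tensor, one_apply, Fintype.prod_boole, funext_iff]
  congr 1

theorem onWire_commute {n p q : ℕ} (h : p ≠ q) (M N : Matrix (Fin 2) (Fin 2) ℝ) :
    onWire n p M * onWire n q N = onWire n q N * onWire n p M := by
  simp only [onWire, tensor_mul]
  congr 1
  funext i
  split_ifs <;> simp_all

/-- `onWire` connects only indices that agree off wire `q`, and `hd` says that the diagonal entries
do not see bit `q`. -/
theorem onWire_commute_diagonal {n q : ℕ} (M : Matrix (Fin 2) (Fin 2) ℝ)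
    (d : (Fin n → Fin 2) → ℝ) (hd : ∀ x y : Fin n → Fin 2, (∀ i : Fin n, (i : ℕ) ≠ q → x i = y i) →
      d x = d y) :
    onWire n q M * diagonal d = diagonal d * onWire n q M := by
  ext x y
  rw [mul_diagonal, diagonal_mul]
  by_cases hq : q < n
  · rw [onWire_apply ⟨q, hq⟩]
    split_ifs with h
    · rw [hd x y, mul_comm]
      intro i hi
      rw [h, Function.update_of_ne fun hc => hi (by rw [hc])]
    · simp
  -- There is no wire `q`, so every tensor factor is 1.
  · have h1 : onWire n q M = 1 := by
      rw [onWire, ← tensor_one]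
      congr 1
      funext i
      rw [if_neg (by omega)]
    rw [h1, one_apply]
    split_ifs with h
    · rw [h, mul_comm]
    · simp

/-- The diagonal of `CZ` depends only on its own two bits, so it commutes with one-wire gates
elsewhere. Two `CZ` gates commute simply because both are diagonal. -/
theorem op_commute (n : ℕ) (a b : Prim × ℕ)
    (h : a.2 + a.1.arity ≤ b.2 ∨ b.2 + b.1.arity ≤ a.2) :
    Prim.op n a * Prim.op n b = Prim.op n b * Prim.op n a := by
  have key : ∀ (p q : ℕ) (M : Matrix (Fin 2) (Fin 2) ℝ), q + 1 ≤ p ∨ p + 2 ≤ q →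
      onWire n q M * Prim.op n (.CZ, p) = Prim.op n (.CZ, p) * onWire n q M := by
    intro p q M hpq
    apply onWire_commute_diagonal
    intro x y hxy
    have : ∀ i : Fin n, (i : ℕ) = p ∨ (i : ℕ) = p + 1 → x i = y i :=
      fun i hi => hxy i (by omega)
    congr 1
    apply propext
    exact forall_congr' fun i => ⟨fun hx hi => this i hi ▸ hx hi, fun hy hi => this i hi ▸ hy hi⟩
  obtain ⟨a, p⟩ := a
  obtain ⟨b, q⟩ := b
  cases a <;> cases b <;> simp only [Prim.arity] at h
  · exact onWire_commute (by omega) _ _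
  · exact onWire_commute (by omega) _ _
  · exact key q p _ h
  · exact onWire_commute (by omega) _ _
  · exact onWire_commute (by omega) _ _
  · exact key q p _ h
  · exact (key p q _ h.symm).symm
  · exact (key p q _ h.symm).symm
  · simp only [Prim.op, diagonal_mul_diagonal, mul_comm]

theorem sameOp_exchange (n : ℕ) (a b : Prim × ℕ)
    (h : a.2 + a.1.arity ≤ b.2 ∨ b.2 + b.1.arity ≤ a.2) : SameOp n 1 [a, b] [b, a] := by
  simp [SameOp, opOfList, op_commute n a b h]

/-! ## Rewriting is sound -/

theorem forget_append (l l' : GateList) : forget (l ++ l') = forget l ++ forget l' :=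
  List.flatMap_append

theorem forget_shift (k : ℕ) (l : GateList) : forget (shift k l) = shift k (forget l) := by
  induction l with
  | nil => rfl
  | cons g l ih =>
    have cons : ∀ (g : Gate × ℕ) (l : GateList), forget (g :: l) =
      shift g.2 g.1.expand ++ forget l := fun g l => List.flatMap_cons
    rw [shift_cons, cons, cons, ih, shift_append, shift_shift]

/-- A sign is its own inverse, so both scalars can be collected on one side. -/
theorem PrimCircuit.op_eq_iff {n : ℕ} {s t : ℤˣ} {l l' : List (Prim × ℕ)} :
    PrimCircuit.op n (s, l) = PrimCircuit.op n (t, l') ↔ SameOp n (s * t) l l' := by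
  simp only [PrimCircuit.op, SameOp]
  rcases Int.units_eq_one_or s with rfl | rfl <;> rcases Int.units_eq_one_or t with rfl | rfl <;>
    simp [neg_eq_iff_eq_neg]

theorem PrimStep.op_eq {n : ℕ} {c d : PrimCircuit} (h : PrimStep typedRelations n c d) :
    c.op n = d.op n := by
  cases h with
  | rel r k s u v hr hk =>
    rw [PrimCircuit.op_eq_iff, ← mul_assoc, Int.units_mul_self, one_mul]
    exact (checkEq.sameOp_shift (List.all_eq_true.1 typedRelations_checkEq r hr) hk).congr u v
  | exchange a b s u v h =>
    rw [PrimCircuit.op_eq_iff, Int.units_mul_self]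
    exact (sameOp_exchange n a b h).congr u v

theorem EqualModulo.op_eq {n : ℕ} {c d : PrimCircuit} (h : EqualModulo typedRelations n c d) :
    c.op n = d.op n := by
  induction h with
  | rel _ _ h => exact h.op_eq
  | refl => rfl
  | symm _ _ _ ih => exact ih.symm
  | trans _ _ _ _ _ ih ih' => exact ih.trans ih'

/-- `l` and `l'` can be exchanged by exchanging neighbouring gates. -/
theorem EqualModulo.exchange_lists {R : List CircuitRelation} {n : ℕ} (l l' : List (Prim × ℕ))
    (h : ∀ a ∈ l, ∀ b ∈ l', a.2 + a.1.arity ≤ b.2 ∨ b.2 + b.1.arity ≤ a.2) (s : ℤˣ)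
    (u v : List (Prim × ℕ)) :
    EqualModulo R n (s, u ++ l ++ l' ++ v) (s, u ++ l' ++ l ++ v) := by
  induction l generalizing u with
  | nil => simp only [List.append_nil]; exact .refl _
  | cons a l ih =>
    have h1 := ih (fun a' ha' => h a' (List.mem_cons_of_mem _ ha')) (u ++ [a])
    have h2 : ∀ (l' : List (Prim × ℕ)) (u : List (Prim × ℕ)),
        (∀ b ∈ l', a.2 + a.1.arity ≤ b.2 ∨ b.2 + b.1.arity ≤ a.2) →
        EqualModulo R n (s, u ++ [a] ++ l' ++ (l ++ v)) (s, u ++ l' ++ [a] ++ (l ++ v)) := by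
      intro l' u h
      induction l' generalizing u with
      | nil => simp only [List.append_nil]; exact .refl _
      | cons b l' ih =>
        have h3 := Relation.EqvGen.rel _ _ (PrimStep.exchange (R := R) (n := n) a b s u
          (l' ++ (l ++ v)) (h b List.mem_cons_self))
        have h4 := ih (u ++ [b]) fun b' hb' => h b' (List.mem_cons_of_mem _ hb')
        simp only [List.append_assoc, List.cons_append, List.nil_append] at h3 h4 ⊢
        exact h3.trans _ _ _ h4
    have h3 := h2 l' u (h a List.mem_cons_self)
    simp only [List.append_assoc, List.cons_append, List.nil_append] at h1 h3 ⊢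
    exact h1.trans _ _ _ h3

theorem Gate.expand_fits (g : Gate) : Fits g.inp.length g.expand := by
  cases g <;> simp [Gate.inp, Gate.expand, Fits, Prim.arity]

/-- Only the exchange step needs work: swapping two derived gates becomes swapping their whole
words, gate by gate. Unfolding a shorthand is invisible after `forget`. -/
theorem Step.equalModulo {R : List CircuitRelation} {n : ℕ} {c d : Circuit} (h : Step R n c d) :
    EqualModulo R n (c.1, forget c.2) (d.1, forget d.2) := by
  cases h with
  | rel r k s u v hr hk =>
    simp only [forget_append, forget_shift]
    exact .rel _ _ (.rel r k s _ _ hr hk)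
  | exchange a b s u v h =>
    have key : ∀ g : Gate × ℕ, forget [g] = shift g.2 g.1.expand := by simp [forget]
    have e1 : forget (u ++ [a, b] ++ v) = forget u ++ forget [a] ++ forget [b] ++ forget v := by
      simp [forget]
    have e2 : forget (u ++ [b, a] ++ v) = forget u ++ forget [b] ++ forget [a] ++ forget v := by
      simp [forget]
    rw [e1, e2]
    apply EqualModulo.exchange_lists
    have mem : ∀ g : Gate × ℕ, ∀ a ∈ forget [g], g.2 ≤ a.2 ∧
        a.2 + a.1.arity ≤ g.2 + g.1.inp.length := by
      intro g a ha
      rw [key, shift, List.mem_map] at ha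
      obtain ⟨a, ha, rfl⟩ := ha
      have := g.1.expand_fits a ha
      simp only
      omega
    intro a' ha' b' hb'
    have := mem a a' ha'
    have := mem b b' hb'
    omega
  | unfoldX t p s u v =>
    have : forget (u ++ [(.X t, p)] ++ v) =
        forget (u ++ [(.H t, p), (.Z t, p), (.H t, p)] ++ v) := by
      simp [forget, Gate.expand, shift]
    simp only [this]
    exact .refl _
  | unfoldCXZ t p s u v =>
    have : forget (u ++ [(.CXZ t, p)] ++ v) =
        forget (u ++ [(.H t, p), (.CZ t, p), (.H t, p), (.CZ t, p)] ++ v) := by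
      simp [forget, Gate.expand, shift]
    simp only [this]
    exact .refl _

theorem Step.mono {R R' : List CircuitRelation} (hR : ∀ r ∈ R, r ∈ R') {n : ℕ} {c d : Circuit}
    (h : Step R n c d) : Step R' n c d := by
  cases h with
  | rel r k s u v hr hk => exact .rel r k s u v (hR r hr) hk
  | exchange a b s u v h => exact .exchange a b s u v h
  | unfoldX t p s u v => exact .unfoldX t p s u v
  | unfoldCXZ t p s u v => exact .unfoldCXZ t p s u v

theorem Rewrites.mono {R R' : List CircuitRelation} (hR : ∀ r ∈ R, r ∈ R') {n : ℕ} {c d : Circuit}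
    (h : Rewrites R n c d) : Rewrites R' n c d :=
  Relation.ReflTransGen.mono (fun _ _ h => ⟨h.1, h.2.1, h.2.2.mono hR⟩) _ _ h

theorem mem_typedRelations_of_mem_pushRelations (r : CircuitRelation) (hr : r ∈ pushRelations) :
    r ∈ typedRelations := List.mem_append_left _ hr

theorem Rewrites.equalModulo {R : List CircuitRelation} {n : ℕ} {c d : Circuit}
    (h : Rewrites R n c d) : EqualModulo R n (c.1, forget c.2) (d.1, forget d.2) := by
  induction h with
  | refl => exact .refl _
  | tail _ h ih => exact ih.trans _ _ _ h.2.2.equalModulo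

theorem Rewrites.op_eq {n : ℕ} {c d : Circuit} (h : Rewrites typedRelations n c d) :
    c.op n = d.op n :=
  h.equalModulo.op_eq

theorem forget_toCircuit (c : PrimCircuit) : forget c.toCircuit.2 = c.2 := by
  obtain ⟨s, l⟩ := c
  simp only [PrimCircuit.toCircuit]
  induction l with
  | nil => rfl
  | cons g l ih =>
    rw [List.map_cons, forget, List.flatMap_cons, ← forget, ih]
    obtain ⟨g, p⟩ := g
    cases g <;> rfl

/-! ## Types -/

/-- The constructor ties the position of the gate to `σ.length`; here the position is free and
linked by an equation, so that inversion applies to any placed gate. -/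
theorem hasType_cons_iff {ν T : List WireType} {g : Gate × ℕ} {l : GateList} :
    HasType ν (g :: l) T ↔ ∃ σ ρ, ν = σ ++ g.1.inp ++ ρ ∧ σ.length = g.2 ∧
      HasType (σ ++ g.1.out ++ ρ) l T := by
  constructor
  · rintro (_ | ⟨σ, ρ, τ, g, l, h⟩)
    exact ⟨σ, ρ, rfl, rfl, h⟩
  · rintro ⟨σ, ρ, rfl, hσ, h⟩
    obtain ⟨g, p⟩ := g
    simp only at hσ
    subst hσ
    exact .cons _ _ _ _ _ h

theorem hasType_nil_iff {σ τ : List WireType} : HasType σ [] τ ↔ σ = τ := by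
  constructor
  · rintro ⟨⟩; rfl
  · rintro rfl; exact .nil _

theorem hasType_append_iff {σ τ : List WireType} {l l' : GateList} :
    HasType σ (l ++ l') τ ↔ ∃ ρ, HasType σ l ρ ∧ HasType ρ l' τ := by
  induction l generalizing σ with
  | nil => simp [hasType_nil_iff]
  | cons g l ih =>
    simp only [List.cons_append, hasType_cons_iff, ih]
    constructor
    · rintro ⟨α, β, h1, h2, ρ, h3, h4⟩
      exact ⟨ρ, ⟨α, β, h1, h2, h3⟩, h4⟩
    · rintro ⟨ρ, ⟨α, β, h1, h2, h3⟩, h4⟩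
      exact ⟨α, β, h1, h2, ρ, h3, h4⟩

theorem Gate.out_length (g : Gate) : g.out.length = g.inp.length := by cases g <;> rfl

theorem HasType.length_eq {σ τ : List WireType} {l : GateList} (h : HasType σ l τ) :
    τ.length = σ.length := by
  induction h with
  | nil => rfl
  | cons σ ρ τ g l _ ih => simp [ih, g.out_length]

/-- The types to the right of the gates of `l`, if these fit to the types `σ` on the left. -/
def infer : List WireType → GateList → Option (List WireType)
  | σ, [] => some σ
  | σ, g :: l =>
    if (σ.take g.2).length = g.2 ∧ (σ.drop g.2).take g.1.inp.length = g.1.inp then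
      infer (σ.take g.2 ++ g.1.out ++ σ.drop (g.2 + g.1.inp.length)) l
    else none

/-- Types propagate deterministically from left to right. So typing is decidable, and the type
behaviour of the relations can be checked by computation. -/
theorem infer_eq_some_iff {σ τ : List WireType} {l : GateList} :
    infer σ l = some τ ↔ HasType σ l τ := by
  induction l generalizing σ with
  | nil => simp [infer, hasType_nil_iff]
  | cons g l ih =>
    rw [infer, hasType_cons_iff]
    constructor
    · intro h
      split_ifs at h with hc
      refine ⟨_, _, ?_, hc.1, ih.1 h⟩
      conv_lhs => rw [← List.take_append_drop g.2 σ,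
        ← List.take_append_drop g.1.inp.length (List.drop g.2 σ), hc.2]
      simp
    · rintro ⟨α, β, rfl, hα, h⟩
      rw [← hα, if_pos]
      · rw [ih]
        convert h using 2
        · simp
        · rw [← List.length_append, List.drop_left']
          simp
      · simp

/-- The condition on a relation that ensures that it preserves types. -/
def CircuitRelation.PreservesTypes (r : CircuitRelation) : Prop :=
  (∀ g ∈ r.lhs, g.2 + g.1.inp.length ≤ r.width) ∧
    ∀ σ τ : List WireType, σ.length = r.width → HasType σ r.lhs τ → HasType σ r.rhs τ

/-- All lists of types of the given length. -/
def allTypes : ℕ → List (List WireType)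
  | 0 => [[]]
  | w + 1 => (allTypes w).map (.single :: ·) ++ (allTypes w).map (.double :: ·)

theorem mem_allTypes (σ : List WireType) : σ ∈ allTypes σ.length := by
  induction σ with
  | nil => simp [allTypes]
  | cons t σ ih => cases t <;> simp [allTypes, ih]

/-- For each choice of input types, either the left side is ill-typed or both sides give the same
output types. Hence typing only has to be known for the left side. -/
theorem pushRelations_types : (pushRelations.all fun r =>
    decide (∀ g ∈ r.lhs, g.2 + g.1.inp.length ≤ r.width) &&
    (allTypes r.width).all fun σ => decide (infer σ r.lhs = none) ||
      decide (infer σ r.lhs = infer σ r.rhs)) = true := by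
  decide +kernel

theorem preservesTypes_of_mem_pushRelations (r : CircuitRelation) (hr : r ∈ pushRelations) :
    r.PreservesTypes := by
  have h := List.all_eq_true.1 pushRelations_types r hr
  simp only [Bool.and_eq_true, decide_eq_true_eq, List.all_eq_true, Bool.or_eq_true] at h
  refine ⟨h.1, fun σ τ hσ hτ => ?_⟩
  rw [← infer_eq_some_iff] at hτ ⊢
  rcases h.2 σ (hσ ▸ mem_allTypes σ) with h | h
  · simp [h] at hτ
  · rw [← h, hτ]

theorem HasType.shift {σ τ : List WireType} {l : GateList} (h : HasType σ l τ)
    (α β : List WireType) : HasType (α ++ σ ++ β) (shift α.length l) (α ++ τ ++ β) := by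
  induction h with
  | nil => exact .nil _
  | cons σ ρ τ g l _ ih =>
    rw [shift_cons, hasType_cons_iff]
    exact ⟨α ++ σ, ρ ++ β, by simp, by simp, by simpa using ih⟩

/-- Gates that stay inside the window cannot touch the types `α` above and `β` below it, so a typing
in context restricts to a typing of the window. -/
theorem HasType.of_shift {l : GateList} {α σ β T : List WireType}
    (hl : ∀ g ∈ l, g.2 + g.1.inp.length ≤ σ.length)
    (h : HasType (α ++ σ ++ β) (RealStab.shift α.length l) T) :
    ∃ τ, T = α ++ τ ++ β ∧ HasType σ l τ := by
  induction l generalizing σ with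
  | nil => exact ⟨σ, (hasType_nil_iff.1 h).symm, .nil _⟩
  | cons g l ih =>
    rw [shift_cons, hasType_cons_iff] at h
    obtain ⟨μ, ρ, h1, h2, h3⟩ := h
    have hg := hl g List.mem_cons_self
    simp only at h1 h2 h3
    -- The wires above the gate are all of `α` and the first `g.2` wires of the window.
    have e : μ = α ++ σ.take g.2 := by
      have := congrArg (List.take μ.length) h1
      rw [List.append_assoc μ, List.take_left, h2, List.append_assoc, List.take_length_add_append,
        List.take_append_of_le_length (by omega)] at this
      exact this.symm
    subst e
    have e2 : σ.drop g.2 ++ β = g.1.inp ++ ρ := by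
      conv_lhs at h1 => rw [← List.take_append_drop g.2 σ]
      simpa only [List.append_assoc, List.append_cancel_left_eq] using h1
    have e3 : σ.drop g.2 = g.1.inp ++ σ.drop (g.2 + g.1.inp.length) := by
      have := congrArg (List.take g.1.inp.length) e2
      rw [List.take_append_of_le_length (by rw [List.length_drop]; omega), List.take_left] at this
      conv_lhs => rw [← List.take_append_drop g.1.inp.length (σ.drop g.2), this]
      simp
    have e4 : ρ = σ.drop (g.2 + g.1.inp.length) ++ β := by
      rw [e3] at e2
      simpa using e2.symm
    subst e4
    have hlen : (σ.take g.2 ++ g.1.out ++ σ.drop (g.2 + g.1.inp.length)).length = σ.length := by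
      simp [g.1.out_length]; omega
    obtain ⟨τ, hτ, h4⟩ := ih (σ := σ.take g.2 ++ g.1.out ++ σ.drop (g.2 + g.1.inp.length))
      (fun g' hg' => by rw [hlen]; exact hl g' (List.mem_cons_of_mem _ hg')) (by simpa using h3)
    refine ⟨τ, hτ, hasType_cons_iff.2 ⟨_, _, ?_, ?_, h4⟩⟩
    · conv_lhs => rw [← List.take_append_drop g.2 σ, e3]
      simp
    · simp; omega

/-- The list of types splits into five consecutive pieces, two of which belong to the gates;
replacing inputs by outputs in these two pieces can be done in either order. -/
theorem hasType_exchange {σ τ : List WireType} {a b : Gate × ℕ}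
    (h : a.2 + a.1.inp.length ≤ b.2 ∨ b.2 + b.1.inp.length ≤ a.2)
    (ht : HasType σ [a, b] τ) : HasType σ [b, a] τ := by
  obtain ⟨α, β, rfl, hα, ht⟩ := hasType_cons_iff.1 ht
  obtain ⟨γ, δ, he, hγ, ht⟩ := hasType_cons_iff.1 ht
  obtain rfl := hasType_nil_iff.1 ht
  have ha := a.1.out_length
  have hb := b.1.out_length
  rcases h with h | h
  · have h1 := congrArg List.length he
    obtain ⟨μ, rfl, h3⟩ : ∃ μ, γ = α ++ a.1.out ++ μ ∧ β = μ ++ (b.1.inp ++ δ) := by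
      rw [List.append_assoc γ, List.append_eq_append_iff] at he
      rcases he with he | ⟨μ, he, he'⟩
      · exact he
      · have := congrArg List.length he
        simp at this
        obtain rfl : μ = [] := List.length_eq_zero_iff.1 (by omega)
        exact ⟨[], by simpa using he.symm, by simpa using he'.symm⟩
    subst h3
    refine hasType_cons_iff.2 ⟨α ++ a.1.inp ++ μ, δ, by simp, ?_,
      hasType_cons_iff.2 ⟨α, μ ++ b.1.out ++ δ, by simp, hα, hasType_nil_iff.2 (by simp)⟩⟩
    simp at hγ ⊢
    omega
  · obtain ⟨μ, rfl, h3⟩ : ∃ μ, α = γ ++ b.1.inp ++ μ ∧ δ = μ ++ (a.1.out ++ β) := by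
      rw [List.append_assoc α, List.append_eq_append_iff] at he
      rcases he with ⟨μ, he, he'⟩ | he
      · have := congrArg List.length he
        simp at this
        obtain rfl : μ = [] := List.length_eq_zero_iff.1 (by omega)
        exact ⟨[], by simpa using he.symm, by simpa using he'.symm⟩
      · exact he
    subst h3
    refine hasType_cons_iff.2 ⟨γ, μ ++ a.1.inp ++ β, by simp, hγ,
      hasType_cons_iff.2 ⟨γ ++ b.1.out ++ μ, β, by simp, ?_, hasType_nil_iff.2 (by simp)⟩⟩
    simp at hα ⊢
    omega

theorem hasType_append_congr {σ τ : List WireType} {u l l' v : GateList}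
    (h : HasType σ (u ++ l ++ v) τ)
    (hl : ∀ ρ μ, ρ.length = σ.length → HasType ρ l μ → HasType ρ l' μ) :
    HasType σ (u ++ l' ++ v) τ := by
  simp only [hasType_append_iff] at *
  obtain ⟨μ, ⟨ρ, h1, h2⟩, h3⟩ := h
  exact ⟨μ, ⟨ρ, h1, hl ρ μ h1.length_eq h2⟩, h3⟩

theorem Step.hasType {R : List CircuitRelation} (hR : ∀ r ∈ R, r.PreservesTypes) {n : ℕ}
    {c d : Circuit} (h : Step R n c d) {σ τ : List WireType} (hσ : σ.length = n)
    (ht : HasType σ c.2 τ) : HasType σ d.2 τ := by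
  cases h with
  | rel r k s u v hr hk =>
    refine hasType_append_congr ht fun ρ μ hρ hμ => ?_
    obtain ⟨α, β, γ, rfl, h1, h2⟩ : ∃ α β γ, ρ = α ++ β ++ γ ∧ α.length = k ∧
        β.length = r.width := by
      refine ⟨ρ.take k, (ρ.drop k).take r.width, ρ.drop (k + r.width), ?_, ?_, ?_⟩
      · rw [List.append_assoc, ← List.drop_drop, List.take_append_drop, List.take_append_drop]
      · simp; omega
      · simp; omega
    subst h1
    obtain ⟨τ', rfl, h3⟩ := HasType.of_shift (h2 ▸ (hR r hr).1) hμ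
    exact ((hR r hr).2 _ _ h2 h3).shift α γ
  | exchange a b s u v h => exact hasType_append_congr ht fun ρ μ _ => hasType_exchange h
  | unfoldX t p s u v =>
    refine hasType_append_congr ht fun ρ μ _ hμ => ?_
    obtain ⟨α, β, rfl, hα, hμ⟩ := hasType_cons_iff.1 hμ
    exact hasType_cons_iff.2 ⟨α, β, rfl, hα, hasType_cons_iff.2 ⟨α, β, rfl, hα,
      hasType_cons_iff.2 ⟨α, β, rfl, hα, hμ⟩⟩⟩
  | unfoldCXZ t p s u v =>
    refine hasType_append_congr ht fun ρ μ _ hμ => ?_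
    obtain ⟨α, β, rfl, hα, hμ⟩ := hasType_cons_iff.1 hμ
    exact hasType_cons_iff.2 ⟨α, .single :: β, by simp [Gate.inp], hα, hasType_cons_iff.2 ⟨α, β, by
      simp [Gate.inp, Gate.out], hα, hasType_cons_iff.2 ⟨α, .single :: β, by
      simp [Gate.inp, Gate.out], hα, hasType_cons_iff.2 ⟨α, β, by
      simp [Gate.inp, Gate.out], hα, hμ⟩⟩⟩⟩

/-- Rewriting without regard to types. -/
abbrev Steps (n : ℕ) : Circuit → Circuit → Prop := Relation.ReflTransGen (Step pushRelations n)

/-- Since push relations preserve types, it suffices that the first circuit is well typed. The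
pushing argument can therefore work with untyped steps throughout. -/
theorem Steps.rewrites {n : ℕ} {c d : Circuit} (h : Steps n c d) (hc : WellTyped n c.2) :
    WellTyped n d.2 ∧ Rewrites pushRelations n c d := by
  induction h with
  | refl => exact ⟨hc, .refl⟩
  | tail _ h ih =>
    have := h.hasType preservesTypes_of_mem_pushRelations (List.length_replicate) ih.1
    exact ⟨this, ih.2.tail ⟨ih.1, this, h⟩⟩

end RealStab

namespace RealStab

/-! ## Normal forms as paths

The clean gates of a normal form are read from left to right by an automaton whose states record the
labels of the wires. -/

/-- `A n`: the wires `0, …, n - 1` are labelled 1. `B n p t`: of these wires, `p` has type `t` and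
label 2. `D n p`: of these wires, `p` has label 3 or 4. All wires from `n` on have no label. -/
inductive State
  | A (n : ℕ)
  | B (n p : ℕ) (t : WireType)
  | D (n p : ℕ)
  deriving DecidableEq

/-- The type of the top output wire. -/
def Gate.topOut (g : Gate) : WireType := g.out.headD .single

/-- The type of the bottom input wire. -/
def Gate.bottomIn (g : Gate) : WireType := g.inp.getLastD .single

namespace State

/-- The number of labelled wires. -/
def size : State → ℕ
  | A n => n
  | B n _ _ => n
  | D n _ => n

/-- The state after a clean gate. -/
def next : State → Gate × ℕ → Option State
  | A n, (g, p) => if g.kind = .A ∧ p < n then some (B n p g.topOut) else none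
  | B n q t, (g, p) =>
    if g.kind = .B ∧ q = p + 1 ∧ p + 1 < n ∧ g.bottomIn = t then some (B n p g.topOut)
    else if g.kind = .C ∧ q = 0 ∧ p = 0 ∧ 0 < n ∧ t = .single then some (D n 0) else none
  | D n q, (g, p) =>
    if g.kind = .D ∧ p = q ∧ q + 1 < n then some (D n (q + 1))
    else if g.kind = .E ∧ p = q ∧ n = q + 1 then some (A q) else none

/-- The state after a list of clean gates. -/
def nextList : State → GateList → Option State
  | S, [] => some S
  | S, g :: l => (S.next g).bind fun S' => S'.nextList l

/-- The gates of `l` complete a normal form from the state `S` on. -/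
def Clean (S : State) (l : GateList) : Prop := S.nextList l = some (A 0)

/-- The states decrease along a normal form. -/
def rank : State → ℕ ×ₗ ℕ ×ₗ ℕ
  | A n => toLex (n, toLex (2, 0))
  | B n p _ => toLex (n, toLex (1, p))
  | D n p => toLex (n, toLex (0, n - p))

/-- Within a block of `n` wires the phases `A`, `B`, `D` follow one another, the `B` gates moving up
towards wire 0 and the `D` gates down towards wire `n - 1`. The `E` gate then decreases `n`. -/
theorem rank_lt_of_next {S S' : State} {g : Gate × ℕ} (h : S.next g = some S') :
    S'.rank < S.rank := by
  obtain ⟨g, p⟩ := g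
  cases S <;> simp only [next] at h <;> split_ifs at h <;> cases h <;>
    simp only [rank, Prod.Lex.toLex_lt_toLex] <;> simp <;> omega

theorem size_le_of_next {S S' : State} {g : Gate × ℕ} (h : S.next g = some S') :
    S'.size ≤ S.size := by
  obtain ⟨g, p⟩ := g
  cases S <;> simp only [next] at h <;> split_ifs at h <;> cases h <;> simp only [size] <;> omega

theorem nextList_append {S : State} {l l' : GateList} :
    S.nextList (l ++ l') = (S.nextList l).bind fun S' => S'.nextList l' := by
  induction l generalizing S with
  | nil => rfl
  | cons g l ih =>
    simp only [List.cons_append, nextList]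
    cases S.next g with
    | none => rfl
    | some S' => exact ih

theorem nextList_cons_eq_some {S T : State} {g : Gate × ℕ} {l : GateList} :
    S.nextList (g :: l) = some T ↔ ∃ S', S.next g = some S' ∧ S'.nextList l = some T := by
  simp [nextList, Option.bind_eq_some_iff]

theorem clean_cons {S : State} {g : Gate × ℕ} {l : GateList} :
    S.Clean (g :: l) ↔ ∃ S', S.next g = some S' ∧ S'.Clean l := nextList_cons_eq_some

theorem clean_append {S S' : State} {l l' : GateList} (h : S.nextList l = some S') :
    S.Clean (l ++ l') ↔ S'.Clean l' := by
  simp [Clean, nextList_append, h]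

/-- Add `k` wires above and `m` wires below. -/
def embed (k m : ℕ) : State → State
  | A n => A (k + n + m)
  | B n p t => B (k + n + m) (k + p) t
  | D n p => D (k + n + m) (k + p)

/-- Gates of kind `C` and `E` depend on the top and bottom wire. -/
def Compatible (k m : ℕ) (K : List Kind) : Prop := (.C ∈ K → k = 0) ∧ (.E ∈ K → m = 0)

/-- Transitions are local, with two exceptions: `C` occurs only on wire 0, so there may be no wires
above, and `E` only on the last labelled wire, so there may be no labelled wires below. -/
theorem next_embed {K : List Kind} {k m : ℕ} (hK : Compatible k m K) {S S' : State} {g : Gate × ℕ}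
    (hg : g.1.kind ∈ K) (h : S.next g = some S') :
    (S.embed k m).next (g.1, k + g.2) = some (S'.embed k m) := by
  obtain ⟨g, p⟩ := g
  simp only at hg
  cases S with
  | A n =>
    simp only [next] at h
    split_ifs at h with h1
    cases h
    simp only [embed, next]
    rw [if_pos ⟨h1.1, by omega⟩]
  | B n q t =>
    simp only [next] at h
    split_ifs at h with h1 h1
    · cases h
      simp only [embed, next]
      rw [if_pos ⟨h1.1, by omega, by omega, h1.2.2.2⟩]
    · cases h
      have hk := hK.1 (h1.1 ▸ hg)
      simp only [embed, next]
      rw [if_neg (by simp [h1.1]), if_pos ⟨h1.1, by omega, by omega, by omega, h1.2.2.2.2⟩, hk]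
  | D n q =>
    simp only [next] at h
    split_ifs at h with h1 h1
    · cases h
      simp only [embed, next]
      rw [if_pos ⟨h1.1, by omega, by omega⟩]
      rfl
    · cases h
      have hm := hK.2 (h1.1 ▸ hg)
      simp only [embed, next]
      rw [if_neg (by simp [h1.1]), if_pos ⟨h1.1, by omega, by omega⟩, hm]
      rfl

theorem nextList_embed {K : List Kind} {k m : ℕ} (hK : Compatible k m K) {S S' : State}
    {l : GateList} (hl : ∀ g ∈ l, g.1.kind ∈ K) (h : S.nextList l = some S') :
    (S.embed k m).nextList (shift k l) = some (S'.embed k m) := by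
  induction l generalizing S with
  | nil => cases h; rfl
  | cons g l ih =>
    obtain ⟨T, h1, h2⟩ := nextList_cons_eq_some.1 h
    rw [shift_cons, nextList_cons_eq_some]
    exact ⟨_, next_embed hK (hl g List.mem_cons_self) h1,
      ih (fun g' hg' => hl g' (List.mem_cons_of_mem _ hg')) h2⟩

/-! ## Dirty gates -/

/-- The status of a wire: labelled 1; of some type and labelled 2; labelled 3 or 4; without label. -/
inductive Status
  | free | mid (t : WireType) | low | gone
  deriving DecidableEq

/-- The status of a wire in a state. -/
def status : State → ℕ → Status
  | A n, j => if j < n then .free else .gone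
  | B n p t, j => if j = p then .mid t else if j < n then .free else .gone
  | D n p, j => if j = p then .low else if j < n then .free else .gone

/-- The dirty gates that can be pushed through a normal form starting in the state `S`. -/
def Pushable (S : State) : Gate × ℕ → Prop
  | (.H .single, j) => S.status j = .free
  | (.H .double, j) => S.status j = .mid .double
  | (.Z .single, j) => S.status j = .free ∨ S.status j = .mid .single ∨ S.status j = .low
  | (.Z .double, j) => S.status j = .mid .double
  | (.X .single, j) => S.status j = .free ∨ S.status j = .mid .single
  | (.X .double, j) => S.status j = .mid .double
  | (.CZ .single, j) => S.status (j + 1) = .free ∧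
      (S.status j = .free ∨ S.status j = .mid .single ∨ S.status j = .low)
  | (.CXZ .single, j) => S.status (j + 1) = .free ∧ S.status j = .free
  | (.CXZ .double, j) => S.status (j + 1) = .free ∧ S.status j = .mid .double
  | _ => False

instance (S : State) (g : Gate × ℕ) : Decidable (S.Pushable g) := by
  obtain ⟨g, j⟩ := g
  cases g with
  | H t => cases t <;> (simp only [Pushable]; infer_instance)
  | Z t => cases t <;> (simp only [Pushable]; infer_instance)
  | X t => cases t <;> (simp only [Pushable]; infer_instance)
  | CZ t => cases t <;> (simp only [Pushable]; infer_instance)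
  | CXZ t => cases t <;> (simp only [Pushable]; infer_instance)
  | _ => simp only [Pushable]; infer_instance

/-- Wires with status `gone` are excluded because they may become labelled once wires are added
below. -/
theorem status_embed {S : State} {j : ℕ} (h : S.status j ≠ .gone) (k m : ℕ) :
    (S.embed k m).status (k + j) = S.status j := by
  cases S <;> simp only [status, embed] at * <;> split_ifs at * <;> first | rfl | omega | simp_all

theorem Pushable.embed {S : State} {g : Gate × ℕ} (h : S.Pushable g) (k m : ℕ) :
    (S.embed k m).Pushable (g.1, k + g.2) := by
  have key : ∀ {j : ℕ} {s : Status}, s ≠ .gone → S.status j = s →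
      (S.embed k m).status (k + j) = s := by
    rintro j s hs rfl
    exact status_embed hs k m
  obtain ⟨g, j⟩ := g
  cases g with
  | H t => cases t <;> exact key (by simp) h
  | Z t =>
    cases t
    · exact h.imp (key (by simp)) (Or.imp (key (by simp)) (key (by simp)))
    · exact key (by simp) h
  | X t =>
    cases t
    · exact h.imp (key (by simp)) (key (by simp))
    · exact key (by simp) h
  | CZ t =>
    cases t
    · exact h.imp (key (by simp)) (Or.imp (key (by simp)) (Or.imp (key (by simp)) (key (by simp))))
    · exact h
  | CXZ t => cases t <;> exact h.imp (key (by simp)) (key (by simp))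
  | _ => exact h

/-! ## The relations cover all critical cases -/

/-- All clean gates. -/
def cleanGates : List Gate := [.A1, .A2, .A3, .B1, .B2, .B3, .B4, .B5, .B6, .B7, .B8, .C1, .C2,
  .D1, .D2, .D3, .D4, .E1, .E2]

theorem mem_cleanGates {g : Gate} (h : g.kind ≠ .dirty) : g ∈ cleanGates := by
  cases g <;> first | exact absurd rfl h | decide

/-- All lists of clean gates of the given kinds, at the given positions, that can be read from a
given state, with the states that are reached. -/
def paths (K : List Kind) : State → List ℕ → List (GateList × State)
  | S, [] => [([], S)]
  | S, p :: ps => cleanGates.flatMap fun a =>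
    if a.kind ∈ K then
      match S.next (a, p) with
      | none => []
      | some S' => (paths K S' ps).map fun q => ((a, p) :: q.1, q.2)
    else []

theorem kind_ne_dirty_of_next {S S' : State} {g : Gate × ℕ} (h : S.next g = some S') :
    g.1.kind ≠ .dirty := by
  obtain ⟨g, p⟩ := g
  intro hg
  simp only at hg
  cases S <;> simp [next, hg] at h

/-- The enumeration misses no clean continuation with the given positions, so a Boolean test over
`paths` covers all of them. -/
theorem mem_paths {K : List Kind} {S S' : State} {l : GateList} (hl : ∀ g ∈ l, g.1.kind ∈ K)
    (h : S.nextList l = some S') : (l, S') ∈ paths K S (l.map Prod.snd) := by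
  induction l generalizing S with
  | nil => cases h; simp [paths]
  | cons g l ih =>
    obtain ⟨T, h1, h2⟩ := nextList_cons_eq_some.1 h
    simp only [List.map_cons, paths, List.mem_flatMap]
    refine ⟨g.1, mem_cleanGates (kind_ne_dirty_of_next h1), ?_⟩
    rw [if_pos (hl g List.mem_cons_self), h1]
    exact List.mem_map.2 ⟨(l, S'), ih (fun g' hg' => hl g' (List.mem_cons_of_mem _ hg')) h2, rfl⟩

/-- `l` consists of a path of clean gates from `S` to `S'`, followed by dirty gates that can be
pushed. -/
def absorbs (K : List Kind) (S' : State) : State → GateList → Bool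
  | S, [] => decide (S = S')
  | S, g :: l =>
    if g.1.kind = .dirty then decide (S = S') && (g :: l).all fun d => decide (S'.Pushable d)
    else decide (g.1.kind ∈ K) && match S.next g with
      | none => false
      | some T => absorbs K S' T l

theorem exists_of_absorbs {K : List Kind} {S S' : State} {l : GateList}
    (h : absorbs K S' S l = true) : ∃ cl ds, l = cl ++ ds ∧ (∀ g ∈ cl, g.1.kind ∈ K) ∧
      S.nextList cl = some S' ∧ ∀ d ∈ ds, S'.Pushable d := by
  induction l generalizing S with
  | nil => exact ⟨[], [], rfl, by simp, by simpa [absorbs, nextList] using h, by simp⟩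
  | cons g l ih =>
    rw [absorbs] at h
    split_ifs at h with hg
    · simp only [Bool.and_eq_true, decide_eq_true_eq, List.all_eq_true] at h
      exact ⟨[], g :: l, rfl, by simp, by rw [h.1]; rfl, h.2⟩
    · simp only [Bool.and_eq_true, decide_eq_true_eq] at h
      obtain ⟨hK, h⟩ := h
      cases hn : S.next g with
      | none => simp [hn] at h
      | some T =>
        rw [hn] at h
        obtain ⟨cl, ds, rfl, h1, h2, h3⟩ := ih h
        exact ⟨g :: cl, ds, rfl, by simpa [hK] using h1, nextList_cons_eq_some.2 ⟨T, hn, h2⟩, h3⟩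

/-- A critical case consists of a state, a dirty gate and the positions of the clean gates that
follow. It is covered if there always is a push relation whose right hand side is fine. -/
def covered (K : List Kind) (c : State × (Gate × ℕ) × List ℕ) : Bool :=
  (paths K c.1 c.2.2).all fun q => pushRelations.any fun r =>
    decide (r.width = c.1.size) && decide (r.lhs = c.2.1 :: q.1) && absorbs K q.2 c.1 r.rhs

/-- The critical cases with gates of kind `A`, `B` and `D`. -/
def criticalABD : List (State × (Gate × ℕ) × List ℕ) := [
  (A 1, h 0, [0]), (A 1, z 0, [0]), (A 2, cz 0, [0]), (A 2, cz 0, [1, 0]),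
  (B 2 1 .single, h 0, [0]), (B 2 1 .double, h 0, [0]),
  (B 2 1 .single, z 0, [0]), (B 2 1 .double, z 0, [0]),
  (B 2 1 .double, hd 1, [0]),
  (B 2 1 .single, z 1, [0]), (B 2 1 .double, zd 1, [0]),
  (B 2 1 .single, x 1, [0]), (B 2 1 .double, xd 1, [0]),
  (B 3 1 .single, cz 1, [0]), (B 3 1 .double, cxzd 1, [0]),
  (B 3 2 .single, cz 0, [1, 0]), (B 3 2 .double, cz 0, [1, 0]),
  (D 2 0, z 0, [0]), (D 2 0, z 1, [0]), (D 2 0, h 1, [0]), (D 2 0, cz 0, [0]),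
  (D 3 0, cz 1, [0, 1])]

/-- The critical cases with a gate of kind `C`. -/
def criticalC : List (State × (Gate × ℕ) × List ℕ) := [
  (B 1 0 .single, z 0, [0]), (B 1 0 .single, x 0, [0]), (B 2 0 .single, cz 0, [0])]

/-- The critical case with a gate of kind `E`. -/
def criticalE : List (State × (Gate × ℕ) × List ℕ) := [(D 1 0, z 0, [0])]

/-- This and the next two checks are where the push relations enter. In each overlap some relation
has exactly the dirty gate and the clean gates as its left side, and its right side reaches the same
state by clean gates before emitting pushable dirty gates. Hence the rest of the normal form remains
a valid continuation. -/
theorem criticalABD_covered : criticalABD.all (covered [.A, .B, .D]) = true := by decide +kernel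

theorem criticalC_covered : criticalC.all (covered [.C]) = true := by decide +kernel

theorem criticalE_covered : criticalE.all (covered [.E]) = true := by decide +kernel

end State

end RealStab

namespace RealStab

/-! ## Pushing dirty gates through normal forms -/

/-- `l` can be rewritten to `l'` with the push relations, in every context and up to a scalar. -/
def Pushes (w : ℕ) (l l' : GateList) : Prop :=
  ∃ t : ℤˣ, ∀ (s : ℤˣ) (u v : GateList), Steps w (s, u ++ l ++ v) (s * t, u ++ l' ++ v)

namespace Pushes

theorem refl (w : ℕ) (l : GateList) : Pushes w l l :=
  ⟨1, fun s u v => by rw [mul_one]⟩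

theorem trans {w : ℕ} {a b c : GateList} (h : Pushes w a b) (h' : Pushes w b c) :
    Pushes w a c := by
  obtain ⟨s, hs⟩ := h
  obtain ⟨t, ht⟩ := h'
  exact ⟨s * t, fun r u v => mul_assoc r s t ▸ (hs r u v).trans (ht _ u v)⟩

theorem congr {w : ℕ} {a b : GateList} (h : Pushes w a b) (u v : GateList) :
    Pushes w (u ++ a ++ v) (u ++ b ++ v) := by
  obtain ⟨t, ht⟩ := h
  refine ⟨t, fun s u' v' => ?_⟩
  have := ht s (u' ++ u) (v ++ v')
  simpa only [List.append_assoc] using this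

theorem of_mem {w : ℕ} {r : CircuitRelation} (hr : r ∈ pushRelations) {k : ℕ}
    (hk : k + r.width ≤ w) : Pushes w (shift k r.lhs) (shift k r.rhs) :=
  ⟨r.sgn, fun s u v => .single (.rel r k s u v hr hk)⟩

theorem exchange (w : ℕ) {a b : Gate × ℕ}
    (h : a.2 + a.1.inp.length ≤ b.2 ∨ b.2 + b.1.inp.length ≤ a.2) : Pushes w [a, b] [b, a] :=
  ⟨1, fun s u v => by rw [mul_one]; exact .single (.exchange a b s u v h)⟩

theorem unfoldX (w : ℕ) (t : WireType) (p : ℕ) :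
    Pushes w [(.X t, p)] [(.H t, p), (.Z t, p), (.H t, p)] :=
  ⟨1, fun s u v => by rw [mul_one]; exact .single (.unfoldX t p s u v)⟩

theorem unfoldCXZ (w : ℕ) (t : WireType) (p : ℕ) :
    Pushes w [(.CXZ t, p)] [(.H t, p), (.CZ t, p), (.H t, p), (.CZ t, p)] :=
  ⟨1, fun s u v => by rw [mul_one]; exact .single (.unfoldCXZ t p s u v)⟩

end Pushes

namespace State

/-- The list `ds` can be pushed into every normal form starting in the state `S`. -/
def Absorbs (w : ℕ) (S : State) (ds : GateList) : Prop :=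
  ∀ N, S.Clean N → ∃ N', S.Clean N' ∧ Pushes w (ds ++ N) N'

/-- The gates enter one at a time, the last one first because it is adjacent to `N`. The state does
not change in between. -/
theorem Absorbs.of_forall {w : ℕ} {S : State} {ds : GateList} (h : ∀ d ∈ ds, S.Absorbs w [d]) :
    S.Absorbs w ds := by
  induction ds with
  | nil => exact fun N hN => ⟨N, hN, .refl w N⟩
  | cons d ds ih =>
    intro N hN
    obtain ⟨N₁, h1, h2⟩ := ih (fun d' hd' => h d' (List.mem_cons_of_mem _ hd')) N hN
    obtain ⟨N₂, h3, h4⟩ := h d List.mem_cons_self N₁ h1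
    refine ⟨N₂, h3, .trans ?_ h4⟩
    simpa using h2.congr [d] []

theorem Absorbs.of_pushes {w : ℕ} {S : State} {ds ds' : GateList} (h : S.Absorbs w ds')
    (hp : Pushes w ds ds') : S.Absorbs w ds := by
  intro N hN
  obtain ⟨N', h1, h2⟩ := h N hN
  exact ⟨N', h1, .trans (by simpa using hp.congr [] N) h2⟩

/-- A dirty gate is exchanged with the first clean gate. -/
theorem exists_pushes_of_disjoint {w : ℕ} {S S' : State} {g c : Gate × ℕ} {N : GateList}
    (hc : S.next c = some S') (hN : S'.Clean N)
    (h : g.2 + g.1.inp.length ≤ c.2 ∨ c.2 + c.1.inp.length ≤ g.2) (hg : S'.Absorbs w [g]) :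
    ∃ N', S.Clean N' ∧ Pushes w (g :: c :: N) N' := by
  obtain ⟨N', h1, h2⟩ := hg N hN
  refine ⟨c :: N', clean_cons.2 ⟨S', hc, h1⟩, .trans (b := c :: g :: N) ?_ ?_⟩
  · simpa using (Pushes.exchange w h).congr [] N
  · simpa using h2.congr [c] []

/-- A dirty gate is pushed through the first clean gates with a relation. -/
theorem exists_pushes_of_covered {w : ℕ} {K : List Kind} {S : State} {g : Gate × ℕ}
    {cs : List ((State × (Gate × ℕ) × List ℕ))} (hcov : cs.all (covered K) = true)
    {cl : GateList} (hmem : (S, g, cl.map Prod.snd) ∈ cs) (hcl : ∀ g ∈ cl, g.1.kind ∈ K)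
    {S' : State} (hS' : S.nextList cl = some S') {k m : ℕ} (hK : Compatible k m K)
    (hw : k + S.size ≤ w) {N : GateList} (hN : (S'.embed k m).Clean N)
    (ih : ∀ d, (S'.embed k m).Pushable d → (S'.embed k m).Absorbs w [d]) :
    ∃ N', (S.embed k m).Clean N' ∧ Pushes w (shift k (g :: cl) ++ N) N' := by
  have h := List.all_eq_true.1 hcov _ hmem
  -- The clean gates at hand occur in the enumeration, so some push relation has `g :: cl` as its
  -- left side.
  have h := List.all_eq_true.1 h _ (mem_paths hcl hS')
  obtain ⟨r, hr, h⟩ := List.any_eq_true.1 h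
  simp only [Bool.and_eq_true, decide_eq_true_eq] at h
  obtain ⟨⟨h1, h2⟩, h3⟩ := h
  obtain ⟨cl', ds, h4, h5, h6, h7⟩ := exists_of_absorbs h3
  -- The dirty gates produced on the right stand before the state reached after the clean ones,
  -- where pushing is already known.
  have hds : (S'.embed k m).Absorbs w (shift k ds) := by
    apply Absorbs.of_forall
    intro d hd
    obtain ⟨d', hd', rfl⟩ := List.mem_map.1 hd
    exact ih _ ((h7 d' hd').embed k m)
  obtain ⟨N', h8, h9⟩ := hds N hN
  refine ⟨shift k cl' ++ N', (clean_append (nextList_embed hK h5 h6)).2 h8, ?_⟩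
  have hp := (Pushes.of_mem hr (h1 ▸ hw : k + r.width ≤ w)).congr [] N
  rw [h2, h4, shift_append] at hp
  refine .trans (by simpa using hp) ?_
  simpa using h9.congr (shift k cl') []

/-- The gates that are pushed without being unfolded before. -/
def Basic (S : State) : Gate × ℕ → Prop
  | (.X _, j) => S.status j ≠ .free
  | (.CXZ t, _) => t = .double
  | _ => True

/-- On wires labelled 1, the gates `X` and `CXZ` unfold into `H`, `Z` and `CZ`, which are pushable
in the same state. So no relations are needed for them there. -/
theorem absorbs_of_basic {w : ℕ} {S : State}
    (h : ∀ g, S.Pushable g → S.Basic g → S.Absorbs w [g]) (g : Gate × ℕ) (hg : S.Pushable g) :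
    S.Absorbs w [g] := by
  by_cases hb : S.Basic g
  · exact h g hg hb
  obtain ⟨g, j⟩ := g
  cases g with
  | X t =>
    cases t with
    | single =>
      have hj : S.status j = .free := not_not.1 hb
      refine .of_pushes (.of_forall fun d hd => ?_) (.unfoldX w _ j)
      simp only [List.mem_cons, List.not_mem_nil, or_false] at hd
      rcases hd with rfl | rfl | rfl
      · exact h _ hj trivial
      · exact h _ (Or.inl hj) trivial
      · exact h _ hj trivial
    | double =>
      have hj : S.status j = .free := not_not.1 hb
      have hj' : S.status j = .mid .double := hg
      simp [hj] at hj'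
  | CXZ t =>
    cases t with
    | single =>
      obtain ⟨h1, h2⟩ : S.status (j + 1) = .free ∧ S.status j = .free := hg
      refine .of_pushes (.of_forall fun d hd => ?_) (.unfoldCXZ w _ j)
      simp only [List.mem_cons, List.not_mem_nil, or_false] at hd
      rcases hd with rfl | rfl | rfl | rfl
      · exact h _ h2 trivial
      · exact h _ ⟨h1, Or.inl h2⟩ trivial
      · exact h _ h2 trivial
      · exact h _ ⟨h1, Or.inl h2⟩ trivial
    | double => exact absurd rfl hb
  | _ => exact absurd trivial hb

end State

end RealStab

/-! ### Pushing a single dirty gate, state by state -/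

namespace RealStab

namespace State

/-- All dirty gates that are pushable in smaller states can be pushed. -/
def AbsorbsBelow (w : ℕ) (S : State) : Prop :=
  ∀ S' : State, S'.rank < S.rank → S'.size ≤ w → ∀ d, S'.Pushable d → S'.Absorbs w [d]

theorem AbsorbsBelow.next {w : ℕ} {S S' : State} {c : Gate × ℕ} (h : S.AbsorbsBelow w)
    (hS : S.size ≤ w) (hc : S.next c = some S') (d : Gate × ℕ) (hd : S'.Pushable d) :
    S'.Absorbs w [d] :=
  h S' (rank_lt_of_next hc) ((size_le_of_next hc).trans hS) d hd

/-- For the relations whose left side contains two clean gates. -/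
theorem AbsorbsBelow.next₂ {w : ℕ} {S S' S'' : State} {c c' : Gate × ℕ} (h : S.AbsorbsBelow w)
    (hS : S.size ≤ w) (hc : S.next c = some S') (hc' : S'.next c' = some S'') (d : Gate × ℕ)
    (hd : S''.Pushable d) : S''.Absorbs w [d] :=
  h S'' ((rank_lt_of_next hc').trans (rank_lt_of_next hc))
    (((size_le_of_next hc').trans (size_le_of_next hc)).trans hS) d hd

theorem compatible_ABD (k m : ℕ) : Compatible k m [.A, .B, .D] := by simp [Compatible]

theorem next_A {n p : ℕ} {a : Gate} (ha : a.kind = .A) (hp : p < n) :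
    (A n).next (a, p) = some (B n p a.topOut) := if_pos ⟨ha, hp⟩

theorem next_B {n p : ℕ} {b : Gate} (hb : b.kind = .B) (hp : p + 1 < n) :
    (B n (p + 1) b.bottomIn).next (b, p) = some (B n p b.topOut) := if_pos ⟨hb, rfl, hp, rfl⟩

theorem next_C {n : ℕ} {c : Gate} (hc : c.kind = .C) (hn : 0 < n) :
    (B n 0 .single).next (c, 0) = some (D n 0) := by
  simp [next, hc, hn]

theorem next_D {n p : ℕ} {d : Gate} (hd : d.kind = .D) (hp : p + 1 < n) :
    (D n p).next (d, p) = some (D n (p + 1)) := if_pos ⟨hd, rfl, hp⟩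

theorem next_E {p : ℕ} {e : Gate} (he : e.kind = .E) :
    (D (p + 1) p).next (e, p) = some (A p) := by
  simp [next, he]

theorem next_A_eq_some {n : ℕ} {c : Gate × ℕ} {S : State} (h : (A n).next c = some S) :
    ∃ a p, c = (a, p) ∧ a.kind = .A ∧ p < n ∧ S = B n p a.topOut := by
  obtain ⟨a, p⟩ := c
  simp only [next] at h
  split_ifs at h with h1
  exact ⟨a, p, rfl, h1.1, h1.2, (Option.some.inj h).symm⟩

theorem next_B_eq_some {n q : ℕ} {t : WireType} {c : Gate × ℕ} {S : State}
    (h : (B n q t).next c = some S) :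
    (∃ b p, c = (b, p) ∧ b.kind = .B ∧ q = p + 1 ∧ p + 1 < n ∧ b.bottomIn = t ∧
      S = B n p b.topOut) ∨
    ∃ g, c = (g, 0) ∧ g.kind = .C ∧ q = 0 ∧ 0 < n ∧ t = .single ∧ S = D n 0 := by
  obtain ⟨b, p⟩ := c
  simp only [next] at h
  split_ifs at h with h1 h1
  · exact Or.inl ⟨b, p, rfl, h1.1, h1.2.1, h1.2.2.1, h1.2.2.2, (Option.some.inj h).symm⟩
  · obtain ⟨h2, h3, rfl, h4, h5⟩ := h1
    exact Or.inr ⟨b, rfl, h2, h3, h4, h5, (Option.some.inj h).symm⟩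

theorem next_B_succ_eq_some {n p : ℕ} {t : WireType} {c : Gate × ℕ} {S : State}
    (h : (B n (p + 1) t).next c = some S) :
    ∃ b, c = (b, p) ∧ b.kind = .B ∧ p + 1 < n ∧ b.bottomIn = t ∧ S = B n p b.topOut := by
  rcases next_B_eq_some h with ⟨b, q, rfl, h1, h2, h3⟩ | ⟨g, rfl, h1, h2, h3⟩
  · obtain rfl : p = q := by omega
    exact ⟨b, rfl, h1, h3⟩
  · omega

theorem next_B_zero_eq_some {n : ℕ} {t : WireType} {c : Gate × ℕ} {S : State}
    (h : (B n 0 t).next c = some S) :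
    ∃ g, c = (g, 0) ∧ g.kind = .C ∧ 0 < n ∧ t = .single ∧ S = D n 0 := by
  rcases next_B_eq_some h with ⟨b, q, rfl, h1, h2, h3⟩ | ⟨g, rfl, h1, h2, h3⟩
  · omega
  · exact ⟨g, rfl, h1, h3⟩

theorem next_D_eq_some {n p : ℕ} {c : Gate × ℕ} {S : State} (h : (D n p).next c = some S) :
    (∃ d, c = (d, p) ∧ d.kind = .D ∧ p + 1 < n ∧ S = D n (p + 1)) ∨
      ∃ e, c = (e, p) ∧ e.kind = .E ∧ n = p + 1 ∧ S = A p := by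
  obtain ⟨d, q⟩ := c
  simp only [next] at h
  split_ifs at h with h1 h1
  · obtain ⟨h2, rfl, h3⟩ := h1
    exact Or.inl ⟨d, rfl, h2, h3, (Option.some.inj h).symm⟩
  · obtain ⟨h2, rfl, h3⟩ := h1
    exact Or.inr ⟨d, rfl, h2, h3, (Option.some.inj h).symm⟩

theorem Gate.inp_length_of_kind {g : Gate} : g.inp.length = match g.kind with
    | .dirty => g.inp.length
    | .A => 1 | .B => 2 | .C => 1 | .D => 2 | .E => 1 := by
  cases g <;> rfl

theorem exists_of_clean_B {n p : ℕ} {t : WireType} {N : GateList}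
    (h : (B n (p + 1) t).Clean N) :
    ∃ b N', N = (b, p) :: N' ∧ b.kind = .B ∧ p + 1 < n ∧ b.bottomIn = t ∧
      (B n p b.topOut).Clean N' := by
  cases N with
  | nil => cases h
  | cons c N =>
    obtain ⟨S, h1, h2⟩ := clean_cons.1 h
    obtain ⟨b, rfl, h3, h4, h5, rfl⟩ := next_B_succ_eq_some h1
    exact ⟨b, N, rfl, h3, h4, h5, h2⟩

theorem exists_of_clean_D {n p : ℕ} {N : GateList} (h : (D n p).Clean N) (hp : p + 1 < n) :
    ∃ d N', N = (d, p) :: N' ∧ d.kind = .D ∧ (D n (p + 1)).Clean N' := by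
  cases N with
  | nil => cases h
  | cons c N =>
    obtain ⟨S, h1, h2⟩ := clean_cons.1 h
    rcases next_D_eq_some h1 with ⟨d, rfl, h3, h4, rfl⟩ | ⟨e, rfl, h3, h4, rfl⟩
    · exact ⟨d, N, rfl, h3, h2⟩
    · omega

theorem status_A_eq_free {n j : ℕ} : (A n).status j = .free ↔ j < n := by
  simp [status]

theorem status_B_eq_free {n p j : ℕ} {t : WireType} :
    (B n p t).status j = .free ↔ j ≠ p ∧ j < n := by
  simp only [status]; split_ifs <;> simp_all

theorem status_B_eq_mid {n p j : ℕ} {t t' : WireType} :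
    (B n p t).status j = .mid t' ↔ j = p ∧ t = t' := by
  simp only [status]; split_ifs <;> simp_all

theorem status_D_eq_free {n p j : ℕ} : (D n p).status j = .free ↔ j ≠ p ∧ j < n := by
  simp only [status]; split_ifs <;> simp_all

theorem status_D_eq_low {n p j : ℕ} : (D n p).status j = .low ↔ j = p := by
  simp only [status]; split_ifs <;> simp_all

theorem status_A_ne {n j : ℕ} : (A n).status j ≠ .low ∧ ∀ t, (A n).status j ≠ .mid t := by
  simp only [status]; split_ifs <;> simp

theorem status_B_ne {n p j : ℕ} {t : WireType} : (B n p t).status j ≠ .low := by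
  simp only [status]; split_ifs <;> simp

theorem status_D_ne {n p j : ℕ} {t : WireType} : (D n p).status j ≠ .mid t := by
  simp only [status]; split_ifs <;> simp

/-- A gate that avoids the wire `p` of the `A` gate slides past it. A `CZ` overlaps in two ways:
with its top wire on `p`, where `A` alone matters, or with its bottom wire on `p`, where the next
`B` gate is involved as well. -/
theorem absorbs_A {w n : ℕ} (hn : n ≤ w) (ih : (A n).AbsorbsBelow w) (g : Gate × ℕ)
    (hg : (A n).Pushable g) (hb : (A n).Basic g) : (A n).Absorbs w [g] := by
  intro N hN
  obtain ⟨g, j⟩ := g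
  cases N with
  | nil =>
    -- The empty list is accepted only from `A 0`, a state that has no wire for a dirty gate.
    obtain rfl : n = 0 := by simpa [Clean, nextList] using hN
    cases g with
    | H t | Z t | X t | CZ t | CXZ t => cases t <;> simp [Pushable, status] at hg
    | _ => exact hg.elim
  | cons c N =>
    obtain ⟨S, h1, h2⟩ := clean_cons.1 hN
    obtain ⟨a, p, rfl, ha, hp, rfl⟩ := next_A_eq_some h1
    have hlen : a.inp.length = 1 := by rw [Gate.inp_length_of_kind, ha]
    have hex : ∀ g : Gate, (g.inp.length + j ≤ p ∨ p + 1 ≤ j) →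
        (B n p a.topOut).Pushable (g, j) →
        ∃ N', (A n).Clean N' ∧ Pushes w ((g, j) :: (a, p) :: N) N' := fun g hd hg =>
      exists_pushes_of_disjoint h1 h2 (by simp only [hlen]; omega) (ih.next hn h1 _ hg)
    have hone : ∀ g : Gate, (A 1, (g, 0), [0]) ∈ criticalABD → j = p →
        ∃ N', (A n).Clean N' ∧ Pushes w ((g, j) :: (a, p) :: N) N' := by
      rintro g hmem rfl
      -- The critical case on one wire is embedded with `j` wires above and `m` below; the same cut
      -- into window and surroundings is used in all cases that follow.
      obtain ⟨m, rfl⟩ : ∃ m, n = j + 1 + m := ⟨n - (j + 1), by omega⟩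
      exact exists_pushes_of_covered criticalABD_covered (cl := [(a, 0)]) hmem (by simp [ha])
        (nextList_cons_eq_some.2 ⟨_, next_A ha (by omega), rfl⟩) (compatible_ABD j m)
        (by simp only [size]; omega) h2 (ih.next hn h1)
    cases g with
    | H t =>
      cases t with
      | double => exact absurd hg (status_A_ne.2 _)
      | single =>
        have hj := status_A_eq_free.1 hg
        by_cases hjp : j = p
        · exact hone _ (by decide) hjp
        · exact hex _ (by simp only [Gate.inp, List.length_singleton]; omega)
            (status_B_eq_free.2 ⟨hjp, hj⟩)
    | Z t =>
      cases t with
      | double => exact absurd hg (status_A_ne.2 _)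
      | single =>
        have hj : j < n := by
          simpa [Pushable, status_A_eq_free, status_A_ne.1, status_A_ne.2 .single] using hg
        by_cases hjp : j = p
        · exact hone _ (by decide) hjp
        · exact hex _ (by simp only [Gate.inp, List.length_singleton]; omega)
            (Or.inl (status_B_eq_free.2 ⟨hjp, hj⟩))
    | X t =>
      cases t with
      | double => exact absurd hg (status_A_ne.2 _)
      | single => exact absurd (hg.resolve_right (status_A_ne.2 _)) hb
    | CZ t =>
      cases t with
      | double => exact hg.elim
      | single =>
        have hj : j + 1 < n := status_A_eq_free.1 hg.1
        by_cases hjp : j = p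
        · subst hjp
          obtain ⟨m, rfl⟩ : ∃ m, n = j + 2 + m := ⟨n - (j + 2), by omega⟩
          exact exists_pushes_of_covered criticalABD_covered (S := A 2) (g := cz 0)
            (cl := [(a, 0)]) (by simp [criticalABD]) (by simp [ha])
            (nextList_cons_eq_some.2 ⟨_, next_A ha (by omega), rfl⟩) (compatible_ABD j m)
            (by simp only [size]; omega) h2 (ih.next hn h1)
        by_cases hjp' : p = j + 1
        · subst hjp'
          obtain ⟨m, rfl⟩ : ∃ m, n = j + 2 + m := ⟨n - (j + 2), by omega⟩
          -- The wire `j + 1` is not the top one, so a `B` gate on the wires `j`, `j + 1` must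
          -- follow.
          obtain ⟨b, N, rfl, hb1, hb2, hb3, h3⟩ := exists_of_clean_B h2
          have h4 := next_B hb1 hb2
          have h5 := next_B (n := 2) (p := 0) hb1 (by omega)
          rw [hb3] at h4 h5
          exact exists_pushes_of_covered criticalABD_covered (S := A 2) (g := cz 0)
            (cl := [(a, 1), (b, 0)]) (by simp [criticalABD]) (by simp [ha, hb1])
            (nextList_cons_eq_some.2 ⟨_, next_A ha (by omega), nextList_cons_eq_some.2
              ⟨_, h5, rfl⟩⟩) (compatible_ABD j m) (by simp only [size]; omega) h3
            (ih.next₂ hn h1 h4)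
        · exact hex _ (by simp only [Gate.inp, List.length_cons, List.length_nil]; omega)
            ⟨status_B_eq_free.2 ⟨by omega, hj⟩, Or.inl (status_B_eq_free.2 ⟨hjp, by omega⟩)⟩
    | CXZ t =>
      cases t with
      | double => exact absurd hg.2 (status_A_ne.2 _)
      | single => cases hb
    | _ => exact hg.elim

/-- The label 2 has reached wire 0, so a `C` gate follows and the wire is single. Only gates
touching wire 0 are critical, and they are embedded with no wires above. -/
theorem absorbs_B_zero {w n : ℕ} {t : WireType} (hn : n ≤ w) (ih : (B n 0 t).AbsorbsBelow w)
    (g : Gate × ℕ) (hg : (B n 0 t).Pushable g) (hb : (B n 0 t).Basic g) :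
    (B n 0 t).Absorbs w [g] := by
  intro N hN
  obtain ⟨g, j⟩ := g
  cases N with
  | nil => cases hN
  | cons c N =>
    obtain ⟨S, h1, h2⟩ := clean_cons.1 hN
    obtain ⟨c, rfl, hc, hn0, rfl, rfl⟩ := next_B_zero_eq_some h1
    have hlen : c.inp.length = 1 := by rw [Gate.inp_length_of_kind, hc]
    have hex : ∀ g : Gate, j ≠ 0 → (D n 0).Pushable (g, j) →
        ∃ N', (B n 0 .single).Clean N' ∧ Pushes w ((g, j) :: (c, 0) :: N) N' := fun g hd hg =>
      exists_pushes_of_disjoint h1 h2 (by simp only [hlen]; omega) (ih.next hn h1 _ hg)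
    have hone : ∀ g : Gate, (B 1 0 .single, (g, 0), [0]) ∈ criticalC → j = 0 →
        ∃ N', (B n 0 .single).Clean N' ∧ Pushes w ((g, j) :: (c, 0) :: N) N' := by
      rintro g hmem rfl
      obtain ⟨m, rfl⟩ : ∃ m, n = 0 + 1 + m := ⟨n - 1, by omega⟩
      exact exists_pushes_of_covered criticalC_covered (cl := [(c, 0)]) hmem (by simp [hc])
        (nextList_cons_eq_some.2 ⟨_, next_C hc (by omega), rfl⟩) (k := 0) (m := m)
        (by simp [Compatible]) (by simp only [size]; omega) h2 (ih.next hn h1)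
    cases g with
    | H t =>
      cases t with
      | double => simp [status_B_eq_mid, Pushable] at hg
      | single =>
        have hj := status_B_eq_free.1 hg
        exact hex _ hj.1 (status_D_eq_free.2 hj)
    | Z t =>
      cases t with
      | double => simp [status_B_eq_mid, Pushable] at hg
      | single =>
        by_cases hj0 : j = 0
        · exact hone _ (by decide) hj0
        · exact hex _ hj0 (Or.inl (status_D_eq_free.2 (by
            simpa [Pushable, status_B_eq_mid, status_B_eq_free, status_B_ne, hj0] using hg)))
    | X t =>
      cases t with
      | double => simp [status_B_eq_mid, Pushable] at hg
      | single =>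
        exact hone _ (by decide) (status_B_eq_mid.1 (hg.resolve_left hb)).1
    | CZ t =>
      cases t with
      | double => exact hg.elim
      | single =>
        have hj := status_B_eq_free.1 hg.1
        by_cases hj0 : j = 0
        · subst hj0
          obtain ⟨m, rfl⟩ : ∃ m, n = 0 + 2 + m := ⟨n - 2, by omega⟩
          exact exists_pushes_of_covered criticalC_covered (S := B 2 0 .single) (g := cz 0)
            (cl := [(c, 0)]) (by simp [criticalC]) (by simp [hc])
            (nextList_cons_eq_some.2 ⟨_, next_C hc (by omega), rfl⟩) (k := 0) (m := m)
            (by simp [Compatible]) (by simp only [size]; omega) h2 (ih.next hn h1)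
        · exact hex _ hj0 ⟨status_D_eq_free.2 hj,
            Or.inl (status_D_eq_free.2 ⟨hj0, by omega⟩)⟩
    | CXZ t =>
      cases t with
      | double => simp [status_B_eq_mid, Pushable] at hg
      | single => cases hb
    | _ => exact hg.elim

/-- A `B` gate on `p`, `p + 1` follows. A `CZ` or `CXZ` with top wire `p + 1` needs a third wire
below. A `CZ` with bottom wire `p` needs the next `B` gate, which exists because `p > 0` in that
case. No `CZ` joins `p` to `p + 1`, since its bottom wire would have to be labelled 1. -/
theorem absorbs_B_succ {w n p : ℕ} {t : WireType} (hn : n ≤ w)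
    (ih : (B n (p + 1) t).AbsorbsBelow w)
    (g : Gate × ℕ) (hg : (B n (p + 1) t).Pushable g) (hb : (B n (p + 1) t).Basic g) :
    (B n (p + 1) t).Absorbs w [g] := by
  intro N hN
  obtain ⟨g, j⟩ := g
  obtain ⟨b, N, rfl, hb1, hb2, hb3, h2⟩ := exists_of_clean_B hN
  have h1 := next_B hb1 hb2
  rw [hb3] at h1
  have hlen : b.inp.length = 2 := by rw [Gate.inp_length_of_kind, hb1]
  have hex : ∀ g : Gate, (g.inp.length + j ≤ p ∨ p + 2 ≤ j) → (B n p b.topOut).Pushable (g, j) →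
      ∃ N', (B n (p + 1) t).Clean N' ∧ Pushes w ((g, j) :: (b, p) :: N) N' := fun g hd hg =>
    exists_pushes_of_disjoint h1 h2 (by simp only [hlen]; omega) (ih.next hn h1 _ hg)
  have htwo : ∀ (g : Gate) (i : ℕ), (B 2 1 t, (g, i), [0]) ∈ criticalABD → j = p + i →
      ∃ N', (B n (p + 1) t).Clean N' ∧ Pushes w ((g, j) :: (b, p) :: N) N' := by
    rintro g i hmem rfl
    obtain ⟨m, rfl⟩ : ∃ m, n = p + 2 + m := ⟨n - (p + 2), by omega⟩
    have h5 := next_B (n := 2) (p := 0) hb1 (by omega)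
    rw [hb3] at h5
    exact exists_pushes_of_covered criticalABD_covered (cl := [(b, 0)]) hmem (by simp [hb1])
      (nextList_cons_eq_some.2 ⟨_, h5, rfl⟩) (compatible_ABD p m)
      (by simp only [size]; omega) h2 (ih.next hn h1)
  have hthree : ∀ (g : Gate), (B 3 1 t, (g, 1), [0]) ∈ criticalABD → j = p + 1 → j + 1 < n →
      ∃ N', (B n (p + 1) t).Clean N' ∧ Pushes w ((g, j) :: (b, p) :: N) N' := by
    rintro g hmem rfl hj
    obtain ⟨m, rfl⟩ : ∃ m, n = p + 3 + m := ⟨n - (p + 3), by omega⟩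
    have h5 := next_B (n := 3) (p := 0) hb1 (by omega)
    rw [hb3] at h5
    exact exists_pushes_of_covered criticalABD_covered (cl := [(b, 0)]) hmem (by simp [hb1])
      (nextList_cons_eq_some.2 ⟨_, h5, rfl⟩) (compatible_ABD p m)
      (by simp only [size]; omega) h2 (ih.next hn h1)
  have hfree : ∀ {i : ℕ}, i < p ∨ p + 2 ≤ i → i < n → (B n p b.topOut).status i = .free :=
    fun hi hi' => status_B_eq_free.2 ⟨by omega, hi'⟩
  cases g with
  | H t' =>
    cases t' with
    | double =>
      obtain ⟨rfl, rfl⟩ := status_B_eq_mid.1 hg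
      exact htwo _ 1 (by decide) rfl
    | single =>
      have hj := status_B_eq_free.1 hg
      by_cases hjp : j = p
      · exact htwo _ 0 (by cases t <;> decide) hjp
      · exact hex _ (by simp only [Gate.inp, List.length_singleton]; omega)
          (hfree (by omega) hj.2)
  | Z t' =>
    cases t' with
    | double =>
      obtain ⟨rfl, rfl⟩ := status_B_eq_mid.1 hg
      exact htwo _ 1 (by decide) rfl
    | single =>
      simp only [Pushable, status_B_eq_free, status_B_eq_mid, status_B_ne, or_false] at hg
      rcases hg with hj | ⟨rfl, rfl⟩
      · by_cases hjp : j = p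
        · exact htwo _ 0 (by cases t <;> decide) hjp
        · exact hex _ (by simp only [Gate.inp, List.length_singleton]; omega)
            (Or.inl (hfree (by omega) hj.2))
      · exact htwo _ 1 (by decide) rfl
  | X t' =>
    cases t' with
    | double =>
      obtain ⟨rfl, rfl⟩ := status_B_eq_mid.1 hg
      exact htwo _ 1 (by decide) rfl
    | single =>
      obtain ⟨rfl, rfl⟩ := status_B_eq_mid.1 (hg.resolve_left hb)
      exact htwo _ 1 (by decide) rfl
  | CZ t' =>
    cases t' with
    | double => exact hg.elim
    | single =>
      simp only [Pushable, status_B_eq_free, status_B_eq_mid, status_B_ne, or_false] at hg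
      rcases hg with ⟨hj, hj' | ⟨rfl, rfl⟩⟩
      · by_cases hjp : p = j + 1
        · subst hjp
          obtain ⟨m, rfl⟩ : ∃ m, n = j + 3 + m := ⟨n - (j + 3), by omega⟩
          obtain ⟨b', N, rfl, hb1', hb2', hb3', h3⟩ := exists_of_clean_B h2
          have h4 := next_B hb1' hb2'
          have h5 := next_B (n := 3) (p := 0) hb1' (by omega)
          have h6 := next_B (n := 3) (p := 1) hb1 (by omega)
          rw [hb3'] at h4 h5
          rw [hb3] at h6
          exact exists_pushes_of_covered criticalABD_covered (S := B 3 2 t) (g := cz 0)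
            (cl := [(b, 1), (b', 0)]) (by cases t <;> simp [criticalABD]) (by simp [hb1, hb1'])
            (nextList_cons_eq_some.2 ⟨_, h6, nextList_cons_eq_some.2 ⟨_, h5, rfl⟩⟩)
            (compatible_ABD j m) (by simp only [size]; omega) h3 (ih.next₂ hn h1 h4)
        · exact hex _ (by simp only [Gate.inp, List.length_cons, List.length_nil]; omega)
            ⟨hfree (by omega) hj.2, Or.inl (hfree (by omega) hj'.2)⟩
      · exact hthree _ (by decide) rfl hj.2
  | CXZ t' =>
    cases t' with
    | double =>
      obtain ⟨rfl, rfl⟩ := status_B_eq_mid.1 hg.2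
      exact hthree _ (by decide) rfl (status_B_eq_free.1 hg.1).2
    | single => cases hb
  | _ => exact hg.elim

/-- Before a `D` gate on `p`, `p + 1` the situation mirrors that of `B`, with a second `D` gate
involved when a `CZ` has top wire `p + 1`. Before an `E` gate all other labelled wires lie above,
and only `Z` on the wire of `E` is critical. -/
theorem absorbs_D {w n p : ℕ} (hn : n ≤ w) (ih : (D n p).AbsorbsBelow w)
    (g : Gate × ℕ) (hg : (D n p).Pushable g) (hb : (D n p).Basic g) : (D n p).Absorbs w [g] := by
  intro N hN
  obtain ⟨g, j⟩ := g
  cases N with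
  | nil => cases hN
  | cons c N =>
    obtain ⟨S, h1, h2⟩ := clean_cons.1 hN
    rcases next_D_eq_some h1 with ⟨d, rfl, hd, hp, rfl⟩ | ⟨e, rfl, he, rfl, rfl⟩
    · have hlen : d.inp.length = 2 := by rw [Gate.inp_length_of_kind, hd]
      have hex : ∀ g : Gate, (g.inp.length + j ≤ p ∨ p + 2 ≤ j) →
          (D n (p + 1)).Pushable (g, j) →
          ∃ N', (D n p).Clean N' ∧ Pushes w ((g, j) :: (d, p) :: N) N' := fun g hd hg =>
        exists_pushes_of_disjoint h1 h2 (by simp only [hlen]; omega) (ih.next hn h1 _ hg)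
      have htwo : ∀ (g : Gate) (i : ℕ), (D 2 0, (g, i), [0]) ∈ criticalABD → j = p + i →
          ∃ N', (D n p).Clean N' ∧ Pushes w ((g, j) :: (d, p) :: N) N' := by
        rintro g i hmem rfl
        obtain ⟨m, rfl⟩ : ∃ m, n = p + 2 + m := ⟨n - (p + 2), by omega⟩
        exact exists_pushes_of_covered criticalABD_covered (cl := [(d, 0)]) hmem (by simp [hd])
          (nextList_cons_eq_some.2 ⟨_, next_D hd (by omega), rfl⟩) (compatible_ABD p m)
          (by simp only [size]; omega) h2 (ih.next hn h1)
      have hfree : ∀ {i : ℕ}, i < p ∨ p + 2 ≤ i → i < n → (D n (p + 1)).status i = .free :=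
        fun hi hi' => status_D_eq_free.2 ⟨by omega, hi'⟩
      cases g with
      | H t =>
        cases t with
        | double => exact absurd hg status_D_ne
        | single =>
          have hj := status_D_eq_free.1 hg
          by_cases hjp : j = p + 1
          · exact htwo _ 1 (by decide) hjp
          · exact hex _ (by simp only [Gate.inp, List.length_singleton]; omega)
              (hfree (by omega) hj.2)
      | Z t =>
        cases t with
        | double => exact absurd hg status_D_ne
        | single =>
          simp only [Pushable, status_D_eq_free, status_D_eq_low, status_D_ne, false_or] at hg
          by_cases hjp : j = p + 1
          · exact htwo _ 1 (by decide) hjp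
          by_cases hjp' : j = p
          · exact htwo _ 0 (by decide) hjp'
          · exact hex _ (by simp only [Gate.inp, List.length_singleton]; omega)
              (Or.inl (hfree (by omega) (by omega)))
      | X t =>
        cases t with
        | double => exact absurd hg status_D_ne
        | single => exact absurd (hg.resolve_right status_D_ne) hb
      | CZ t =>
        cases t with
        | double => exact hg.elim
        | single =>
          simp only [Pushable, status_D_eq_free, status_D_eq_low, status_D_ne, false_or] at hg
          by_cases hjp : j = p
          · exact htwo _ 0 (by decide) hjp
          by_cases hjp' : j = p + 1
          · subst hjp'
            obtain ⟨m, rfl⟩ : ∃ m, n = p + 3 + m := ⟨n - (p + 3), by omega⟩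
            -- The bottom wire `p + 2` of the `CZ` is labelled, so `D` rather than `E` comes next.
            obtain ⟨d', N, rfl, hd', h3⟩ := exists_of_clean_D h2 (by omega)
            exact exists_pushes_of_covered criticalABD_covered (S := D 3 0) (g := cz 1)
              (cl := [(d, 0), (d', 1)]) (by simp [criticalABD]) (by simp [hd, hd'])
              (nextList_cons_eq_some.2 ⟨_, next_D hd (by omega), nextList_cons_eq_some.2
                ⟨_, next_D hd' (by omega), rfl⟩⟩) (compatible_ABD p m)
              (by simp only [size]; omega) h3 (ih.next₂ hn h1 (next_D hd' (by omega)))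
          · exact hex _ (by simp only [Gate.inp, List.length_cons, List.length_nil]; omega)
              ⟨hfree (by omega) (by omega), Or.inl (hfree (by omega) (by omega))⟩
      | CXZ t =>
        cases t with
        | double => exact absurd hg.2 status_D_ne
        | single => cases hb
      | _ => exact hg.elim
    · have hlen : e.inp.length = 1 := by rw [Gate.inp_length_of_kind, he]
      have hex : ∀ g : Gate, g.inp.length + j ≤ p → (A p).Pushable (g, j) →
          ∃ N', (D (p + 1) p).Clean N' ∧ Pushes w ((g, j) :: (e, p) :: N) N' := fun g hd hg =>
        exists_pushes_of_disjoint h1 h2 (by simp only [hlen]; omega) (ih.next hn h1 _ hg)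
      cases g with
      | H t =>
        cases t with
        | double => exact absurd hg status_D_ne
        | single =>
          have hj := status_D_eq_free.1 hg
          exact hex _ (by simp only [Gate.inp, List.length_singleton]; omega)
            (status_A_eq_free.2 (by omega))
      | Z t =>
        cases t with
        | double => exact absurd hg status_D_ne
        | single =>
          simp only [Pushable, status_D_eq_free, status_D_eq_low, status_D_ne, false_or] at hg
          by_cases hjp : j = p
          · subst hjp
            exact exists_pushes_of_covered criticalE_covered (S := D 1 0) (g := z 0)
              (cl := [(e, 0)]) (by simp [criticalE]) (by simp [he])
              (nextList_cons_eq_some.2 ⟨_, next_E he, rfl⟩) (k := j) (m := 0)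
              (by simp [Compatible]) (by simp only [size]; omega) h2 (ih.next hn h1)
          · exact hex _ (by simp only [Gate.inp, List.length_singleton]; omega)
              (Or.inl (status_A_eq_free.2 (by omega)))
      | X t =>
        cases t with
        | double => exact absurd hg status_D_ne
        | single => exact absurd (hg.resolve_right status_D_ne) hb
      | CZ t =>
        cases t with
        | double => exact hg.elim
        | single =>
          simp only [Pushable, status_D_eq_free, status_D_eq_low, status_D_ne, false_or] at hg
          exact hex _ (by simp only [Gate.inp, List.length_cons, List.length_nil]; omega)
            ⟨status_A_eq_free.2 (by omega), Or.inl (status_A_eq_free.2 (by omega))⟩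
      | CXZ t =>
        cases t with
        | double => exact absurd hg.2 status_D_ne
        | single => cases hb
      | _ => exact hg.elim

/-- Every pushable gate can be pushed into every normal form. -/
theorem absorbs_of_pushable {w : ℕ} (S : State) (hS : S.size ≤ w) (g : Gate × ℕ)
    (hg : S.Pushable g) : S.Absorbs w [g] := by
  induction h : S.rank using WellFoundedLT.induction generalizing S g with
  | ind r ih =>
    subst h
    have ih : S.AbsorbsBelow w := fun S' hS' hw d hd => ih S'.rank hS' S' hw d hd rfl
    refine absorbs_of_basic (fun g hg hb => ?_) g hg
    cases S with
    | A n => exact absorbs_A hS ih g hg hb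
    | B n p t =>
      cases p with
      | zero => exact absorbs_B_zero hS ih g hg hb
      | succ p => exact absorbs_B_succ hS ih g hg hb
    | D n p => exact absorbs_D hS ih g hg hb

end State

end RealStab

namespace RealStab

/-! ## Types along normal forms -/

theorem HasType.getElem?_eq {σ τ : List WireType} {g : Gate × ℕ} {l : GateList}
    (h : HasType σ (g :: l) τ) {i : ℕ} (hi : i < g.1.inp.length) :
    σ[g.2 + i]? = g.1.inp[i]? := by
  obtain ⟨α, β, rfl, hα, -⟩ := hasType_cons_iff.1 h
  rw [← hα, List.append_assoc, List.getElem?_append_right (by omega), Nat.add_sub_cancel_left,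
    List.getElem?_append_left hi]

theorem HasType.unique {σ τ τ' : List WireType} {l : GateList} (h : HasType σ l τ)
    (h' : HasType σ l τ') : τ = τ' := by
  rw [← infer_eq_some_iff] at h h'
  exact Option.some.inj (h.symm.trans h')

theorem HasType.tail {σ ρ τ : List WireType} {l l' : GateList} (h : HasType σ (l ++ l') τ)
    (hl : HasType σ l ρ) : HasType ρ l' τ := by
  obtain ⟨ρ', h1, h2⟩ := hasType_append_iff.1 h
  rwa [hl.unique h1]

namespace State

/-- The type of a wire. -/
def typeAt : State → ℕ → WireType
  | B _ p t, j => if j = p then t else .single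
  | _, _ => .single

/-- The types of `w` wires. -/
def types (w : ℕ) (S : State) : List WireType := (List.range w).map S.typeAt

theorem getElem?_types {w : ℕ} {S : State} {j : ℕ} (hj : j < w) :
    (S.types w)[j]? = some (S.typeAt j) := by
  simp [types, hj]

theorem types_A (w n : ℕ) : (A n).types w = List.replicate w .single := by
  simp [types, List.eq_replicate_iff, typeAt]

theorem types_D (w n p : ℕ) : (D n p).types w = List.replicate w .single := by
  simp [types, List.eq_replicate_iff, typeAt]

theorem types_B (p r n : ℕ) (t : WireType) :
    (B n p t).types (p + 1 + r) = List.replicate p .single ++ [t] ++ List.replicate r .single := by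
  apply List.ext_getElem?
  intro j
  by_cases hj : j < p + 1 + r
  · rw [getElem?_types hj, List.getElem?_append, List.getElem?_append]
    simp only [typeAt, List.length_append, List.length_replicate, List.length_singleton]
    split_ifs <;> first
      | omega
      | rw [List.getElem?_replicate, if_pos (by omega)]
      | simp [*]
  · rw [List.getElem?_eq_none (by simp [types]; omega), List.getElem?_eq_none (by simp; omega)]

theorem inp_out_of_kind_A {g : Gate} (h : g.kind = .A) : g.inp = [.single] ∧ g.out = [g.topOut] := by
  cases g <;> first | exact ⟨rfl, rfl⟩ | cases h

theorem inp_out_of_kind_B {g : Gate} (h : g.kind = .B) :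
    g.inp = [.single, g.bottomIn] ∧ g.out = [g.topOut, .single] := by
  cases g <;> first | exact ⟨rfl, rfl⟩ | cases h

theorem inp_out_of_kind_C {g : Gate} (h : g.kind = .C) : g.inp = [.single] ∧ g.out = [.single] := by
  cases g <;> first | exact ⟨rfl, rfl⟩ | cases h

theorem inp_out_of_kind_D {g : Gate} (h : g.kind = .D) :
    g.inp = [.single, .single] ∧ g.out = [.single, .single] := by
  cases g <;> first | exact ⟨rfl, rfl⟩ | cases h

theorem inp_out_of_kind_E {g : Gate} (h : g.kind = .E) : g.inp = [.single] ∧ g.out = [.single] := by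
  cases g <;> first | exact ⟨rfl, rfl⟩ | cases h

theorem inp_eq_out_of_dirty {g : Gate} (h : g.kind = .dirty) : g.inp = g.out := by
  cases g <;> first | rfl | cases h

theorem hasType_single_wires {w : ℕ} {g : Gate × ℕ}
    (hi : g.1.inp = List.replicate g.1.inp.length .single)
    (ho : g.1.out = List.replicate g.1.inp.length .single) (hw : g.2 + g.1.inp.length ≤ w) :
    HasType (List.replicate w .single) [g] (List.replicate w .single) := by
  obtain ⟨r, rfl⟩ : ∃ r, w = g.2 + g.1.inp.length + r := ⟨_, (Nat.add_sub_cancel' hw).symm⟩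
  refine hasType_cons_iff.2 ⟨List.replicate g.2 .single, List.replicate r .single, ?_, by simp,
    hasType_nil_iff.2 ?_⟩
  · rw [List.replicate_add, List.replicate_add, ← hi]
  · rw [List.replicate_add, List.replicate_add, ← ho]

/-- Only the wire labelled 2 can be double, so the state determines the types of all wires. -/
theorem hasType_of_next {w : ℕ} {S S' : State} {g : Gate × ℕ} (h : S.next g = some S')
    (hw : S.size ≤ w) : HasType (S.types w) [g] (S'.types w) := by
  cases S with
  | A n =>
    obtain ⟨a, p, rfl, ha, hp, rfl⟩ := next_A_eq_some h
    obtain ⟨r, rfl⟩ : ∃ r, w = p + 1 + r := ⟨w - (p + 1), by simp only [size] at hw; omega⟩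
    obtain ⟨h1, h2⟩ := inp_out_of_kind_A ha
    rw [types_A, types_B]
    refine hasType_cons_iff.2 ⟨List.replicate p .single, List.replicate r .single, ?_, by simp,
      hasType_nil_iff.2 (by rw [h2])⟩
    simp [h1, List.replicate_add]
  | B n q t =>
    rcases next_B_eq_some h with ⟨b, p, rfl, hb, rfl, hp, rfl, rfl⟩ | ⟨c, rfl, hc, rfl, hp, rfl, rfl⟩
    · obtain ⟨r, rfl⟩ : ∃ r, w = p + 1 + 1 + r := ⟨w - (p + 2), by simp only [size] at hw; omega⟩
      obtain ⟨h1, h2⟩ := inp_out_of_kind_B hb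
      rw [types_B, show p + 1 + 1 + r = p + 1 + (r + 1) by omega, types_B]
      refine hasType_cons_iff.2 ⟨List.replicate p .single, List.replicate r .single, ?_, by simp,
        hasType_nil_iff.2 ?_⟩
      · simp [h1, List.replicate_succ']
      · simp [h2, List.replicate_succ]
    · obtain ⟨r, rfl⟩ : ∃ r, w = 0 + 1 + r := ⟨w - 1, by simp only [size] at hw; omega⟩
      obtain ⟨h1, h2⟩ := inp_out_of_kind_C hc
      have e : (B n 0 .single).types (0 + 1 + r) = List.replicate (0 + 1 + r) .single := by
        rw [types_B]; simp [List.replicate_add]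
      rw [e, types_D]
      exact hasType_single_wires (by rw [h1]; rfl) (by rw [h1, h2]; rfl)
        (by simp [h1])
  | D n p =>
    simp only [size] at hw
    rw [types_D]
    rcases next_D_eq_some h with ⟨d, rfl, hd, hp, rfl⟩ | ⟨e, rfl, he, rfl, rfl⟩
    · obtain ⟨h1, h2⟩ := inp_out_of_kind_D hd
      rw [types_D]
      exact hasType_single_wires (by rw [h1]; rfl) (by rw [h1, h2]; rfl) (by simp [h1]; omega)
    · obtain ⟨h1, h2⟩ := inp_out_of_kind_E he
      rw [types_A]
      exact hasType_single_wires (by rw [h1]; rfl) (by rw [h1, h2]; rfl) (by simp [h1]; omega)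

theorem hasType_of_nextList {w : ℕ} {S S' : State} {l : GateList} (h : S.nextList l = some S')
    (hw : S.size ≤ w) : HasType (S.types w) l (S'.types w) := by
  induction l generalizing S with
  | nil => cases h; exact .nil _
  | cons g l ih =>
    obtain ⟨T, h1, h2⟩ := nextList_cons_eq_some.1 h
    exact hasType_append_iff.2 ⟨_, hasType_of_next h1 hw,
      ih h2 ((size_le_of_next h1).trans hw)⟩

/-! ## Normal circuits are the paths of the automaton -/

theorem exists_bs_of_clean {n p : ℕ} {t : WireType} {N : GateList} (h : (B n p t).Clean N) :
    ∃ bs c N', (∀ b ∈ bs, b.kind = .B) ∧ c.kind = .C ∧ bs.length = p ∧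
      N = ascending bs ++ [(c, 0)] ++ N' ∧
      (B n p t).nextList (ascending bs ++ [(c, 0)]) = some (D n 0) ∧ (D n 0).Clean N' := by
  induction p generalizing t N with
  | zero =>
    cases N with
    | nil => cases h
    | cons g N =>
      obtain ⟨S, h1, h2⟩ := clean_cons.1 h
      obtain ⟨c, rfl, hc, hn, rfl, rfl⟩ := next_B_zero_eq_some h1
      exact ⟨[], c, N, by simp, hc, rfl, rfl, nextList_cons_eq_some.2 ⟨_, h1, rfl⟩, h2⟩
  | succ p ih =>
    obtain ⟨b, N, rfl, hb1, hb2, rfl, h2⟩ := exists_of_clean_B h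
    obtain ⟨bs, c, N', h3, h4, rfl, rfl, h5, h6⟩ := ih h2
    refine ⟨b :: bs, c, N', by simpa [hb1] using h3, h4, rfl, rfl, ?_, h6⟩
    exact nextList_cons_eq_some.2 ⟨_, next_B hb1 hb2, h5⟩

theorem exists_ds_of_clean {n p : ℕ} {N : GateList} (h : (D n p).Clean N) :
    ∃ ds e N', (∀ d ∈ ds, d.kind = .D) ∧ e.kind = .E ∧ p + ds.length + 1 = n ∧
      N = descending p ds ++ [(e, p + ds.length)] ++ N' ∧ (A (n - 1)).Clean N' := by
  induction hr : n - p generalizing p N with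
  | zero =>
    cases N with
    | nil => cases h
    | cons g N =>
      obtain ⟨S, h1, h2⟩ := clean_cons.1 h
      rcases next_D_eq_some h1 with ⟨d, rfl, hd, hp, rfl⟩ | ⟨e, rfl, he, rfl, rfl⟩ <;> omega
  | succ r ih =>
    cases N with
    | nil => cases h
    | cons g N =>
      obtain ⟨S, h1, h2⟩ := clean_cons.1 h
      rcases next_D_eq_some h1 with ⟨d, rfl, hd, hp, rfl⟩ | ⟨e, rfl, he, rfl, rfl⟩
      · obtain ⟨ds, e, N', h3, h4, h5, rfl, h6⟩ := ih h2 (by omega)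
        refine ⟨d :: ds, e, N', by simpa [hd] using h3, h4, by simp; omega, ?_, h6⟩
        simp only [descending, List.length_cons, List.cons_append, add_assoc, add_comm 1]
      · exact ⟨[], e, N, by simp, he, rfl, rfl, h2⟩

/-- Typing supplies what the automaton tests: the bottom input of each `B` gate has the type left by
the previous gate, and the input of `C` is single. -/
theorem nextList_ascending {n : ℕ} {bs : List Gate} {c : Gate} {τ : List WireType} {t : WireType}
    (hbs : ∀ b ∈ bs, b.kind = .B) (hc : c.kind = .C) (hn : bs.length < n)
    (h : HasType ((B n bs.length t).types n) (ascending bs ++ [(c, 0)]) τ) :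
    (B n bs.length t).nextList (ascending bs ++ [(c, 0)]) = some (D n 0) := by
  induction bs generalizing t with
  | nil =>
    have h1 := HasType.getElem?_eq h (i := 0) (by simp [(inp_out_of_kind_C hc).1])
    rw [getElem?_types (by simpa using hn)] at h1
    simp only [(inp_out_of_kind_C hc).1, typeAt, List.length_nil, add_zero, if_true] at h1
    obtain rfl : t = .single := by simpa using h1
    exact nextList_cons_eq_some.2 ⟨_, next_C hc hn, rfl⟩
  | cons b bs ih =>
    have hb := hbs b List.mem_cons_self
    -- Input number 1 of a `B` gate is its bottom wire, which is the wire labelled 2.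
    have h1 := HasType.getElem?_eq h (i := 1) (by simp [(inp_out_of_kind_B hb).1])
    rw [getElem?_types (by simpa using hn)] at h1
    simp only [(inp_out_of_kind_B hb).1, typeAt, List.length_cons, if_true] at h1
    obtain rfl : t = b.bottomIn := by simpa using h1
    have h2 := next_B hb hn
    exact nextList_cons_eq_some.2 ⟨_, h2, ih (fun b' hb' => hbs b' (List.mem_cons_of_mem _ hb'))
      ((Nat.lt_succ_self _).trans hn) (HasType.tail (l := [_]) h (hasType_of_next h2 le_rfl))⟩

theorem nextList_of_isZCircuit {n : ℕ} {l : GateList} (h : IsZCircuit n l) :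
    (A n).nextList l = some (D n 0) := by
  obtain ⟨a, bs, c, ha, hbs, hc, hn, rfl, ht⟩ := h
  have h1 := next_A ha hn
  rw [WellTyped, ← types_A n n] at ht
  exact nextList_cons_eq_some.2 ⟨_, h1, nextList_ascending hbs hc hn
    (HasType.tail (l := [_]) ht (hasType_of_next h1 le_rfl))⟩

theorem nextList_descending {p n : ℕ} {ds : List Gate} {e : Gate} (hds : ∀ d ∈ ds, d.kind = .D)
    (he : e.kind = .E) (hn : p + ds.length + 1 = n) :
    (D n p).nextList (descending p ds ++ [(e, p + ds.length)]) = some (A (n - 1)) := by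
  induction ds generalizing p with
  | nil =>
    subst hn
    exact nextList_cons_eq_some.2 ⟨_, next_E he, rfl⟩
  | cons d ds ih =>
    simp only [List.length_cons] at hn
    have := ih (p := p + 1) (fun d' hd' => hds d' (List.mem_cons_of_mem _ hd')) (by omega)
    refine nextList_cons_eq_some.2 ⟨_, next_D (hds d List.mem_cons_self) (by omega), ?_⟩
    rw [add_assoc, add_comm 1] at this
    exact this

theorem nextList_of_isXCircuit {n : ℕ} {l : GateList} (h : IsXCircuit n l) :
    (D n 0).nextList l = some (A (n - 1)) := by
  obtain ⟨ds, e, hds, he, hn, rfl⟩ := h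
  have := nextList_descending (p := 0) (n := n) hds he (by omega)
  simpa only [zero_add] using this

/-- The first `C` and the first `E` gate of an accepted list mark the ends of `L` and `M`, and
cutting there recovers the blocks recursively. -/
theorem isNormalList_iff {n : ℕ} {l : GateList} : IsNormalList n l ↔ (A n).Clean l := by
  constructor
  · intro h
    induction h with
    | zero => rfl
    | succ n L M N hL hM _ ih =>
      rw [List.append_assoc, clean_append (nextList_of_isZCircuit hL),
        clean_append (nextList_of_isXCircuit hM)]
      exact ih
  · intro h
    induction n generalizing l with
    | zero =>
      cases l with
      | nil => exact .zero
      | cons g l =>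
        obtain ⟨S, h1, -⟩ := clean_cons.1 h
        obtain ⟨a, p, rfl, ha, hp, rfl⟩ := next_A_eq_some h1
        omega
    | succ n ih =>
      cases l with
      | nil => cases h
      | cons g l =>
        obtain ⟨S, h1, h2⟩ := clean_cons.1 h
        obtain ⟨a, p, rfl, ha, hp, rfl⟩ := next_A_eq_some h1
        obtain ⟨bs, c, N, h3, h4, rfl, rfl, h5, h6⟩ := exists_bs_of_clean h2
        obtain ⟨ds, e, N', h7, h8, h9, rfl, h10⟩ := exists_ds_of_clean h6
        have hL : (A (n + 1)).nextList ((a, bs.length) :: ascending bs ++ [(c, 0)]) =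
          some (D (n + 1) 0) := nextList_cons_eq_some.2 ⟨_, h1, h5⟩
        have ht := hasType_of_nextList hL (le_refl (n + 1))
        rw [types_A, types_D] at ht
        have := IsNormalList.succ n _ _ N' ⟨a, bs, c, ha, h3, h4, hp, rfl, ht⟩
          ⟨ds, e, h7, h8, by omega, rfl⟩ (ih h10)
        simpa using this

/-! ## Dirty normal forms -/

/-- The labels of the wires in a state. -/
def label : State → ℕ → Label
  | A n, j => if j < n then .l1 else .final
  | B n p _, j => if j = p then .l2 else if j < n then .l1 else .final
  | D n p, j => if j = p then if p = 0 then .l3 else .l4 else if j < n then .l1 else .final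

/-- Hence the labels computed by folding `relabel` over a list are a function of the state reached.
-/
theorem relabel_label {S S' : State} {g : Gate × ℕ} (h : S.next g = some S') :
    relabel S.label g = S'.label := by
  funext j
  cases S with
  | A n =>
    obtain ⟨a, p, rfl, ha, hp, rfl⟩ := next_A_eq_some h
    simp only [relabel, ha, label, Function.update_apply]
  | B n q t =>
    rcases next_B_eq_some h with ⟨b, p, rfl, hb, rfl, hp, rfl, rfl⟩ | ⟨c, rfl, hc, rfl, hp, rfl, rfl⟩
    · simp only [relabel, hb, label, Function.update_apply]
      split_ifs <;> first | rfl | omega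
    · simp only [relabel, hc, label, Function.update_apply]
      split_ifs <;> rfl
  | D n p =>
    rcases next_D_eq_some h with ⟨d, rfl, hd, hp, rfl⟩ | ⟨e, rfl, he, rfl, rfl⟩
    · simp only [relabel, hd, label, Function.update_apply]
      split_ifs <;> first | rfl | omega
    · simp only [relabel, he, label, Function.update_apply]
      split_ifs <;> first | rfl | omega

theorem status_of_label_l1 {S : State} {j : ℕ} (h : S.label j = .l1) :
    S.status j = .free ∧ S.typeAt j = .single := by
  cases S <;> simp only [label, status, typeAt] at * <;> split_ifs at * <;> simp_all

theorem status_of_label_l2 {S : State} {j : ℕ} (h : S.label j = .l2) :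
    S.status j = .mid (S.typeAt j) := by
  cases S <;> simp only [label, status, typeAt] at * <;> split_ifs at * <;> simp_all

theorem status_of_label_l3 {S : State} {j : ℕ} (h : S.label j = .l3 ∨ S.label j = .l4) :
    S.status j = .low ∧ S.typeAt j = .single := by
  cases S <;> simp only [label, status, typeAt] at * <;> split_ifs at * <;> simp_all

theorem typeAt_eq_of_hasType {w : ℕ} {S : State} {g : Gate × ℕ} {l : GateList}
    {τ : List WireType} (h : HasType (S.types w) (g :: l) τ) (hg : 0 < g.1.inp.length) :
    some (S.typeAt g.2) = g.1.inp[0]? := by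
  have h1 := h.getElem?_eq (i := 0) hg
  have h2 := h1
  rw [List.getElem?_eq_getElem hg] at h2
  obtain ⟨h3, -⟩ := List.getElem?_eq_some_iff.1 h2
  rw [getElem?_types (by simpa [types] using h3)] at h1
  exact h1

/-- `Allowed` concerns labels, `Pushable` concerns labels together with types. The typing hypothesis
bridges the gap by identifying the type parameter of the gate with the type of its wire. -/
theorem pushable_of_allowed {w : ℕ} {S : State} {g : Gate × ℕ} {l : GateList} {τ : List WireType}
    (h : HasType (S.types w) (g :: l) τ) (hg : Allowed S.label g) : S.Pushable g := by
  obtain ⟨g, j⟩ := g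
  have l3 : S.label j = .l3 → S.status j = .low ∧ S.typeAt j = .single :=
    fun h => status_of_label_l3 (Or.inl h)
  have l4 : S.label j = .l4 → S.status j = .low ∧ S.typeAt j = .single :=
    fun h => status_of_label_l3 (Or.inr h)
  cases g with
  | H t | Z t | X t =>
    have ht := typeAt_eq_of_hasType h (by simp [Gate.inp])
    simp only [Gate.inp, List.getElem?_cons_zero, Option.some.injEq] at ht
    subst ht
    simp only [Allowed] at hg
    rcases hg with hg | hg
    · obtain ⟨h1, h2⟩ := status_of_label_l1 hg
      rw [h2]
      simp [Pushable, h1]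
    · have l2 := @status_of_label_l2 S j
      cases ht : S.typeAt j <;> simp_all [Pushable] <;>
        (rcases hg with hg | hg | hg <;> simp_all)
  | CZ t | CXZ t =>
    have ht := typeAt_eq_of_hasType h (by simp [Gate.inp])
    simp only [Gate.inp, List.getElem?_cons_zero, Option.some.injEq] at ht
    subst ht
    simp only [Allowed] at hg
    obtain ⟨h1, hg⟩ := hg
    have h1 := (status_of_label_l1 h1).1
    have l1 := @status_of_label_l1 S j
    have l2 := @status_of_label_l2 S j
    cases ht : S.typeAt j <;> simp_all [Pushable] <;>
      (rcases hg with hg | hg | hg <;> simp_all)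
  | _ => exact hg.elim

/-- Recursion along the list: the remainder is cleaned first, then a clean gate is put back in front
of it while a dirty gate is pushed into it. Dirty gates change neither state nor types, so the
hypotheses pass to the remainder. -/
theorem exists_pushes_of_dirty {w : ℕ} {S : State} (hS : S.size ≤ w) {l : GateList}
    {τ : List WireType} (ht : HasType (S.types w) l τ)
    (hl : S.Clean (l.filter fun g => g.1.kind ≠ .dirty))
    (hd : ∀ (u v : GateList) (g : Gate × ℕ), l = u ++ g :: v → g.1.kind = .dirty →
      Allowed (u.foldl relabel S.label) g) : ∃ N, S.Clean N ∧ Pushes w l N := by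
  induction l generalizing S with
  | nil => exact ⟨[], hl, .refl w _⟩
  | cons g l ih =>
    by_cases hg : g.1.kind = .dirty
    · have hp := pushable_of_allowed ht (hd [] l g rfl hg)
      obtain ⟨α, β, h1, h2, h3⟩ := hasType_cons_iff.1 ht
      rw [← inp_eq_out_of_dirty hg, ← h1] at h3
      rw [List.filter_cons_of_neg (by simpa using hg)] at hl
      obtain ⟨N, h4, h5⟩ := ih hS h3 hl fun u v g' h hg' => by
        have := hd (g :: u) v g' (by rw [h]; rfl) hg'
        simpa only [List.foldl_cons, relabel, hg] using this
      obtain ⟨N', h6, h7⟩ := absorbs_of_pushable S hS g hp N h4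
      refine ⟨N', h6, .trans ?_ h7⟩
      simpa using h5.congr [g] []
    · rw [List.filter_cons_of_pos (by simpa using hg)] at hl
      obtain ⟨S', h1, h2⟩ := clean_cons.1 hl
      obtain ⟨N, h4, h5⟩ := ih ((size_le_of_next h1).trans hS)
        (HasType.tail (l := [g]) ht (hasType_of_next h1 hS)) h2 fun u v g' h hg' => by
          have := hd (g :: u) v g' (by rw [h]; rfl) hg'
          simpa only [List.foldl_cons, relabel_label h1] using this
      refine ⟨g :: N, clean_cons.2 ⟨S', h1, h4⟩, ?_⟩
      simpa using h5.congr [g] []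

end State

theorem Pushes.rewrites {n : ℕ} {l l' : GateList} (h : Pushes n l l') (hl : WellTyped n l)
    (s : ℤˣ) : ∃ t : ℤˣ, Rewrites pushRelations n (s, l) (t, l') := by
  obtain ⟨t, ht⟩ := h
  refine ⟨s * t, (Steps.rewrites ?_ hl).2⟩
  simpa using ht s [] []

theorem IsDirtyNormal.exists_normalForm {n : ℕ} {d : Circuit} (hd : IsDirtyNormal n d) :
    ∃ N : Circuit, IsNormalFormOf n N (d.op n) ∧ Rewrites pushRelations n d N := by
  obtain ⟨h1, h2, h3⟩ := hd
  obtain ⟨N, h4, h5⟩ := State.exists_pushes_of_dirty (S := .A n) (le_refl n)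
    (by rw [State.types_A]; exact h2) (State.isNormalList_iff.1 h1) h3
  obtain ⟨t, ht⟩ := h5.rewrites h2 d.1
  exact ⟨(t, N), ⟨State.isNormalList_iff.2 h4,
    (ht.mono mem_typedRelations_of_mem_pushRelations).op_eq.symm⟩, ht⟩

end RealStab

namespace RealStab

/-! ## The normal form of the identity -/

/-- A gate on the wires `0, …, n - 1`, all whose wires have single type. -/
def IsSingle (n : ℕ) (g : Gate × ℕ) : Prop :=
  g.1.inp = List.replicate g.1.inp.length .single ∧
    g.1.out = List.replicate g.1.inp.length .single ∧ g.2 + g.1.inp.length ≤ n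

theorem wellTyped_of_isSingle {n : ℕ} {l : GateList} (h : ∀ g ∈ l, IsSingle n g) :
    WellTyped n l := by
  induction l with
  | nil => exact .nil _
  | cons g l ih =>
    have hg := h g List.mem_cons_self
    exact hasType_append_iff.2 ⟨_, State.hasType_single_wires hg.1 hg.2.1 hg.2.2,
      ih fun g' hg' => h g' (List.mem_cons_of_mem _ hg')⟩

/-- The gates `B1` on the wires `(k - 1, k), …, (0, 1)`, then `C1`, then the gates `D1` on the wires
`(0, 1), …, (k - 1, k)`. -/
def identityBCD : ℕ → GateList
  | 0 => [(.C1, 0)]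
  | k + 1 => (.B1, k) :: identityBCD k ++ [(.D1, k)]

/-- The normal form of the identity. -/
def identityNormal : ℕ → GateList
  | 0 => []
  | n + 1 => (.A1, n) :: identityBCD n ++ (.E1, n) :: identityNormal n

theorem isSingle_identityBCD {n k : ℕ} (h : k < n) : ∀ g ∈ identityBCD k, IsSingle n g := by
  induction k with
  | zero =>
    simp only [identityBCD, List.mem_singleton, forall_eq]
    exact ⟨rfl, rfl, h⟩
  | succ k ih =>
    simp only [identityBCD, List.cons_append, List.mem_cons, List.mem_append, List.not_mem_nil,
      or_false]
    rintro g (rfl | hg | rfl)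
    · exact ⟨rfl, rfl, h⟩
    · exact ih (by omega) g hg
    · exact ⟨rfl, rfl, h⟩

theorem isSingle_identityNormal {n m : ℕ} (h : m ≤ n) : ∀ g ∈ identityNormal m, IsSingle n g := by
  induction m with
  | zero => simp [identityNormal]
  | succ m ih =>
    simp only [identityNormal, List.cons_append, List.mem_cons, List.mem_append]
    rintro g (rfl | hg | rfl | hg)
    · exact ⟨rfl, rfl, h⟩
    · exact isSingle_identityBCD h g hg
    · exact ⟨rfl, rfl, h⟩
    · exact ih (by omega) g hg

theorem Rewrites.trans {R : List CircuitRelation} {n : ℕ} {a b c : Circuit}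
    (h : Rewrites R n a b) (h' : Rewrites R n b c) : Rewrites R n a c :=
  Relation.ReflTransGen.trans h h'

theorem rewrites_of_mem_expansionRelations {n k : ℕ} {l r : GateList} {w : ℕ}
    (hr : eqn w l r ∈ expansionRelations) (hk : k + w ≤ n) (s : ℤˣ) {u v : GateList}
    (h : ∀ g ∈ u ++ shift k l ++ v, IsSingle n g) (h' : ∀ g ∈ u ++ shift k r ++ v, IsSingle n g) :
    Rewrites typedRelations n (s, u ++ shift k l ++ v) (s, u ++ shift k r ++ v) := by
  have := Step.rel (R := typedRelations) (n := n) _ k s u v (List.mem_append_right _ hr) hk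
  simp only [eqn, mul_one] at this
  exact .single ⟨wellTyped_of_isSingle h, wellTyped_of_isSingle h', this⟩

/-- Repeated expansion moves the `C1` gate up one wire at a time, leaving a `B1` on its left and a
`D1` on its right, until it reaches wire 0. -/
theorem rewrites_identityBCD {n k : ℕ} (h : k < n) (s : ℤˣ) {u v : GateList}
    (hu : ∀ g ∈ u, IsSingle n g) (hv : ∀ g ∈ v, IsSingle n g) :
    Rewrites typedRelations n (s, u ++ [(.C1, k)] ++ v) (s, u ++ identityBCD k ++ v) := by
  induction k generalizing u v with
  | zero => exact .refl
  | succ k ih =>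
    have hB : IsSingle n (.B1, k) := ⟨rfl, rfl, h⟩
    have hC : IsSingle n (.C1, k) := ⟨rfl, rfl, Nat.lt_of_succ_lt h⟩
    have hC' : IsSingle n (.C1, k + 1) := ⟨rfl, rfl, h⟩
    have hD : IsSingle n (.D1, k) := ⟨rfl, rfl, h⟩
    have h1 := rewrites_of_mem_expansionRelations (n := n) (k := k) (w := 2) (l := [(.C1, 1)])
      (r := [(.B1, 0), (.C1, 0), (.D1, 0)]) (by simp [expansionRelations]) (by omega) s (u := u)
      (v := v) (by simp [shift]; grind) (by simp [shift]; grind)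
    have h2 := ih (by omega) (u := u ++ [(.B1, k)]) (v := (.D1, k) :: v) (by simp; grind)
      (by simp; grind)
    refine h1.trans ?_
    simpa [identityBCD, shift] using h2

/-- For the bottom wire create `A1 C1 E1`, expand its `C1` up to wire 0, and continue to the right
with the wires above. -/
theorem rewrites_identityNormal {n m : ℕ} (h : m ≤ n) (s : ℤˣ) {u : GateList}
    (hu : ∀ g ∈ u, IsSingle n g) :
    Rewrites typedRelations n (s, u) (s, u ++ identityNormal m) := by
  induction m generalizing u with
  | zero => simp only [identityNormal, List.append_nil]; exact .refl
  | succ m ih =>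
    have hA : IsSingle n (.A1, m) := ⟨rfl, rfl, h⟩
    have hC : IsSingle n (.C1, m) := ⟨rfl, rfl, h⟩
    have hE : IsSingle n (.E1, m) := ⟨rfl, rfl, h⟩
    have h1 := rewrites_of_mem_expansionRelations (n := n) (k := m) (w := 1) (l := [])
      (r := [(.A1, 0), (.C1, 0), (.E1, 0)]) (by simp [expansionRelations]) h s (u := u)
      (v := []) (by simpa [shift] using hu) (by simp [shift]; grind)
    have h2 := rewrites_identityBCD (n := n) (k := m) h s (u := u ++ [(.A1, m)]) (v := [(.E1, m)])
      (by simp; grind) (by simp; grind)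
    have hBCD := isSingle_identityBCD h
    have h3 := ih (u := u ++ [(.A1, m)] ++ identityBCD m ++ [(.E1, m)]) (by omega) (by simp; grind)
    refine Rewrites.trans (by simpa [shift] using h1) (Rewrites.trans (by simpa using h2) ?_)
    simpa [identityNormal] using h3

theorem State.nextList_identityBCD {n k : ℕ} (h : k < n) :
    (State.B n k .single).nextList (identityBCD k) = some (.D n k) := by
  induction k with
  | zero => exact nextList_cons_eq_some.2 ⟨_, next_C rfl h, rfl⟩
  | succ k ih =>
    refine nextList_cons_eq_some.2 ⟨.B n k .single, next_B (b := .B1) rfl h, ?_⟩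
    refine (nextList_append (l' := [(.D1, k)])).trans ?_
    rw [ih (by omega)]
    exact nextList_cons_eq_some.2 ⟨_, next_D rfl h, rfl⟩

theorem State.clean_identityNormal (n : ℕ) : (State.A n).Clean (identityNormal n) := by
  induction n with
  | zero => rfl
  | succ n ih =>
    refine clean_cons.2 ⟨.B (n + 1) n .single, next_A (a := .A1) rfl (by omega), ?_⟩
    refine (clean_append (nextList_identityBCD (by omega))).2 ?_
    exact clean_cons.2 ⟨_, next_E rfl, ih⟩

/-- Once the normal form of the identity is appended, all gates of the circuit stand before a normal
form in the state `A n`, where `H`, `Z` and `CZ` are pushable on every wire. -/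
theorem exists_normalForm_rewrites {n : ℕ} {c : PrimCircuit} (hc : c.OnWires n) :
    ∃ N : Circuit, IsNormalFormOf n N (c.op n) ∧ Rewrites typedRelations n c.toCircuit N := by
  have hs : ∀ g ∈ c.toCircuit.2, IsSingle n g := by
    intro g hg
    obtain ⟨⟨g, p⟩, hg', rfl⟩ := List.mem_map.1 hg
    have := hc _ hg'
    cases g <;> exact ⟨rfl, rfl, this⟩
  have h1 := rewrites_identityNormal (le_refl n) c.1 hs
  have h2 : (State.A n).Absorbs n c.toCircuit.2 := by
    refine .of_forall fun g hg => State.absorbs_of_pushable _ (le_refl n) g ?_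
    obtain ⟨⟨g, p⟩, hg', rfl⟩ := List.mem_map.1 hg
    have := hc _ hg'
    cases g
    · exact State.status_A_eq_free.2 this
    · exact Or.inl (State.status_A_eq_free.2 this)
    · exact ⟨State.status_A_eq_free.2 this, Or.inl (State.status_A_eq_free.2 (by
        simp only [Prim.arity] at this; omega))⟩
  obtain ⟨N, h3, h4⟩ := h2 _ (State.clean_identityNormal n)
  obtain ⟨t, ht⟩ := h4.rewrites (wellTyped_of_isSingle fun g hg =>
    (List.mem_append.1 hg).elim (hs g) (isSingle_identityNormal le_rfl g)) c.1
  have h5 : Rewrites typedRelations n c.toCircuit (t, N) :=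
    h1.trans (ht.mono mem_typedRelations_of_mem_pushRelations)
  refine ⟨(t, N), ⟨State.isNormalList_iff.2 h3, ?_⟩, h5⟩
  rw [← h5.op_eq, Circuit.op, forget_toCircuit]
  rfl

end RealStab

namespace RealStab

open Matrix

/-! ## Pauli operators as circuits -/

/-- The Pauli matrices `1`, `X`, `Z` and `Y = X * Z`. -/
inductive Letter
  | I | X | Z | Y
  deriving DecidableEq

namespace Letter

/-- The matrix of a letter. -/
def mat : Letter → Matrix (Fin 2) (Fin 2) ℝ
  | I => 1
  | X => matX
  | Z => matZ
  | Y => matX * matZ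

/-- A circuit of a letter. -/
def word : Letter → List (Prim × ℕ)
  | I => []
  | X => [(.H, 0), (.Z, 0), (.H, 0)]
  | Z => [(.Z, 0)]
  | Y => [(.Z, 0), (.H, 0), (.Z, 0), (.H, 0)]

/-- All letters. -/
def all : List Letter := [I, X, Z, Y]

theorem mem_all (a : Letter) : a ∈ all := by cases a <;> decide

/-- Whether a letter flips the bit. -/
def flip : Letter → Fin 2
  | I => 0
  | X => 1
  | Z => 0
  | Y => 1

/-- The sign for the bit `1`. -/
def phase : Letter → ℝ
  | I => 1
  | X => 1
  | Z => -1
  | Y => -1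

theorem ext_flip_phase {a b : Letter} (h : a.flip = b.flip) (h' : a.phase = b.phase) : a = b := by
  cases a <;> cases b <;> first
    | rfl
    | (exfalso; revert h; decide)
    | (exfalso; revert h'; simp only [phase]; norm_num)

theorem mat_zero (a : Letter) (i : Fin 2) : a.mat i 0 = if i = a.flip then 1 else 0 := by
  cases a <;> fin_cases i <;> simp [mat, flip, matX, matZ, Matrix.one_apply]

theorem mat_one (a : Letter) (i : Fin 2) : a.mat i 1 = if i = a.flip then 0 else a.phase := by
  cases a <;> fin_cases i <;> simp [mat, flip, phase, matX, matZ, Matrix.one_apply]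

theorem mat_cases (a : Letter) :
    a.mat = 1 ∨ a.mat = matX ∨ a.mat = matZ ∨ a.mat = matX * matZ := by
  cases a <;> simp [mat]

theorem word_fits (a : Letter) : Fits 1 a.word := by cases a <;> decide

end Letter

theorem matH_mul_matZ_mul_matH : matH * matZ * matH = matX := by
  have h : (√2 : ℝ) * √2 = 2 := Real.mul_self_sqrt (by norm_num)
  ext i j
  fin_cases i <;> fin_cases j <;>
    simp [matH, matZ, matX, Matrix.mul_apply, Fin.sum_univ_two] <;> field_simp <;> nlinarith

theorem onWire_mul (n p : ℕ) (M N : Matrix (Fin 2) (Fin 2) ℝ) :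
    onWire n p M * onWire n p N = onWire n p (M * N) := by
  simp only [onWire, tensor_mul]
  congr 1
  funext i
  split_ifs <;> simp

@[simp] theorem onWire_one (n p : ℕ) : onWire n p 1 = 1 := by
  simp [onWire]

theorem opOfList_word (n p : ℕ) (a : Letter) :
    opOfList n (shift p a.word) = onWire n p a.mat := by
  have hH : Prim.op n (.H, p) = onWire n p matH := rfl
  have hZ : Prim.op n (.Z, p) = onWire n p matZ := rfl
  cases a <;> simp [Letter.word, shift, opOfList, hH, hZ, onWire_mul, Letter.mat,
    ← matH_mul_matZ_mul_matH, mul_assoc]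

/-- The circuit of the letters `ls` on the wires from `p` on. -/
def pauliWord : ℕ → List Letter → List (Prim × ℕ)
  | _, [] => []
  | p, a :: ls => shift p a.word ++ pauliWord (p + 1) ls

theorem pauliWord_append (p : ℕ) (ls ls' : List Letter) :
    pauliWord p (ls ++ ls') = pauliWord p ls ++ pauliWord (p + ls.length) ls' := by
  induction ls generalizing p with
  | nil => rfl
  | cons a ls ih => simp [pauliWord, ih, add_assoc, add_comm 1]

theorem shift_pauliWord (k p : ℕ) (ls : List Letter) :
    shift k (pauliWord p ls) = pauliWord (k + p) ls := by
  induction ls generalizing p with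
  | nil => rfl
  | cons a ls ih => simp [pauliWord, shift_append, shift_shift, ih, add_assoc]

theorem mem_pauliWord {p : ℕ} {ls : List Letter} {g : Prim × ℕ} (h : g ∈ pauliWord p ls) :
    p ≤ g.2 ∧ g.2 + g.1.arity ≤ p + ls.length := by
  induction ls generalizing p with
  | nil => simp [pauliWord] at h
  | cons a ls ih =>
    rcases List.mem_append.1 h with h | h
    · obtain ⟨g', hg', rfl⟩ := List.mem_map.1 h
      have := a.word_fits g' hg'
      simp only [List.length_cons]
      omega
    · have := ih h
      simp only [List.length_cons]
      omega

/-- The tensor product of the letters `ls`, continued by `I`. -/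
def pauliTensor (n : ℕ) (ls : List Letter) : Op n := tensor fun i => (ls.getD i .I).mat

theorem opOfList_pauliWord (n : ℕ) (ls : List Letter) :
    opOfList n (pauliWord 0 ls) = pauliTensor n ls := by
  have key : ∀ p, opOfList n (pauliWord p ls) =
      tensor fun i : Fin n => if (i : ℕ) < p then 1 else (ls.getD (i - p) .I).mat := by
    induction ls with
    | nil => intro p; simp [pauliWord, opOfList, Letter.mat]
    | cons a ls ih =>
      intro p
      rw [pauliWord, opOfList_append, ih, opOfList_word, onWire, tensor_mul]
      congr 1
      funext i
      rcases lt_trichotomy (i : ℕ) p with h | h | h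
      · simp [h, h.ne, show (i : ℕ) < p + 1 by omega]
      · simp [h]
      · rw [if_neg (by omega), if_neg (by omega), if_neg (by omega), mul_one,
          show (i : ℕ) - p = (i - (p + 1)) + 1 by omega, List.getD_cons_succ]
  rw [key 0]
  simp [pauliTensor]

theorem mem_pauliGroup_iff {n : ℕ} {P : Op n} : P ∈ pauliGroup n ↔
    ∃ (s : ℤˣ) (ls : List Letter), ls.length = n ∧ P = ((s : ℤ) : ℝ) • pauliTensor n ls := by
  constructor
  · rintro ⟨s, f, hf, rfl⟩
    have : ∀ i, ∃ a : Letter, f i = a.mat := by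
      intro i
      rcases hf i with h | h | h | h
      exacts [⟨.I, h⟩, ⟨.X, h⟩, ⟨.Z, h⟩, ⟨.Y, h⟩]
    choose a ha using this
    refine ⟨s, List.ofFn a, List.length_ofFn, ?_⟩
    congr 2
    funext i
    simp [ha]
  · rintro ⟨s, ls, -, rfl⟩
    exact ⟨s, _, fun i => Letter.mat_cases _, rfl⟩

theorem tensor_mat_apply_zero {n : ℕ} (w : Fin n → Letter) (x : Fin n → Fin 2) :
    tensor (fun i => (w i).mat) x 0 = if ∀ i, x i = (w i).flip then 1 else 0 := by
  simp only [tensor, Pi.zero_apply, Letter.mat_zero, Fintype.prod_boole]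
  congr 1

theorem tensor_mat_apply_single {n : ℕ} (w : Fin n → Letter) (k : Fin n) :
    tensor (fun i => (w i).mat) (Function.update (fun i => (w i).flip) k ((w k).flip + 1))
      (Pi.single k 1) = (w k).phase := by
  rw [tensor, Finset.prod_eq_single k]
  · have : (w k).flip + 1 ≠ (w k).flip := by generalize (w k).flip = a; fin_cases a <;> decide
    simp [Letter.mat_one, this]
  · intro i _ hi
    simp [hi, Letter.mat_zero]
  · simp

/-- The column of the zero index has a single nonzero entry: its value is the sign, its row gives
the bits flipped by the letters. The column of the index with only bit `k` set then gives the phase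
of letter `k`, and flip and phase determine a letter. -/
theorem tensor_mat_injective {n : ℕ} {s s' : ℤˣ} {w w' : Fin n → Letter}
    (h : ((s : ℤ) : ℝ) • tensor (fun i => (w i).mat) =
      ((s' : ℤ) : ℝ) • tensor fun i => (w' i).mat) : s = s' ∧ w = w' := by
  have hs : ((s : ℤ) : ℝ) ≠ 0 := by exact_mod_cast s.ne_zero
  have h1 := congrFun (congrFun h fun i => (w i).flip) 0
  simp only [Matrix.smul_apply, tensor_mat_apply_zero, smul_eq_mul] at h1
  rw [if_pos fun _ => trivial, mul_one] at h1
  split_ifs at h1 with h2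
  · rw [mul_one] at h1
    have hss : s = s' := by exact_mod_cast h1
    refine ⟨hss, funext fun k => Letter.ext_flip_phase (h2 k) ?_⟩
    have h3 := congrFun (congrFun h (Function.update (fun i => (w i).flip) k ((w k).flip + 1)))
      (Pi.single k 1)
    have h4 := tensor_mat_apply_single w' k
    rw [← h2 k, show (fun i => (w' i).flip) = fun i => (w i).flip from funext fun i => (h2 i).symm]
      at h4
    simp only [Matrix.smul_apply, tensor_mat_apply_single, smul_eq_mul, h4, ← hss] at h3
    exact mul_left_cancel₀ hs h3
  · simp [hs] at h1

theorem pauliTensor_injective {n : ℕ} {s s' : ℤˣ} {ls ls' : List Letter}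
    (h : ((s : ℤ) : ℝ) • pauliTensor n ls = ((s' : ℤ) : ℝ) • pauliTensor n ls') :
    s = s' ∧ ∀ i < n, ls.getD i .I = ls'.getD i .I := by
  obtain ⟨h1, h2⟩ := tensor_mat_injective (w := fun i : Fin n => ls.getD i .I)
    (w' := fun i : Fin n => ls'.getD i .I) h
  exact ⟨h1, fun i hi => congrFun h2 ⟨i, hi⟩⟩

/-! ## The Clifford group -/

theorem finite_pauliGroup (n : ℕ) : (pauliGroup n).Finite := by
  have : pauliGroup n ⊆ Set.range fun q : ℤˣ × (Fin n → Fin 4) =>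
      ((q.1 : ℤ) : ℝ) • tensor fun i => (![1, matX, matZ, matX * matZ] (q.2 i)) := by
    rintro P ⟨s, f, hf, rfl⟩
    have : ∀ i, ∃ j : Fin 4, f i = ![1, matX, matZ, matX * matZ] j := by
      intro i
      rcases hf i with h | h | h | h
      exacts [⟨0, h⟩, ⟨1, h⟩, ⟨2, h⟩, ⟨3, h⟩]
    choose j hj using this
    refine ⟨(s, j), ?_⟩
    simp only [← hj]
  exact (Set.finite_range _).subset this

theorem isUnit_of_mem_cliffordGroup {n : ℕ} {U : Op n} (h : U ∈ cliffordGroup n) : IsUnit U.det :=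
  (Matrix.isUnit_iff_isUnit_det U).1 (IsUnit.of_mul_eq_one _ ((mem_orthogonalGroup_iff _ _).1 h.1))

/-- `cliffordGroup` only asks that `U P U⁻¹` be Pauli. Conjugation is injective and the Pauli group
finite, so it is also surjective and `U⁻¹ P U` is Pauli too. -/
theorem exists_conj_eq {n : ℕ} {U : Op n} (h : U ∈ cliffordGroup n) {P : Op n}
    (hP : P ∈ pauliGroup n) : ∃ Q ∈ pauliGroup n, U * Q = P * U := by
  have hU := isUnit_of_mem_cliffordGroup h
  have hinj : Set.InjOn (fun Q => U * Q * U⁻¹) (pauliGroup n) := by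
    intro Q _ Q' _ hQ
    have := congrArg (fun M => U⁻¹ * M * U) hQ
    simpa [mul_assoc, nonsing_inv_mul _ hU, nonsing_inv_mul_cancel_left _ _ hU] using this
  obtain ⟨Q, hQ, h1⟩ := ((Set.Finite.injOn_iff_bijOn_of_mapsTo
    (finite_pauliGroup n) h.2).1 hinj).surjOn hP
  refine ⟨Q, hQ, ?_⟩
  rw [← h1]
  simp [mul_assoc, nonsing_inv_mul _ hU]

theorem one_mem_cliffordGroup (n : ℕ) : 1 ∈ cliffordGroup n :=
  ⟨one_mem _, fun P hP => by simpa using hP⟩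

theorem mul_mem_cliffordGroup {n : ℕ} {U V : Op n} (hU : U ∈ cliffordGroup n)
    (hV : V ∈ cliffordGroup n) : U * V ∈ cliffordGroup n := by
  refine ⟨mul_mem hU.1 hV.1, fun P hP => ?_⟩
  have := hU.2 _ (hV.2 P hP)
  rw [Matrix.mul_inv_rev]
  simpa only [mul_assoc] using this

theorem inv_mem_cliffordGroup {n : ℕ} {U : Op n} (hU : U ∈ cliffordGroup n) :
    U⁻¹ ∈ cliffordGroup n := by
  have h := isUnit_of_mem_cliffordGroup hU
  have e : U⁻¹ = Uᵀ := inv_eq_right_inv ((mem_orthogonalGroup_iff _ _).1 hU.1)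
  refine ⟨by rw [e]; exact Unitary.star_mem hU.1, fun P hP => ?_⟩
  obtain ⟨Q, hQ, h1⟩ := exists_conj_eq hU hP
  rw [nonsing_inv_nonsing_inv _ h, mul_assoc, ← h1, nonsing_inv_mul_cancel_left _ _ h]
  exact hQ

theorem smul_mem_cliffordGroup {n : ℕ} {U : Op n} (hU : U ∈ cliffordGroup n) (s : ℤˣ) :
    ((s : ℤ) : ℝ) • U ∈ cliffordGroup n := by
  rcases Int.units_eq_one_or s with rfl | rfl
  · simpa using hU
  · have h := isUnit_of_mem_cliffordGroup hU
    have h1 := (mem_orthogonalGroup_iff _ _).1 hU.1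
    have e : (-U)⁻¹ = -U⁻¹ := inv_eq_right_inv (by simp [mul_nonsing_inv _ h])
    have : -U ∈ cliffordGroup n := by
      refine ⟨(mem_orthogonalGroup_iff _ _).2 (by simpa using h1), fun P hP => ?_⟩
      rw [e]
      simpa using hU.2 P hP
    simpa using this

theorem sameOp_exchange_lists {n : ℕ} {l l' : List (Prim × ℕ)}
    (h : ∀ a ∈ l, ∀ b ∈ l', a.2 + a.1.arity ≤ b.2 ∨ b.2 + b.1.arity ≤ a.2) :
    SameOp n 1 (l ++ l') (l' ++ l) := by
  have := (EqualModulo.exchange_lists (R := typedRelations) (n := n) l l' h 1 [] []).op_eq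
  rw [PrimCircuit.op_eq_iff] at this
  simpa using this

/-- All lists of letters of the given length. -/
def allLetters : ℕ → List (List Letter)
  | 0 => [[]]
  | n + 1 => Letter.all.flatMap fun a => (allLetters n).map (a :: ·)

theorem mem_allLetters (ls : List Letter) : ls ∈ allLetters ls.length := by
  induction ls with
  | nil => simp [allLetters]
  | cons a ls ih =>
    simp only [List.length_cons, allLetters, List.mem_flatMap]
    exact ⟨a, a.mem_all, List.mem_map_of_mem ih⟩

theorem length_of_mem_allLetters {n : ℕ} {ls : List Letter} (h : ls ∈ allLetters n) :
    ls.length = n := by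
  induction n generalizing ls with
  | zero => simpa [allLetters] using h
  | succ n ih =>
    simp only [allLetters, List.mem_flatMap, List.mem_map] at h
    obtain ⟨a, -, ls, h, rfl⟩ := h
    simp [ih h]

/-- A finite search: each generator, on its own wires, carries every tensor product of letters to
another one up to sign. -/
theorem conj_pauliWord_checkEq : ([Prim.H, .Z, .CZ].all fun g => (allLetters g.arity).all fun ls =>
    (allLetters g.arity).any fun ls' =>
      checkEq g.arity 1 (pauliWord 0 ls ++ [(g, 0)]) ([(g, 0)] ++ pauliWord 0 ls') ||
      checkEq g.arity (-1) (pauliWord 0 ls ++ [(g, 0)]) ([(g, 0)] ++ pauliWord 0 ls')) = true := by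
  decide +kernel

theorem exists_conj_pauliWord (g : Prim) (ls : List Letter) (h : ls.length = g.arity) :
    ∃ (s : ℤˣ) (ls' : List Letter), ls'.length = g.arity ∧
      checkEq g.arity s (pauliWord 0 ls ++ [(g, 0)]) ([(g, 0)] ++ pauliWord 0 ls') = true := by
  have h1 := List.all_eq_true.1 conj_pauliWord_checkEq g (by cases g <;> decide)
  have h2 := List.all_eq_true.1 h1 ls (h ▸ mem_allLetters ls)
  obtain ⟨ls', h3, h4⟩ := List.any_eq_true.1 h2
  rcases Bool.or_eq_true_iff.1 h4 with h4 | h4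
  · exact ⟨1, ls', length_of_mem_allLetters h3, h4⟩
  · exact ⟨-1, ls', length_of_mem_allLetters h3, h4⟩

theorem op_mul_self (n : ℕ) (g : Prim × ℕ) (hg : g.2 + g.1.arity ≤ n) :
    Prim.op n g * Prim.op n g = 1 := by
  obtain ⟨g, p⟩ := g
  have h : checkEq g.arity 1 [(g, 0), (g, 0)] [] = true := by cases g <;> decide +kernel
  have := checkEq.sameOp_shift h hg
  simpa [SameOp, shift, opOfList] using this

theorem op_transpose (n : ℕ) (g : Prim × ℕ) : (Prim.op n g)ᵀ = Prim.op n g := by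
  have key : ∀ (p : ℕ) (M : Matrix (Fin 2) (Fin 2) ℝ), Mᵀ = M →
      (onWire n p M)ᵀ = onWire n p M := by
    intro p M hM
    ext x y
    simp only [transpose_apply, onWire, tensor]
    refine Finset.prod_congr rfl fun i _ => ?_
    split_ifs
    · conv_lhs => rw [← hM, transpose_apply]
    · rw [one_apply, one_apply]; simp only [eq_comm]
  obtain ⟨g, p⟩ := g
  cases g with
  | H => exact key p matH (by ext i j; fin_cases i <;> fin_cases j <;> simp [matH])
  | Z => exact key p matZ (by ext i j; fin_cases i <;> fin_cases j <;> simp [matZ])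
  | CZ => simp [Prim.op]

/-- Gates are symmetric involutions, hence orthogonal. A Pauli operator splits into the letters
above, on and below the wires of the gate; the outer letters commute with the gate and the inner
ones are covered by the finite search. -/
theorem op_mem_cliffordGroup {n : ℕ} (g : Prim × ℕ) (hg : g.2 + g.1.arity ≤ n) :
    Prim.op n g ∈ cliffordGroup n := by
  have h1 := op_mul_self n g hg
  have hinv : (Prim.op n g)⁻¹ = Prim.op n g := inv_eq_right_inv h1
  refine ⟨(mem_orthogonalGroup_iff _ _).2 ?_, fun P hP => ?_⟩
  · rw [op_transpose, h1]
  obtain ⟨s, ls, hls, rfl⟩ := mem_pauliGroup_iff.1 hP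
  obtain ⟨g, p⟩ := g
  simp only at hg
  obtain ⟨la, lb, lc, rfl, ha, hb⟩ : ∃ la lb lc, ls = la ++ lb ++ lc ∧ la.length = p ∧
      lb.length = g.arity := by
    refine ⟨ls.take p, (ls.drop p).take g.arity, ls.drop (p + g.arity), ?_, ?_, ?_⟩
    · rw [List.append_assoc, ← List.drop_drop, List.take_append_drop, List.take_append_drop]
    · simp; omega
    · simp; omega
  obtain ⟨t, lb', hb', hc⟩ := exists_conj_pauliWord g lb hb
  have h2 := checkEq.sameOp_shift hc hg
  rw [shift_append, shift_append, shift_pauliWord, shift_pauliWord] at h2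
  have e : shift p [(g, 0)] = [(g, p)] := rfl
  rw [e, add_zero] at h2
  have h3 : SameOp n 1 (pauliWord (p + g.arity) lc ++ [(g, p)])
      ([(g, p)] ++ pauliWord (p + g.arity) lc) := by
    apply sameOp_exchange_lists
    intro a ha b hb
    rw [List.mem_singleton.1 hb]
    exact Or.inr (mem_pauliWord ha).1
  have h4 : SameOp n 1 (pauliWord 0 la ++ [(g, p)]) ([(g, p)] ++ pauliWord 0 la) := by
    apply sameOp_exchange_lists
    intro a ha' b hb
    rw [List.mem_singleton.1 hb]
    left
    have := (mem_pauliWord ha').2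
    simp only
    omega
  -- The gate moves left through the letters below, on and above its wires, in this order; only the
  -- middle stage changes letters and sign.
  have h5 := (h3.congr (pauliWord 0 la ++ pauliWord p lb) []).trans
    (((by simpa using h2.congr (pauliWord 0 la) (pauliWord (p + g.arity) lc) :
      SameOp n t (pauliWord 0 la ++ pauliWord p lb ++ ([(g, p)] ++ pauliWord (p + g.arity) lc) ++ [])
        (pauliWord 0 la ++ [(g, p)] ++ (pauliWord p lb' ++ pauliWord (p + g.arity) lc)))).trans
      (h4.congr [] (pauliWord p lb' ++ pauliWord (p + g.arity) lc)))
  have w1 : pauliWord 0 (la ++ lb ++ lc) =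
      pauliWord 0 la ++ pauliWord p lb ++ pauliWord (p + g.arity) lc := by
    simp [pauliWord_append, ha, hb]
  have w2 : pauliWord 0 (la ++ lb' ++ lc) =
      pauliWord 0 la ++ pauliWord p lb' ++ pauliWord (p + g.arity) lc := by
    simp [pauliWord_append, ha, hb']
  have h6 : SameOp n t (pauliWord 0 (la ++ lb ++ lc) ++ [(g, p)])
      ([(g, p)] ++ pauliWord 0 (la ++ lb' ++ lc)) := by
    rw [w1, w2]
    simpa using h5
  simp only [SameOp, opOfList_append, opOfList_pauliWord] at h6
  have h7 : opOfList n [(g, p)] = Prim.op n (g, p) := by simp [opOfList]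
  rw [h7] at h6
  refine mem_pauliGroup_iff.2 ⟨s * t, la ++ lb' ++ lc, ?_, ?_⟩
  · rw [← hls]; simp [hb, hb']
  · rw [hinv, Algebra.mul_smul_comm, h6, Algebra.smul_mul_assoc, Algebra.smul_mul_assoc,
      mul_assoc, h1, mul_one, smul_smul]
    push_cast
    rfl

theorem opOfList_mem_cliffordGroup {n : ℕ} {l : List (Prim × ℕ)} (hl : Fits n l) :
    opOfList n l ∈ cliffordGroup n := by
  induction l with
  | nil => exact one_mem_cliffordGroup n
  | cons g l ih =>
    exact mul_mem_cliffordGroup (ih fun g' hg' => hl g' (List.mem_cons_of_mem _ hg'))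
      (op_mem_cliffordGroup g (hl g List.mem_cons_self))

end RealStab

namespace RealStab

open Matrix

/-! ## Adding a wire at the bottom -/

/-- `M ⊗ 1`. -/
def addWire {n : ℕ} (M : Op n) : Op (n + 1) := fun x y =>
  if x (Fin.last n) = y (Fin.last n) then M (Fin.init x) (Fin.init y) else 0

theorem sum_snoc {n : ℕ} (f : (Fin (n + 1) → Fin 2) → ℝ) :
    ∑ x, f x = ∑ a : Fin 2, ∑ b : Fin n → Fin 2, f (Fin.snoc b a) := by
  rw [← Fintype.sum_prod_type' (f := fun a b => f (Fin.snoc b a))]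
  exact (Equiv.sum_comp (Fin.snocEquiv fun _ : Fin (n + 1) => Fin 2) f).symm

theorem addWire_mul {n : ℕ} (M N : Op n) : addWire (M * N) = addWire M * addWire N := by
  ext x y
  rw [mul_apply, sum_snoc, Finset.sum_eq_single (x (Fin.last n))]
  · simp only [addWire, Fin.snoc_last, Fin.init_snoc, if_true]
    split_ifs with h
    · rw [mul_apply]
    · simp
  · intro a _ ha
    refine Finset.sum_eq_zero fun b _ => ?_
    simp [addWire, ha.symm]
  · simp

theorem addWire_snoc {n : ℕ} (M : Op n) (b c : Fin n → Fin 2) (i j : Fin 2) :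
    addWire M (Fin.snoc b i) (Fin.snoc c j) = if i = j then M b c else 0 := by
  simp only [addWire, Fin.snoc_last, Fin.init_snoc]

theorem addWire_injective {n : ℕ} : Function.Injective (addWire (n := n)) := by
  intro M N h
  ext x y
  have := congrFun (congrFun h (Fin.snoc x 0)) (Fin.snoc y 0)
  simpa only [addWire_snoc, if_true] using this

theorem addWire_one (n : ℕ) : addWire (1 : Op n) = 1 := by
  ext x y
  have key : x = y ↔ x (Fin.last n) = y (Fin.last n) ∧ Fin.init x = Fin.init y := by
    constructor
    · rintro rfl; exact ⟨rfl, rfl⟩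
    · rintro ⟨h1, h2⟩
      rw [← Fin.snoc_init_self x, ← Fin.snoc_init_self y, h1, h2]
  simp only [addWire, one_apply, key]
  split_ifs <;> simp_all

theorem addWire_smul {n : ℕ} (c : ℝ) (M : Op n) : addWire (c • M) = c • addWire M := by
  ext x y
  simp [addWire]

theorem addWire_transpose {n : ℕ} (M : Op n) : addWire Mᵀ = (addWire M)ᵀ := by
  ext x y
  simp [addWire, eq_comm]

theorem tensor_apply_succ {n : ℕ} (f : Fin (n + 1) → Matrix (Fin 2) (Fin 2) ℝ)
    (x y : Fin (n + 1) → Fin 2) :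
    tensor f x y = tensor (fun i => f i.castSucc) (Fin.init x) (Fin.init y) *
      f (Fin.last n) (x (Fin.last n)) (y (Fin.last n)) := by
  simp only [tensor, Fin.prod_univ_castSucc]
  rfl

theorem addWire_tensor {n : ℕ} (f : Fin (n + 1) → Matrix (Fin 2) (Fin 2) ℝ)
    (hf : f (Fin.last n) = 1) : addWire (tensor fun i => f i.castSucc) = tensor f := by
  ext x y
  rw [tensor_apply_succ, hf, addWire, one_apply]
  split_ifs <;> simp

theorem addWire_op {n : ℕ} (g : Prim × ℕ) (hg : g.2 + g.1.arity ≤ n) :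
    addWire (Prim.op n g) = Prim.op (n + 1) g := by
  have key : ∀ (p : ℕ) (M : Matrix (Fin 2) (Fin 2) ℝ), p < n →
      addWire (onWire n p M) = onWire (n + 1) p M := by
    intro p M hp
    have := addWire_tensor (fun i : Fin (n + 1) => if (i : ℕ) = p then M else 1)
      (by simp; omega)
    simpa [onWire] using this
  obtain ⟨g, p⟩ := g
  cases g with
  | H => exact key p matH hg
  | Z => exact key p matZ hg
  | CZ =>
    have hg' : p + 2 ≤ n := hg
    have hd : ∀ x : Fin (n + 1) → Fin 2,
        (∀ i : Fin (n + 1), (i : ℕ) = p ∨ (i : ℕ) = p + 1 → x i = 1) ↔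
        ∀ i : Fin n, (i : ℕ) = p ∨ (i : ℕ) = p + 1 → Fin.init x i = 1 := by
      intro x
      constructor
      · exact fun h i hi => h i.castSucc hi
      · intro h i hi
        exact h ⟨i, by omega⟩ hi
    ext x y
    have h1 := congrFun (congrFun (addWire_one n) x) y
    simp only [addWire, one_apply] at h1
    simp only [Prim.op, addWire, diagonal_apply, hd]
    by_cases hxy : x = y
    · simp [hxy]
    · simp only [hxy, if_false] at h1 ⊢
      split_ifs at h1 ⊢ <;> simp_all

theorem addWire_opOfList {n : ℕ} {l : List (Prim × ℕ)} (hl : Fits n l) :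
    addWire (opOfList n l) = opOfList (n + 1) l := by
  induction l with
  | nil => exact addWire_one n
  | cons g l ih =>
    rw [opOfList, addWire_mul, ih fun g' hg' => hl g' (List.mem_cons_of_mem _ hg'),
      addWire_op g (hl g List.mem_cons_self)]
    rfl

theorem addWire_commute_onWire {n : ℕ} (M : Op n) (N : Matrix (Fin 2) (Fin 2) ℝ) :
    addWire M * onWire (n + 1) n N = onWire (n + 1) n N * addWire M := by
  have hN : ∀ x y : Fin (n + 1) → Fin 2, onWire (n + 1) n N x y =
      (1 : Op n) (Fin.init x) (Fin.init y) * N (x (Fin.last n)) (y (Fin.last n)) := by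
    intro x y
    rw [onWire, tensor_apply_succ]
    congr 1
    · rw [← tensor_one]
      congr 1
      funext i
      simp [i.2.ne]
    · simp
  ext x y
  simp only [mul_apply, sum_snoc, addWire, hN, Fin.init_snoc, Fin.snoc_last, one_apply]
  have h1 : ∀ a : Fin 2, ∑ b : Fin n → Fin 2, (if x (Fin.last n) = a then M (Fin.init x) b else 0) *
      ((if b = Fin.init y then 1 else 0) * N a (y (Fin.last n))) =
      if x (Fin.last n) = a then M (Fin.init x) (Fin.init y) * N a (y (Fin.last n)) else 0 := by
    intro a
    rw [Finset.sum_eq_single (Fin.init y)]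
    · rw [if_pos rfl]; split_ifs <;> simp
    · intro b _ hb; simp [hb]
    · simp
  have h2 : ∀ a : Fin 2, ∑ b : Fin n → Fin 2, (if Fin.init x = b then 1 else 0) *
      N (x (Fin.last n)) a * (if a = y (Fin.last n) then M b (Fin.init y) else 0) =
      if a = y (Fin.last n) then M (Fin.init x) (Fin.init y) * N (x (Fin.last n)) a else 0 := by
    intro a
    rw [Finset.sum_eq_single (Fin.init x)]
    · rw [if_pos rfl]; split_ifs <;> simp [mul_comm]
    · intro b _ hb; simp [hb.symm]
    · simp
  simp only [h1, h2]
  simp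

/-- An operator that commutes with `X` and `Z` on the last wire acts on the other wires only. -/
theorem exists_addWire {n : ℕ} {U : Op (n + 1)}
    (hX : U * onWire (n + 1) n matX = onWire (n + 1) n matX * U)
    (hZ : U * onWire (n + 1) n matZ = onWire (n + 1) n matZ * U) : ∃ V : Op n, U = addWire V := by
  have hT : ∀ (M : Matrix (Fin 2) (Fin 2) ℝ) (b : Fin n → Fin 2) (a : Fin 2)
      (f : (Fin (n + 1) → Fin 2) → ℝ), (onWire (n + 1) n M *ᵥ f) (Fin.snoc b a) =
      ∑ j, M a j * f (Fin.snoc b j) := by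
    intro M b a f
    have := onWire_mulVec (Fin.last n) M f (Fin.snoc b a)
    simpa [Fin.update_snoc_last] using this
  have left : ∀ (M : Matrix (Fin 2) (Fin 2) ℝ) (b : Fin n → Fin 2) (a : Fin 2)
      (y : Fin (n + 1) → Fin 2), (onWire (n + 1) n M * U) (Fin.snoc b a) y =
      ∑ j, M a j * U (Fin.snoc b j) y := fun M b a y => hT M b a fun x => U x y
  -- Multiplication from the right is reduced to the action on vectors by transposing.
  have htr : ∀ M : Matrix (Fin 2) (Fin 2) ℝ, onWire (n + 1) n Mᵀ = (onWire (n + 1) n M)ᵀ := by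
    intro M
    ext x y
    simp only [transpose_apply, onWire, tensor]
    refine Finset.prod_congr rfl fun i _ => ?_
    split_ifs
    · rfl
    · rw [one_apply, one_apply]; simp only [eq_comm]
  have right : ∀ (M : Matrix (Fin 2) (Fin 2) ℝ) (b : Fin n → Fin 2) (a : Fin 2)
      (x : Fin (n + 1) → Fin 2), (U * onWire (n + 1) n M) x (Fin.snoc b a) =
      ∑ j, M j a * U x (Fin.snoc b j) := by
    intro M b a x
    have h := hT Mᵀ b a fun y => U x y
    rw [htr, mulVec_transpose] at h
    exact h
  refine ⟨fun x y => U (Fin.snoc x 0) (Fin.snoc y 0), ?_⟩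
  -- Commuting with `Z` kills the two blocks in which the last bits differ.
  have hz : ∀ b c a a', a ≠ a' → U (Fin.snoc b a) (Fin.snoc c a') = 0 := by
    intro b c a a' haa
    have h1 := congrFun (congrFun hZ (Fin.snoc b a)) (Fin.snoc c a')
    rw [left, right] at h1
    fin_cases a <;> fin_cases a' <;> simp [matZ, Fin.sum_univ_two] at h1 haa ⊢ <;> linarith
  -- Commuting with `X` makes the two remaining blocks equal.
  have hx : ∀ b c, U (Fin.snoc b 1) (Fin.snoc c 1) = U (Fin.snoc b 0) (Fin.snoc c 0) := by
    intro b c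
    have h1 := congrFun (congrFun hX (Fin.snoc b 0)) (Fin.snoc c 1)
    rw [left, right] at h1
    simp [matX, Fin.sum_univ_two] at h1
    exact h1.symm
  ext x y
  rw [← Fin.snoc_init_self x, ← Fin.snoc_init_self y]
  refine Eq.trans ?_ (addWire_snoc _ _ _ _ _).symm
  split_ifs with h
  · rw [h]
    generalize y (Fin.last n) = a
    fin_cases a
    · rfl
    · exact hx _ _
  · exact hz _ _ _ _ h

/-- The last letter has to be `I`: the last factor of `M ⊗ 1` has vanishing off-diagonal entries,
which excludes `X` and `Y`, and equal diagonal entries, which excludes `Z`. -/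
theorem mem_pauliGroup_of_addWire {n : ℕ} {M : Op n} (h : addWire M ∈ pauliGroup (n + 1)) :
    M ∈ pauliGroup n := by
  obtain ⟨s, ls, hls, h⟩ := mem_pauliGroup_iff.1 h
  set w : Fin (n + 1) → Letter := fun i => ls.getD i .I with hw
  have hs : ((s : ℤ) : ℝ) ≠ 0 := by exact_mod_cast s.ne_zero
  have h' : addWire M = ((s : ℤ) : ℝ) • tensor fun i => (w i).mat := h
  have hlast : w (Fin.last n) = .I := by
    -- The row is the one where column 0 of the first `n` factors has the entry 1, so the last
    -- factor can be read off.
    have e : ∀ a b, addWire M (Fin.snoc (fun i => (w i.castSucc).flip) a) (Fin.snoc 0 b) =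
        s * (w (Fin.last n)).mat a b := by
      intro a b
      rw [h', Matrix.smul_apply, tensor_apply_succ]
      simp only [Fin.init_snoc, Fin.snoc_last, smul_eq_mul]
      rw [tensor_mat_apply_zero (fun i : Fin n => w i.castSucc)]
      simp
    have e00 := e 0 0
    have e10 := e 1 0
    have e11 := e 1 1
    rw [addWire_snoc, if_pos rfl] at e00 e11
    rw [addWire_snoc, if_neg (by decide)] at e10
    have h1 : (w (Fin.last n)).mat 1 0 = 0 := by
      simpa [hs] using e10.symm
    have h2 : (w (Fin.last n)).mat 0 0 = (w (Fin.last n)).mat 1 1 :=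
      mul_left_cancel₀ hs (e00.symm.trans e11)
    generalize w (Fin.last n) = a at h1 h2
    cases a
    · rfl
    · simp [Letter.mat, matX] at h1
    · simp [Letter.mat, matZ] at h2; norm_num at h2
    · simp [Letter.mat, matX, matZ] at h1
  refine ⟨s, fun i => (w i.castSucc).mat, fun i => Letter.mat_cases _, addWire_injective ?_⟩
  rw [addWire_smul, addWire_tensor (fun i => (w i).mat) (by simp only [hlast]; rfl), h']

theorem addWire_mem_pauliGroup {n : ℕ} {M : Op n} (h : M ∈ pauliGroup n) :
    addWire M ∈ pauliGroup (n + 1) := by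
  obtain ⟨s, f, hf, rfl⟩ := h
  refine ⟨s, Fin.snoc (α := fun _ => Matrix (Fin 2) (Fin 2) ℝ) f 1, ?_, ?_⟩
  · intro i
    cases i using Fin.lastCases with
    | last => left; simp
    | cast i => simpa using hf i
  · rw [addWire_smul, ← addWire_tensor (Fin.snoc (α := fun _ => Matrix (Fin 2) (Fin 2) ℝ) f 1)
      (by simp)]
    simp

theorem mem_cliffordGroup_of_addWire {n : ℕ} {U : Op n} (h : addWire U ∈ cliffordGroup (n + 1)) :
    U ∈ cliffordGroup n := by
  have h1 : U * Uᵀ = 1 := by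
    apply addWire_injective
    rw [addWire_mul, addWire_transpose, addWire_one]
    exact (mem_orthogonalGroup_iff _ _).1 h.1
  refine ⟨(mem_orthogonalGroup_iff _ _).2 h1, fun P hP => mem_pauliGroup_of_addWire ?_⟩
  have h2 := h.2 _ (addWire_mem_pauliGroup hP)
  rw [inv_eq_right_inv h1, addWire_mul, addWire_mul, addWire_transpose]
  rwa [inv_eq_right_inv ((mem_orthogonalGroup_iff _ _).1 h.1)] at h2

end RealStab

namespace RealStab

open Matrix

/-! ## Normal forms and Pauli operators -/

namespace Gate

/-- The Pauli letter that a gate of kind `A`, `B` or `D` absorbs. -/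
def letter : Gate → Letter
  | A1 => .Z
  | A2 => .X
  | A3 => .Y
  | B1 | B5 => .I
  | B2 | B6 => .X
  | B3 | B7 => .Z
  | B4 | B8 => .Y
  | D1 => .I
  | D2 => .X
  | D3 => .Z
  | D4 => .Y
  | _ => .I

/-- The sign that a gate of kind `C` or `E` absorbs. -/
def sign : Gate → ℤˣ
  | C2 | E2 => -1
  | _ => 1

end Gate

/-- The Pauli letter on a wire labelled 2. -/
def zLetter : WireType → Letter
  | .single => .Z
  | .double => .Y

/-- The Pauli letter on a wire labelled 3 or 4. -/
def xLetter : Bool → Letter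
  | false => .X
  | true => .Y

/-- The gates change the Pauli letters as described by `letter`, `zLetter` and `xLetter`. -/
def Gate.checkLetters (g : Gate) : Bool :=
  match g.kind with
  | .A => checkEq 1 1 (g.letter.word ++ g.expand) (g.expand ++ (zLetter g.topOut).word)
  | .B => checkEq 2 1 (pauliWord 0 [g.letter, zLetter g.bottomIn] ++ g.expand)
      (g.expand ++ (zLetter g.topOut).word)
  | .C => checkEq 1 g.sign (Letter.Z.word ++ g.expand) (g.expand ++ Letter.Z.word)
  | .D => checkEq 2 1 (Letter.Z.word ++ g.expand) (g.expand ++ shift 1 Letter.Z.word) &&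
      [false, true].all fun b => checkEq 2 1 (pauliWord 0 [xLetter b, g.letter] ++ g.expand)
        (g.expand ++ shift 1 (xLetter (b ^^ decide (g = .D4))).word)
  | .E => checkEq 1 1 (Letter.Z.word ++ g.expand) (g.expand ++ Letter.Z.word) &&
      checkEq 1 g.sign (Letter.X.word ++ g.expand) (g.expand ++ Letter.X.word)
  | .dirty => true

/-- This finite check gives the clean gates their meaning: each converts the Pauli letters in front
of it into one carried letter behind it, up to the sign read by `C` or `E`. -/
theorem cleanGates_checkLetters : State.cleanGates.all Gate.checkLetters = true := by
  decide +kernel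

theorem Gate.checkLetters_of_kind {g : Gate} (h : g.kind ≠ .dirty) : g.checkLetters = true :=
  List.all_eq_true.1 cleanGates_checkLetters g (State.mem_cleanGates h)

theorem opOfList_of_checkEq {w : ℕ} {s : ℤˣ} {a b c d : List (Prim × ℕ)}
    (h : checkEq w s (a ++ b) (c ++ d) = true) {n k : ℕ} (hk : k + w ≤ n) :
    opOfList n (shift k b) * opOfList n (shift k a) =
      ((s : ℤ) : ℝ) • (opOfList n (shift k d) * opOfList n (shift k c)) := by
  have := checkEq.sameOp_shift h hk
  simpa only [SameOp, shift_append, opOfList_append] using this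

theorem opOfList_commute {n : ℕ} {l l' : List (Prim × ℕ)}
    (h : ∀ a ∈ l, ∀ b ∈ l', a.2 + a.1.arity ≤ b.2 ∨ b.2 + b.1.arity ≤ a.2) :
    opOfList n l' * opOfList n l = opOfList n l * opOfList n l' := by
  have := sameOp_exchange_lists (n := n) h
  simpa [SameOp, opOfList_append] using this

theorem forget_cons (g : Gate × ℕ) (l : GateList) :
    forget (g :: l) = shift g.2 g.1.expand ++ forget l := List.flatMap_cons

theorem mem_shift_expand {g : Gate} {p : ℕ} {a : Prim × ℕ} (h : a ∈ shift p g.expand) :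
    p ≤ a.2 ∧ a.2 + a.1.arity ≤ p + g.inp.length := by
  obtain ⟨a, ha, rfl⟩ := List.mem_map.1 h
  have := g.expand_fits a ha
  simp only
  omega

theorem Gate.inp_length {g : Gate} {k : Kind} (h : g.kind = k) (hk : k ≠ .dirty) :
    g.inp.length = match k with
    | .dirty => 0
    | .A => 1 | .B => 2 | .C => 1 | .D => 2 | .E => 1 := by
  subst h
  cases g <;> first | rfl | exact absurd rfl hk

/-- The letters that the `B` gates of a `Z`-circuit absorb, from top to bottom. -/
def zLetters (bs : List Gate) : List Letter := (bs.map Gate.letter).reverse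

theorem zLetters_cons (b : Gate) (bs : List Gate) :
    zLetters (b :: bs) = zLetters bs ++ [b.letter] := by simp [zLetters]

@[simp] theorem length_zLetters (bs : List Gate) : (zLetters bs).length = bs.length := by
  simp [zLetters]

/-- Each `B` gate merges the letter on its top wire with the carried `Z` or `Y` on its bottom wire
into a carried `Z` or `Y` on its top wire, the type of the wire recording which. The induction runs
from bottom to top, as the gates do. -/
theorem opOfList_ascending {n : ℕ} {bs : List Gate} {t t' : WireType}
    (h : (State.B n bs.length t).nextList (ascending bs) = some (.B n 0 t')) :
    opOfList n (forget (ascending bs)) *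
        (opOfList n (shift bs.length (zLetter t).word) * opOfList n (pauliWord 0 (zLetters bs))) =
      opOfList n (zLetter t').word * opOfList n (forget (ascending bs)) := by
  induction bs generalizing t with
  | nil =>
    obtain rfl : t = t' := by simpa [ascending, State.nextList] using h
    simp [ascending, forget, opOfList, zLetters, pauliWord]
  | cons b bs ih =>
    obtain ⟨S, h1, h2⟩ := State.nextList_cons_eq_some.1 h
    obtain ⟨b', hb', hb, hn, rfl, rfl⟩ := State.next_B_succ_eq_some h1
    obtain rfl : b = b' := congrArg Prod.fst hb'
    have ih := ih h2
    have hloc := b.checkLetters_of_kind (by simp [hb])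
    simp only [Gate.checkLetters, hb] at hloc
    have hloc := opOfList_of_checkEq hloc (k := bs.length) (n := n) (by omega)
    -- The letters still to be absorbed lie strictly above the wires of `b`.
    have hcomm : opOfList n (shift bs.length b.expand) * opOfList n (pauliWord 0 (zLetters bs)) =
        opOfList n (pauliWord 0 (zLetters bs)) * opOfList n (shift bs.length b.expand) := by
      apply opOfList_commute
      intro x hx y hy
      have h3 := mem_pauliWord hx
      have h4 := mem_shift_expand hy
      rw [length_zLetters] at h3
      omega
    simp only [pauliWord, shift_append, shift_shift, add_zero, zero_add, List.append_nil,
      opOfList_append, Units.val_one, Int.cast_one, one_smul] at hloc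
    simp only [ascending, forget_cons, opOfList_append, zLetters_cons, pauliWord_append,
      length_zLetters, zero_add, pauliWord, List.append_nil, List.length_cons]
    generalize opOfList n (pauliWord 0 (zLetters bs)) = W at *
    generalize opOfList n (shift bs.length b.expand) = E at *
    generalize opOfList n (forget (ascending bs)) = F at *
    calc F * E * (opOfList n (shift (bs.length + 1) (zLetter b.bottomIn).word) *
          (opOfList n (shift bs.length b.letter.word) * W))
        = F * (E * (opOfList n (shift (bs.length + 1) (zLetter b.bottomIn).word) *
          opOfList n (shift bs.length b.letter.word))) * W := by simp only [mul_assoc]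
      _ = F * opOfList n (shift bs.length (zLetter b.topOut).word) * (E * W) := by
          rw [hloc]; simp only [mul_assoc]
      _ = F * (opOfList n (shift bs.length (zLetter b.topOut).word) * W) * E := by
          rw [hcomm]; simp only [mul_assoc]
      _ = _ := by rw [ih]; simp only [mul_assoc]

theorem opOfList_A_ascending {n : ℕ} {a : Gate} {bs : List Gate} {t : WireType} (ha : a.kind = .A)
    (hn : bs.length < n)
    (h : (State.B n bs.length a.topOut).nextList (ascending bs) = some (.B n 0 t)) :
    opOfList n (forget ((a, bs.length) :: ascending bs)) *
        pauliTensor n (zLetters bs ++ [a.letter]) =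
      opOfList n (zLetter t).word * opOfList n (forget ((a, bs.length) :: ascending bs)) := by
  have h1 := opOfList_ascending h
  have hloc := a.checkLetters_of_kind (by simp [ha])
  simp only [Gate.checkLetters, ha] at hloc
  have hloc := opOfList_of_checkEq hloc (k := bs.length) (n := n) (by omega)
  have hcomm : opOfList n (shift bs.length a.expand) * opOfList n (pauliWord 0 (zLetters bs)) =
      opOfList n (pauliWord 0 (zLetters bs)) * opOfList n (shift bs.length a.expand) := by
    apply opOfList_commute
    intro x hx y hy
    have h3 := mem_pauliWord hx
    have h4 := mem_shift_expand hy
    rw [length_zLetters] at h3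
    omega
  rw [← opOfList_pauliWord]
  simp only [Units.val_one, Int.cast_one, one_smul] at hloc
  simp only [forget_cons, opOfList_append, pauliWord_append,
    length_zLetters, zero_add, pauliWord, List.append_nil]
  generalize opOfList n (pauliWord 0 (zLetters bs)) = W at *
  generalize opOfList n (shift bs.length a.expand) = E at *
  generalize opOfList n (forget (ascending bs)) = F at *
  calc F * E * (opOfList n (shift bs.length a.letter.word) * W)
      = F * (E * opOfList n (shift bs.length a.letter.word)) * W := by simp only [mul_assoc]
    _ = F * opOfList n (shift bs.length (zLetter a.topOut).word) * (E * W) := by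
        rw [hloc]; simp only [mul_assoc]
    _ = F * (opOfList n (shift bs.length (zLetter a.topOut).word) * W) * E := by
        rw [hcomm]; simp only [mul_assoc]
    _ = _ := by rw [h1]; simp only [mul_assoc]

/-- What a `Z`-circuit encodes: the Pauli operator that it conjugates to `Z` on wire 0 is spelled
out by its gates, with `C` contributing the sign. -/
theorem opOfList_zCircuit {n : ℕ} {a c : Gate} {bs : List Gate} (ha : a.kind = .A)
    (hc : c.kind = .C) (hn : bs.length < n)
    (h : (State.B n bs.length a.topOut).nextList (ascending bs) = some (.B n 0 .single)) :
    opOfList n (forget ((a, bs.length) :: ascending bs ++ [(c, 0)])) *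
        (((c.sign : ℤ) : ℝ) • pauliTensor n (zLetters bs ++ [a.letter])) =
      onWire n 0 matZ * opOfList n (forget ((a, bs.length) :: ascending bs ++ [(c, 0)])) := by
  have h1 := opOfList_A_ascending ha hn h
  have hloc := c.checkLetters_of_kind (by simp [hc])
  simp only [Gate.checkLetters, hc] at hloc
  have hloc := opOfList_of_checkEq hloc (k := 0) (n := n) (by omega)
  have hZ := opOfList_word n 0 .Z
  simp only [shift_zero, Letter.mat] at hloc hZ
  simp only [zLetter, hZ] at h1 hloc
  rw [forget_append, opOfList_append, forget_cons (c, 0), shift_zero]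
  simp only [forget, List.flatMap_nil, List.append_nil] at h1 ⊢
  rw [Algebra.mul_smul_comm, mul_assoc, h1, ← mul_assoc, hloc, Algebra.smul_mul_assoc, smul_smul,
    mul_assoc]
  rcases Int.units_eq_one_or c.sign with h | h <;> simp [h]

/-- Whether the number of gates `D4` is odd. -/
def oddD4 : List Gate → Bool
  | [] => false
  | d :: ds => decide (d = .D4) ^^ oddD4 ds

/-- Whichever `D` gates occur, `Z` moves from the top wire to the bottom one. So an `X`-circuit can
be chosen to fix `X` without spoiling what was arranged for `Z`. -/
theorem opOfList_descending_Z {n p : ℕ} {ds : List Gate} (hds : ∀ d ∈ ds, d.kind = .D)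
    (hn : p + ds.length < n) :
    opOfList n (forget (descending p ds)) * onWire n p matZ =
      onWire n (p + ds.length) matZ * opOfList n (forget (descending p ds)) := by
  induction ds generalizing p with
  | nil => simp [descending, forget, opOfList]
  | cons d ds ih =>
    have hd := hds d List.mem_cons_self
    simp only [List.length_cons] at hn
    have ih := ih (p := p + 1) (fun d' hd' => hds d' (List.mem_cons_of_mem _ hd')) (by omega)
    have hloc := d.checkLetters_of_kind (by simp [hd])
    simp only [Gate.checkLetters, hd, Bool.and_eq_true] at hloc
    have hloc := opOfList_of_checkEq hloc.1 (k := p) (n := n) (by omega)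
    rw [shift_shift, opOfList_word, opOfList_word, Units.val_one, Int.cast_one, one_smul,
      Letter.mat] at hloc
    simp only [descending, forget_cons, opOfList_append, List.length_cons]
    rw [mul_assoc, hloc, ← mul_assoc, ih, mul_assoc, add_assoc, add_comm 1]

/-- The carried letter is `X` or `Y`, each `D` gate absorbs the letter on its bottom wire, and
exactly `D4` exchanges `X` and `Y`. Hence the parity of the number of `D4` gates. -/
theorem opOfList_descending {n p : ℕ} {ds : List Gate} (hds : ∀ d ∈ ds, d.kind = .D)
    (hn : p + ds.length < n) (b : Bool) :
    opOfList n (forget (descending p ds)) *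
        opOfList n (pauliWord p (xLetter b :: ds.map Gate.letter)) =
      onWire n (p + ds.length) (xLetter (b ^^ oddD4 ds)).mat *
        opOfList n (forget (descending p ds)) := by
  induction ds generalizing p b with
  | nil => simp [descending, forget, opOfList, pauliWord, oddD4, opOfList_word]
  | cons d ds ih =>
    have hd := hds d List.mem_cons_self
    simp only [List.length_cons] at hn
    have ih := ih (p := p + 1) (fun d' hd' => hds d' (List.mem_cons_of_mem _ hd')) (by omega)
      (b ^^ decide (d = .D4))
    have hloc := d.checkLetters_of_kind (by simp [hd])
    simp only [Gate.checkLetters, hd, Bool.and_eq_true, List.all_eq_true] at hloc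
    have hloc := opOfList_of_checkEq (hloc.2 b (by cases b <;> simp)) (k := p) (n := n) (by omega)
    have hcomm : opOfList n (shift p d.expand) *
        opOfList n (pauliWord (p + 1 + 1) (ds.map Gate.letter)) =
        opOfList n (pauliWord (p + 1 + 1) (ds.map Gate.letter)) *
          opOfList n (shift p d.expand) := by
      apply opOfList_commute
      intro x hx y hy
      have h3 := mem_pauliWord hx
      have h4 := mem_shift_expand hy
      rw [Gate.inp_length hd (by simp)] at h4
      simp only at h4
      omega
    simp only [pauliWord, shift_append, shift_shift, add_zero, zero_add, List.append_nil,
      opOfList_append, Units.val_one, Int.cast_one, one_smul] at hloc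
    simp only [descending, forget_cons, opOfList_append, List.map_cons, pauliWord,
      List.length_cons, oddD4] at ih ⊢
    rw [Bool.xor_assoc] at ih
    rw [show p + 1 + ds.length = p + (ds.length + 1) by omega] at ih
    generalize opOfList n (pauliWord (p + 1 + 1) (ds.map Gate.letter)) = W at *
    generalize opOfList n (shift p d.expand) = E at *
    generalize opOfList n (forget (descending (p + 1) ds)) = F at *
    generalize opOfList n (shift (p + 1) d.letter.word) = L at *
    generalize opOfList n (shift p (xLetter b).word) = X at *
    calc F * E * (W * L * X) = F * (E * W) * (L * X) := by simp only [mul_assoc]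
      _ = F * W * (E * (L * X)) := by rw [hcomm]; simp only [mul_assoc]
      _ = F * (W * opOfList n (shift (p + 1) (xLetter (b ^^ decide (d = .D4))).word)) * E := by
          rw [hloc]; simp only [mul_assoc]
      _ = _ := by rw [ih]; simp only [mul_assoc]

theorem opOfList_xCircuit_Z {n : ℕ} {ds : List Gate} {e : Gate} (hds : ∀ d ∈ ds, d.kind = .D)
    (he : e.kind = .E) (hn : ds.length + 1 = n) :
    opOfList n (forget (descending 0 ds ++ [(e, ds.length)])) * onWire n 0 matZ =
      onWire n ds.length matZ * opOfList n (forget (descending 0 ds ++ [(e, ds.length)])) := by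
  have h1 := opOfList_descending_Z (p := 0) (n := n) hds (by omega)
  have hloc := e.checkLetters_of_kind (by simp [he])
  simp only [Gate.checkLetters, he, Bool.and_eq_true] at hloc
  have hloc := opOfList_of_checkEq hloc.1 (k := ds.length) (n := n) (by omega)
  rw [opOfList_word, Units.val_one, Int.cast_one, one_smul, Letter.mat] at hloc
  rw [forget_append, opOfList_append, forget_cons (e, ds.length)]
  simp only [forget, List.flatMap_nil, List.append_nil, zero_add] at h1 ⊢
  rw [mul_assoc, h1, ← mul_assoc, hloc, mul_assoc]

theorem opOfList_xCircuit {n : ℕ} {ds : List Gate} {e : Gate} (hds : ∀ d ∈ ds, d.kind = .D)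
    (he : e.kind = .E) (hn : ds.length + 1 = n) :
    opOfList n (forget (descending 0 ds ++ [(e, ds.length)])) *
        (((e.sign : ℤ) : ℝ) • pauliTensor n (xLetter (oddD4 ds) :: ds.map Gate.letter)) =
      onWire n ds.length matX * opOfList n (forget (descending 0 ds ++ [(e, ds.length)])) := by
  -- With this starting letter the exchanges cancel and the last wire receives `X`.
  have h1 := opOfList_descending (p := 0) (n := n) hds (by omega) (oddD4 ds)
  have hloc := e.checkLetters_of_kind (by simp [he])
  simp only [Gate.checkLetters, he, Bool.and_eq_true] at hloc
  have hloc := opOfList_of_checkEq hloc.2 (k := ds.length) (n := n) (by omega)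
  rw [opOfList_word, Letter.mat] at hloc
  rw [Bool.xor_self, opOfList_pauliWord, xLetter, Letter.mat] at h1
  rw [forget_append, opOfList_append, forget_cons (e, ds.length)]
  simp only [forget, List.flatMap_nil, List.append_nil, zero_add] at h1 ⊢
  rw [Algebra.mul_smul_comm, mul_assoc, h1, ← mul_assoc, hloc, Algebra.smul_mul_assoc, smul_smul,
    mul_assoc]
  rcases Int.units_eq_one_or e.sign with h | h <;> simp [h]

end RealStab

namespace RealStab

open Matrix

/-! ## Existence and uniqueness of normal forms -/

theorem HasType.fits {σ τ : List WireType} {l : GateList} (h : HasType σ l τ) :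
    Fits σ.length (forget l) := by
  induction h with
  | nil σ => intro g hg; simp [forget] at hg
  | cons σ ρ τ g l _ ih =>
    intro a ha
    rw [forget_cons] at ha
    rcases List.mem_append.1 ha with ha | ha
    · have := (mem_shift_expand ha).2
      simp only [List.length_append] at this ⊢
      omega
    · have := ih a ha
      have hg : g.inp.length = g.out.length := by cases g <;> rfl
      simp only [List.length_append] at this ⊢
      omega

theorem State.fits_of_nextList {n : ℕ} {S S' : State} {l : GateList}
    (h : S.nextList l = some S') (hn : S.size ≤ n) : Fits n (forget l) := by
  have := (State.hasType_of_nextList h hn).fits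
  simpa [State.types] using this

theorem IsZCircuit.fits {n : ℕ} {L : GateList} (h : IsZCircuit n L) : Fits n (forget L) :=
  State.fits_of_nextList (State.nextList_of_isZCircuit h) le_rfl

theorem IsXCircuit.fits {n : ℕ} {M : GateList} (h : IsXCircuit n M) : Fits n (forget M) :=
  State.fits_of_nextList (State.nextList_of_isXCircuit h) le_rfl

theorem IsNormalList.fits {n : ℕ} {N : GateList} (h : IsNormalList n N) : Fits n (forget N) :=
  State.fits_of_nextList (State.isNormalList_iff.1 h) le_rfl

theorem isUnit_opOfList {n : ℕ} {l : List (Prim × ℕ)} (hl : Fits n l) : IsUnit (opOfList n l) :=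
  (isUnit_iff_isUnit_det _).2 (isUnit_of_mem_cliffordGroup (opOfList_mem_cliffordGroup hl))

theorem IsZCircuit.exists_path {n : ℕ} {L : GateList} (h : IsZCircuit n L) :
    ∃ a bs c, a.kind = .A ∧ c.kind = .C ∧ bs.length < n ∧
      L = (a, bs.length) :: ascending bs ++ [(c, 0)] ∧
      (State.B n bs.length a.topOut).nextList (ascending bs) = some (.B n 0 .single) := by
  have hL := State.nextList_of_isZCircuit h
  obtain ⟨a, bs, c, ha, hbs, hc, hn, rfl, -⟩ := h
  refine ⟨a, bs, c, ha, hc, hn, rfl, ?_⟩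
  rw [List.cons_append, State.nextList_cons_eq_some, State.next_A ha hn] at hL
  obtain ⟨S, rfl, hL⟩ : ∃ S, State.B n bs.length a.topOut = S ∧ _ := by simpa using hL
  rw [State.nextList_append, Option.bind_eq_some_iff] at hL
  obtain ⟨S, h1, h2⟩ := hL
  obtain ⟨T, h2, h3⟩ := State.nextList_cons_eq_some.1 h2
  cases h3
  cases S with
  | A m => simp [State.next, hc] at h2
  | D m q => simp [State.next, hc] at h2
  | B m q t =>
    simp only [State.next, hc] at h2
    simp at h2
    rw [h1]
    grind

/-! ### Gates are determined by the letters, types and signs that they absorb -/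

theorem Gate.eq_of_letter_A {g g' : Gate} (h : g.kind = .A) (h' : g'.kind = .A)
    (hl : g.letter = g'.letter) : g = g' := by
  cases g <;> cases h <;> cases g' <;> cases h' <;> first | rfl | cases hl

theorem Gate.eq_of_letter_B {g g' : Gate} (h : g.kind = .B) (h' : g'.kind = .B)
    (ht : g.bottomIn = g'.bottomIn) (hl : g.letter = g'.letter) : g = g' := by
  cases g <;> cases h <;> cases g' <;> cases h' <;> first | rfl | (cases hl; done) | cases ht

theorem Gate.eq_of_letter_D {g g' : Gate} (h : g.kind = .D) (h' : g'.kind = .D)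
    (hl : g.letter = g'.letter) : g = g' := by
  cases g <;> cases h <;> cases g' <;> cases h' <;> first | rfl | cases hl

theorem Gate.eq_of_sign_C {g g' : Gate} (h : g.kind = .C) (h' : g'.kind = .C)
    (hs : g.sign = g'.sign) : g = g' := by
  cases g <;> cases h <;> cases g' <;> cases h' <;> first | rfl | cases hs

theorem Gate.eq_of_sign_E {g g' : Gate} (h : g.kind = .E) (h' : g'.kind = .E)
    (hs : g.sign = g'.sign) : g = g' := by
  cases g <;> cases h <;> cases g' <;> cases h' <;> first | rfl | cases hs

theorem Gate.letter_ne_I {g : Gate} (h : g.kind = .A) : g.letter ≠ .I := by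
  cases g <;> cases h <;> decide

theorem exists_gate_A {a : Letter} (h : a ≠ .I) : ∃ g : Gate, g.kind = .A ∧ g.letter = a := by
  cases a
  · exact absurd rfl h
  · exact ⟨.A2, rfl, rfl⟩
  · exact ⟨.A1, rfl, rfl⟩
  · exact ⟨.A3, rfl, rfl⟩

theorem exists_gate_B (t : WireType) (a : Letter) :
    ∃ g : Gate, g.kind = .B ∧ g.bottomIn = t ∧ g.letter = a := by
  cases t
  · cases a
    · exact ⟨.B1, rfl, rfl, rfl⟩
    · exact ⟨.B2, rfl, rfl, rfl⟩
    · exact ⟨.B3, rfl, rfl, rfl⟩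
    · exact ⟨.B4, rfl, rfl, rfl⟩
  · cases a
    · exact ⟨.B5, rfl, rfl, rfl⟩
    · exact ⟨.B6, rfl, rfl, rfl⟩
    · exact ⟨.B7, rfl, rfl, rfl⟩
    · exact ⟨.B8, rfl, rfl, rfl⟩

theorem exists_gate_C (s : ℤˣ) : ∃ g : Gate, g.kind = .C ∧ g.sign = s := by
  rcases Int.units_eq_one_or s with rfl | rfl
  · exact ⟨.C1, rfl, rfl⟩
  · exact ⟨.C2, rfl, rfl⟩

theorem exists_gate_D (a : Letter) : ∃ g : Gate, g.kind = .D ∧ g.letter = a := by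
  cases a
  · exact ⟨.D1, rfl, rfl⟩
  · exact ⟨.D2, rfl, rfl⟩
  · exact ⟨.D3, rfl, rfl⟩
  · exact ⟨.D4, rfl, rfl⟩

theorem exists_gate_E (s : ℤˣ) : ∃ g : Gate, g.kind = .E ∧ g.sign = s := by
  rcases Int.units_eq_one_or s with rfl | rfl
  · exact ⟨.E1, rfl, rfl⟩
  · exact ⟨.E2, rfl, rfl⟩

/-- Read from the bottom, the incoming type and the letter determine the `B` gate, which in turn
determines the type for the next gate. -/
theorem ascending_unique {n : ℕ} {bs bs' : List Gate} {t u u' : WireType}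
    (h : (State.B n bs.length t).nextList (ascending bs) = some (.B n 0 u))
    (h' : (State.B n bs'.length t).nextList (ascending bs') = some (.B n 0 u'))
    (hl : zLetters bs = zLetters bs') : bs = bs' := by
  induction bs generalizing bs' t with
  | nil =>
    have := congrArg List.length hl
    rw [length_zLetters, length_zLetters] at this
    exact (List.length_eq_zero_iff.1 this.symm).symm
  | cons b bs ih =>
    cases bs' with
    | nil => simpa using congrArg List.length hl
    | cons b' bs' =>
      rw [zLetters_cons, zLetters_cons] at hl
      obtain ⟨hl', hb⟩ := List.append_inj' hl rfl
      obtain ⟨S, h1, h2⟩ := State.nextList_cons_eq_some.1 h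
      obtain ⟨b₁, hb₁, hk, -, rfl, rfl⟩ := State.next_B_succ_eq_some h1
      obtain rfl : b = b₁ := congrArg Prod.fst hb₁
      obtain ⟨S', h1', h2'⟩ := State.nextList_cons_eq_some.1 h'
      obtain ⟨b₁', hb₁', hk', -, ht, rfl⟩ := State.next_B_succ_eq_some h1'
      obtain rfl : b' = b₁' := congrArg Prod.fst hb₁'
      obtain rfl : b = b' := Gate.eq_of_letter_B hk hk' (by simp_all) (by simpa using hb)
      rw [ih h2 h2' hl']

/-- For every incoming type and every letter there is a `B` gate, so any letters can be absorbed;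
the final type `u` is dictated by them. -/
theorem exists_ascending {n : ℕ} (ls : List Letter) (hn : ls.length < n) (t : WireType) :
    ∃ bs u, (∀ b ∈ bs, b.kind = .B) ∧ zLetters bs = ls ∧
      (State.B n bs.length t).nextList (ascending bs) = some (.B n 0 u) := by
  induction ls using List.reverseRecOn generalizing t with
  | nil => exact ⟨[], t, by simp, rfl, rfl⟩
  | append_singleton ls a ih =>
    obtain ⟨b, hb, rfl, rfl⟩ := exists_gate_B t a
    simp only [List.length_append, List.length_singleton] at hn
    obtain ⟨bs, u, hbs, rfl, h⟩ := ih (by omega) b.topOut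
    rw [length_zLetters] at hn
    refine ⟨b :: bs, u, by simpa [hb] using hbs, zLetters_cons b bs, ?_⟩
    exact State.nextList_cons_eq_some.2 ⟨_, State.next_B hb (by omega), h⟩

/-- With default `I`, entries only determine a list up to trailing `I`s. A last letter other than
`I` fixes the length. -/
theorem append_singleton_eq_of_getD {ls ls' : List Letter} {a a' : Letter} (ha : a ≠ .I)
    (ha' : a' ≠ .I) (h : ∀ i, (ls ++ [a]).getD i .I = (ls' ++ [a']).getD i .I) :
    ls ++ [a] = ls' ++ [a'] := by
  have hlen : ls.length = ls'.length := by
    rcases lt_trichotomy ls.length ls'.length with hlt | heq | hlt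
    · have := h ls'.length
      rw [List.getD_eq_default _ _ (by simp; omega)] at this
      simp at this
      exact absurd this.symm ha'
    · exact heq
    · have := h ls.length
      rw [List.getD_eq_default (ls' ++ [a']) _ (by simp; omega)] at this
      simp at this
      exact absurd this ha
  refine List.ext_getElem (by simp [hlen]) fun i h1 h2 => ?_
  have := h i
  rwa [List.getD_eq_getElem _ _ h1, List.getD_eq_getElem _ _ h2] at this

/-- The last letter other than `I` marks the wire on which the `A` gate has to be placed. -/
theorem exists_last_ne_I (ls : List Letter) : (∀ i, ls.getD i .I = .I) ∨
    ∃ ls' a, a ≠ .I ∧ ls'.length < ls.length ∧ ∀ i, ls.getD i .I = (ls' ++ [a]).getD i .I := by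
  induction ls using List.reverseRecOn with
  | nil => left; simp
  | append_singleton ls a ih =>
    by_cases ha : a = .I
    · subst ha
      have key : ∀ i, (ls ++ [Letter.I]).getD i .I = ls.getD i .I := by
        intro i
        rcases lt_trichotomy i ls.length with hi | hi | hi
        · rw [List.getD_append _ _ _ _ hi]
        · subst hi; simp
        · rw [List.getD_eq_default _ _ (by simp; omega), List.getD_eq_default _ _ (by omega)]
      simp only [key]
      rcases ih with ih | ⟨ls', a, h1, h2, h3⟩
      · exact .inl ih
      · exact .inr ⟨ls', a, h1, by simp; omega, h3⟩
    · exact .inr ⟨ls, a, ha, by simp, fun _ => rfl⟩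

theorem pauliTensor_congr {n : ℕ} {ls ls' : List Letter}
    (h : ∀ i, ls.getD i .I = ls'.getD i .I) : pauliTensor n ls = pauliTensor n ls' := by
  simp only [pauliTensor, h]

/-- Both circuits spell out the same operator `P`. Its letters determine `A`, its position and the
`B` gates, its sign determines `C`. -/
theorem IsZCircuit.unique {n : ℕ} {L L' : GateList} (h : IsZCircuit n L) (h' : IsZCircuit n L')
    {P : Op n} (hP : opOfList n (forget L) * P = onWire n 0 matZ * opOfList n (forget L))
    (hP' : opOfList n (forget L') * P = onWire n 0 matZ * opOfList n (forget L')) : L = L' := by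
  have hu := isUnit_opOfList h.fits
  have hu' := isUnit_opOfList h'.fits
  obtain ⟨a, bs, c, ha, hc, hn, rfl, hpath⟩ := h.exists_path
  obtain ⟨a', bs', c', ha', hc', hn', rfl, hpath'⟩ := h'.exists_path
  have h1 := hu.mul_left_cancel (hP.trans (opOfList_zCircuit ha hc hn hpath).symm)
  have h2 := hu'.mul_left_cancel (hP'.trans (opOfList_zCircuit ha' hc' hn' hpath').symm)
  obtain ⟨hs, hl⟩ := pauliTensor_injective (h1.symm.trans h2)
  have hl := append_singleton_eq_of_getD (Gate.letter_ne_I ha) (Gate.letter_ne_I ha') fun i => by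
    by_cases hi : i < n
    · exact hl i hi
    · rw [List.getD_eq_default _ _ (by simp; omega), List.getD_eq_default _ _ (by simp; omega)]
  obtain ⟨hzl, hal⟩ := List.append_inj' hl rfl
  obtain rfl := Gate.eq_of_letter_A ha ha' (by simpa using hal)
  obtain rfl := Gate.eq_of_sign_C hc hc' hs
  rw [ascending_unique hpath hpath' hzl]

/-- Both circuits spell out the same operator `Q`, whose letters on the wires from 1 on give the `D`
gates and whose sign gives `E`. -/
theorem IsXCircuit.unique {n : ℕ} {M M' : GateList} (h : IsXCircuit n M) (h' : IsXCircuit n M')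
    {Q : Op n} (hQ : opOfList n (forget M) * Q = onWire n (n - 1) matX * opOfList n (forget M))
    (hQ' : opOfList n (forget M') * Q = onWire n (n - 1) matX * opOfList n (forget M')) :
    M = M' := by
  have hu := isUnit_opOfList h.fits
  have hu' := isUnit_opOfList h'.fits
  obtain ⟨ds, e, hds, he, hn, rfl⟩ := h
  obtain ⟨ds', e', hds', he', hn', rfl⟩ := h'
  have e1 := opOfList_xCircuit hds he hn
  have e2 := opOfList_xCircuit hds' he' hn'
  rw [show ds.length = n - 1 by omega] at hu hQ e1 ⊢
  rw [show ds'.length = n - 1 by omega] at hu' hQ' e2 ⊢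
  have h1 := hu.mul_left_cancel (hQ.trans e1.symm)
  have h2 := hu'.mul_left_cancel (hQ'.trans e2.symm)
  obtain ⟨hs, hl⟩ := pauliTensor_injective (h1.symm.trans h2)
  obtain rfl := Gate.eq_of_sign_E he he' hs
  suffices ds = ds' by rw [this]
  refine List.ext_getElem (by omega) fun i h3 h4 => ?_
  -- The letter on wire 0 is the starting `X` or `Y`, so gate number `i` absorbs letter number `i +
  -- 1`.
  have := hl (i + 1) (by omega)
  refine Gate.eq_of_letter_D (hds _ (List.getElem_mem _)) (hds' _ (List.getElem_mem _)) ?_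
  simpa [List.getD_cons_succ, List.getD_eq_getElem, h3, h4] using this

theorem onWire_Y_mul_self (n p : ℕ) (hp : p < n) :
    onWire n p Letter.Y.mat * onWire n p Letter.Y.mat = -1 := by
  have h : checkEq 1 (-1) (Letter.Y.word ++ Letter.Y.word) ([] ++ []) = true := by decide +kernel
  have := opOfList_of_checkEq h (k := p) (n := n) (by omega)
  rw [opOfList_word] at this
  simpa [shift, opOfList] using this

theorem eq_zero_of_eq_neg {n : ℕ} {M : Op n} (h : M = -M) : M = 0 := by
  ext x y
  have := congrFun (congrFun h x) y
  rw [neg_apply] at this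
  rw [Matrix.zero_apply]
  linarith

/-- An involution is not conjugate to `Y`, whose square is `-1`. This is what excludes a carried `Y`
at the end of a circuit. -/
theorem not_conj_Y {n p : ℕ} (hp : p < n) {F T : Op n} (hF : IsUnit F) (hT : T * T = 1)
    (h : F * T = onWire n p Letter.Y.mat * F) : False := by
  have h1 : F = -F := by
    calc F = F * T * T := by rw [mul_assoc, hT, mul_one]
      _ = -F := by rw [h, mul_assoc, h, ← mul_assoc, onWire_Y_mul_self n p hp, neg_one_mul]
  exact hF.ne_zero (eq_zero_of_eq_neg h1)

theorem mul_self_of_smul {n : ℕ} {s : ℤˣ} {T : Op n}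
    (h : (((s : ℤ) : ℝ) • T) * (((s : ℤ) : ℝ) • T) = 1) : T * T = 1 := by
  rcases Int.units_eq_one_or s with rfl | rfl <;> simpa using h

/-- As `P ≠ ±1`, some letter is not `I`; the last such letter gives `A` and the letters above it
give the `B` gates. Since `P² = 1`, the type at wire 0 is single and a `C` gate fits. -/
theorem exists_isZCircuit {n : ℕ} {P : Op n} (hP : P ∈ pauliGroup n) (hPP : P * P = 1)
    (h1 : P ≠ 1) (h2 : P ≠ -1) : ∃ L, IsZCircuit n L ∧
      opOfList n (forget L) * P = onWire n 0 matZ * opOfList n (forget L) := by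
  obtain ⟨s, ls, hls, rfl⟩ := mem_pauliGroup_iff.1 hP
  have hT := mul_self_of_smul hPP
  rcases exists_last_ne_I ls with h | ⟨ls', l, hl, hlen, h⟩
  · have : pauliTensor n ls = 1 := by
      simp only [pauliTensor, h]
      exact tensor_one n
    rw [this] at h1 h2
    rcases Int.units_eq_one_or s with rfl | rfl <;> simp at h1 h2
  rw [pauliTensor_congr h] at hT ⊢
  obtain ⟨a, ha, rfl⟩ := exists_gate_A hl
  obtain ⟨c, hc, rfl⟩ := exists_gate_C s
  obtain ⟨bs, t, hbs, rfl, hpath⟩ := exists_ascending (n := n) ls' (by omega) a.topOut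
  have hn : bs.length < n := by rw [length_zLetters] at hlen; omega
  have hA := State.nextList_cons_eq_some.2 ⟨_, State.next_A ha hn, hpath⟩
  -- A double wire would carry `Y`, making an involution conjugate to `Y`.
  obtain rfl : t = .single := by
    cases t with
    | single => rfl
    | double =>
      have e := opOfList_A_ascending ha hn hpath
      have hY := opOfList_word n 0 .Y
      rw [shift_zero] at hY
      rw [zLetter, hY] at e
      exact (not_conj_Y (n := n) (p := 0) (by omega)
        (isUnit_opOfList (State.fits_of_nextList hA le_rfl)) hT e).elim
  refine ⟨_, ⟨a, bs, c, ha, hbs, hc, hn, rfl, ?_⟩, opOfList_zCircuit ha hc hn hpath⟩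
  have h3 : (State.A n).nextList ((a, bs.length) :: ascending bs ++ [(c, 0)]) =
      some (.D n 0) := by
    rw [State.nextList_append, hA]
    exact State.nextList_cons_eq_some.2 ⟨_, State.next_C hc (by omega), rfl⟩
  have := State.hasType_of_nextList h3 (le_refl n)
  rwa [State.types_A, State.types_D] at this

theorem pauliTensor_mul_onWire_Z {n : ℕ} {ls : List Letter}
    (h : ls.getD 0 .I = .I ∨ ls.getD 0 .I = .Z) :
    pauliTensor n ls * onWire n 0 matZ = onWire n 0 matZ * pauliTensor n ls := by
  simp only [pauliTensor, onWire, tensor_mul]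
  congr 1
  funext i
  split_ifs with hi
  · rw [hi]
    rcases h with h | h <;> simp only [h, Letter.mat, one_mul, mul_one]
  · simp

/-- Anticommutation with `Z` on wire 0 forces the first letter to be `X` or `Y`. The other letters
choose the `D` gates, and `Q² = 1` forces the first letter to match the parity of the `D4` gates. -/
theorem exists_isXCircuit {n : ℕ} {Q : Op n} (hn : 0 < n) (hQ : Q ∈ pauliGroup n)
    (hQQ : Q * Q = 1) (hZ : Q * onWire n 0 matZ = -(onWire n 0 matZ * Q)) :
    ∃ M, IsXCircuit n M ∧
      opOfList n (forget M) * Q = onWire n (n - 1) matX * opOfList n (forget M) := by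
  obtain ⟨s, ls, hls, rfl⟩ := mem_pauliGroup_iff.1 hQ
  have hT := mul_self_of_smul hQQ
  obtain ⟨l, ls, rfl⟩ := List.exists_cons_of_length_pos (hls ▸ hn)
  obtain ⟨b, rfl⟩ : ∃ b, l = xLetter b := by
    -- With such a first letter `Q` would both commute and anticommute with the invertible `Z`,
    -- hence vanish.
    have key : l = .I ∨ l = .Z → False := by
      intro hl
      have e := pauliTensor_mul_onWire_Z (n := n) (ls := l :: ls) (by simpa using hl)
      rw [Algebra.smul_mul_assoc, e, Algebra.mul_smul_comm] at hZ
      have hs : ((s : ℤ) : ℝ) ≠ 0 := by exact_mod_cast s.ne_zero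
      have h0 := (smul_eq_zero.1 (eq_zero_of_eq_neg hZ)).resolve_left hs
      have hZ1 : IsUnit (onWire n 0 matZ) := .of_mul_eq_one _ (op_mul_self n (.Z, 0) hn)
      rw [hZ1.mul_right_eq_zero] at h0
      rw [h0] at hT
      simp at hT
    cases l with
    | I => exact (key (.inl rfl)).elim
    | Z => exact (key (.inr rfl)).elim
    | X => exact ⟨false, rfl⟩
    | Y => exact ⟨true, rfl⟩
  obtain ⟨ds, hds, rfl⟩ : ∃ ds : List Gate, (∀ d ∈ ds, d.kind = .D) ∧ ds.map Gate.letter = ls := by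
    choose f hf hf' using exists_gate_D
    exact ⟨ls.map f, by simp [hf], by simp [Function.comp_def, hf']⟩
  obtain ⟨e, he, rfl⟩ := exists_gate_E s
  have hlen : ds.length + 1 = n := by simpa using hls
  have hM : IsXCircuit n (descending 0 ds ++ [(e, ds.length)]) := ⟨ds, e, hds, he, hlen, rfl⟩
  have hfits : Fits n (forget (descending 0 ds)) := by
    intro g hg
    exact hM.fits g (by rw [forget_append]; exact List.mem_append_left _ hg)
  have h1 := opOfList_descending (p := 0) (n := n) hds (by omega) b
  rw [opOfList_pauliWord] at h1
  -- With the wrong parity the last wire would receive `Y` instead of `X`.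
  obtain rfl : b = oddD4 ds := by
    rcases hb : b ^^ oddD4 ds with _ | _
    · simpa using hb
    · rw [hb] at h1
      exact (not_conj_Y (by omega) (isUnit_opOfList hfits) hT h1).elim
  refine ⟨_, hM, ?_⟩
  rw [show n - 1 = ds.length by omega]
  exact opOfList_xCircuit hds he hlen

theorem IsXCircuit.opOfList_Z {n : ℕ} {M : GateList} (h : IsXCircuit n M) :
    opOfList n (forget M) * onWire n 0 matZ = onWire n (n - 1) matZ * opOfList n (forget M) := by
  obtain ⟨ds, e, hds, he, hn, rfl⟩ := h
  rw [show n - 1 = ds.length by omega]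
  exact opOfList_xCircuit_Z hds he hn

end RealStab

/-! ### Normal forms of Clifford operators, peeled off block by block -/

namespace RealStab

open Matrix

theorem isUnit_units_smul {n : ℕ} (s : ℤˣ) {M : Op n} (h : IsUnit M) :
    IsUnit (((s : ℤ) : ℝ) • M) := by
  rcases Int.units_eq_one_or s with rfl | rfl <;> simpa using h

/-- If `U` and `U'` both carry `Z` to `W`, then `V` and `V'` pull `Z` back to the same operator,
namely the one to which `U V = U' V'` pulls back `W`. This compares the first blocks of two normal
forms. -/
theorem conj_eq_of_mul_eq {n : ℕ} {U V U' V' P Z W : Op n} (hU' : IsUnit U') (h : U * V = U' * V')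
    (hV : V * P = Z * V) (hZ : U * Z = W * U) (hZ' : U' * Z = W * U') : V' * P = Z * V' := by
  apply hU'.mul_left_cancel
  rw [← mul_assoc, ← h, mul_assoc, hV, ← mul_assoc, hZ, mul_assoc, h, ← mul_assoc, ← hZ',
    mul_assoc]

theorem exists_conj_of_isUnit {n : ℕ} {V : Op n} (hV : IsUnit V) (Z : Op n) :
    ∃ P, V * P = Z * V := by
  obtain ⟨V, rfl⟩ := hV
  exact ⟨↑V⁻¹ * (Z * V), by simp⟩

/-- Everything after `L` carries `Z` on wire 0 to `Z` on the last wire, whatever the gates are, so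
equal operators give the same `P` for both `Z`-circuits. After cancelling these, the same argument
with `X` applies to the `X`-circuits. The rest avoids the last wire and is treated by induction. -/
theorem IsNormalList.unique {n : ℕ} {l l' : GateList} (hl : IsNormalList n l)
    (hl' : IsNormalList n l') {s s' : ℤˣ}
    (h : ((s : ℤ) : ℝ) • opOfList n (forget l) = ((s' : ℤ) : ℝ) • opOfList n (forget l')) :
    s = s' ∧ l = l' := by
  induction hl generalizing l' with
  | zero =>
    cases hl'
    have := congrFun (congrFun h 0) 0
    simp only [forget, List.flatMap_nil, opOfList, Matrix.smul_apply, one_apply_eq, smul_eq_mul,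
      mul_one, Int.cast_inj] at this
    exact ⟨Units.ext this, rfl⟩
  | succ n L M N hL hM hN ih =>
    cases hl' with
    | succ _ L' M' N' hL' hM' hN' =>
    have hfits : ∀ {N}, IsNormalList n N → Fits (n + 1) (forget N) :=
      fun h g hg => (h.fits g hg).trans n.le_succ
    have hNu := isUnit_opOfList (hfits hN')
    simp only [forget_append, opOfList_append, ← Algebra.smul_mul_assoc] at h
    -- The remaining blocks live on the first `n` wires and commute with anything on the last wire.
    have hNZ : ∀ {N} (_ : IsNormalList n N) (s : ℤˣ) (K : Matrix (Fin 2) (Fin 2) ℝ),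
        (((s : ℤ) : ℝ) • opOfList (n + 1) (forget N)) * onWire (n + 1) n K =
          onWire (n + 1) n K * (((s : ℤ) : ℝ) • opOfList (n + 1) (forget N)) := by
      intro N hN s K
      rw [← addWire_opOfList hN.fits, Algebra.smul_mul_assoc, addWire_commute_onWire,
        Algebra.mul_smul_comm]
    have hMZ : ∀ {M N} (_ : IsXCircuit (n + 1) M) (_ : IsNormalList n N) (s : ℤˣ),
        ((((s : ℤ) : ℝ) • opOfList (n + 1) (forget N)) * opOfList (n + 1) (forget M)) *
          onWire (n + 1) 0 matZ = onWire (n + 1) n matZ *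
          ((((s : ℤ) : ℝ) • opOfList (n + 1) (forget N)) * opOfList (n + 1) (forget M)) := by
      intro M N hM hN s
      rw [mul_assoc, hM.opOfList_Z, ← mul_assoc, Nat.add_sub_cancel, hNZ hN, mul_assoc]
    have hsN := isUnit_units_smul s' hNu
    simp only [← mul_assoc] at h
    obtain ⟨P, hP⟩ := exists_conj_of_isUnit (isUnit_opOfList hL.fits) (onWire (n + 1) 0 matZ)
    obtain rfl := hL.unique hL' hP (conj_eq_of_mul_eq (hsN.mul (isUnit_opOfList hM'.fits)) h hP
      (hMZ hM hN s) (hMZ hM' hN' s'))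
    have h := (isUnit_opOfList hL.fits).mul_right_cancel h
    obtain ⟨Q, hQ⟩ := exists_conj_of_isUnit (isUnit_opOfList hM.fits) (onWire (n + 1) n matX)
    obtain rfl := hM.unique hM' hQ (conj_eq_of_mul_eq hsN h hQ (hNZ hN s matX) (hNZ hN' s' matX))
    have h := (isUnit_opOfList hM.fits).mul_right_cancel h
    rw [← addWire_opOfList hN.fits, ← addWire_opOfList hN'.fits, ← addWire_smul,
      ← addWire_smul] at h
    obtain ⟨rfl, rfl⟩ := ih hN' (addWire_injective h)
    exact ⟨rfl, rfl⟩

theorem onWire_mem_pauliGroup (n p : ℕ) (a : Letter) : onWire n p a.mat ∈ pauliGroup n := by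
  refine ⟨1, fun i => if (i : ℕ) = p then a.mat else 1, fun i => ?_, by simp [onWire]⟩
  by_cases h : (i : ℕ) = p
  · simpa only [h, if_true] using a.mat_cases
  · simp [h]

theorem onWire_X_mul_Z (n p : ℕ) (hp : p < n) :
    onWire n p matX * onWire n p matZ = -(onWire n p matZ * onWire n p matX) := by
  have h : checkEq 1 (-1) (Letter.Z.word ++ Letter.X.word) (Letter.X.word ++ Letter.Z.word) =
    true := by decide +kernel
  have := opOfList_of_checkEq h (k := p) (n := n) (by omega)
  simpa [opOfList_word, Letter.mat] using this

theorem onWire_X_mul_self (n p : ℕ) (hp : p < n) : onWire n p matX * onWire n p matX = 1 := by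
  have h : checkEq 1 1 (Letter.X.word ++ Letter.X.word) ([] ++ []) = true := by decide +kernel
  have := opOfList_of_checkEq h (k := p) (n := n) (by omega)
  rw [opOfList_word, Letter.mat] at this
  simpa [shift, opOfList] using this

theorem onWire_Z_mul_self (n p : ℕ) (hp : p < n) : onWire n p matZ * onWire n p matZ = 1 :=
  op_mul_self n (.Z, p) hp

/-- A scalar commutes with `X`, whereas `Z` anticommutes with it. -/
theorem onWire_Z_ne {n p : ℕ} (hp : p < n) (s : ℤˣ) :
    onWire n p matZ ≠ ((s : ℤ) : ℝ) • (1 : Op n) := by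
  intro h
  have h1 := onWire_X_mul_Z n p hp
  rw [h, Algebra.mul_smul_comm, Algebra.smul_mul_assoc, mul_one, one_mul] at h1
  have h2 := eq_zero_of_eq_neg h1
  have hs : ((s : ℤ) : ℝ) ≠ 0 := by exact_mod_cast s.ne_zero
  have h3 := (smul_eq_zero.1 h2).resolve_left hs
  have h4 := onWire_X_mul_self n p hp
  simp [h3] at h4

theorem exists_isNormalList {n : ℕ} {U : Op n} (hU : U ∈ cliffordGroup n) :
    ∃ (s : ℤˣ) (N : GateList), IsNormalList n N ∧
      U = ((s : ℤ) : ℝ) • opOfList n (forget N) := by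
  induction n with
  | zero =>
    have h1 := congrFun (congrFun ((mem_orthogonalGroup_iff _ _).1 hU.1) 0) 0
    -- On zero wires operators are 1×1 matrices, and orthogonality says that the entry squares to 1.
    simp only [mul_apply, Finset.univ_unique, Finset.sum_singleton, transpose_apply,
      one_apply_eq] at h1
    have e : ∀ x y : Fin 0 → Fin 2, U x y = U 0 0 := by
      intro x y
      rw [Subsingleton.elim x 0, Subsingleton.elim y 0]
    rw [e] at h1
    have key : ∀ s : ℤˣ, U 0 0 = ((s : ℤ) : ℝ) → U = ((s : ℤ) : ℝ) • opOfList 0 (forget []) := by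
      intro s h
      ext x y
      rw [e, h, Subsingleton.elim x y]
      simp [forget, opOfList]
    rcases mul_self_eq_one_iff.1 h1 with h | h
    · exact ⟨1, [], .zero, key 1 (by rw [h]; simp)⟩
    · exact ⟨-1, [], .zero, key (-1) (by rw [h]; simp)⟩
  | succ n ih =>
    have hu : IsUnit U := (isUnit_iff_isUnit_det _).2 (isUnit_of_mem_cliffordGroup hU)
    have hlt : n < n + 1 := n.lt_succ_self
    -- `P` is `Z` on the last wire pulled back along `U`; it inherits being an involution other than
    -- `±1`.
    obtain ⟨P, hP, hUP⟩ := exists_conj_eq hU (onWire_mem_pauliGroup (n + 1) n .Z)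
    rw [Letter.mat] at hUP
    have hone : ∀ s : ℤˣ, P ≠ ((s : ℤ) : ℝ) • 1 := by
      rintro s rfl
      apply onWire_Z_ne hlt s
      apply hu.mul_right_cancel
      rw [← hUP, Algebra.mul_smul_comm, Algebra.smul_mul_assoc, mul_one, one_mul]
    obtain ⟨L, hL, hLP⟩ := exists_isZCircuit hP
      (hu.mul_left_cancel (by rw [← mul_assoc, hUP, mul_assoc, hUP, ← mul_assoc,
        onWire_Z_mul_self _ _ hlt, one_mul, mul_one]))
      (by simpa using hone 1) (by simpa using hone (-1))
    -- Divide by `L` on the right: `L` is applied first, and the quotient is again Clifford.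
    obtain ⟨V, rfl, hV⟩ : ∃ V, U = V * opOfList (n + 1) (forget L) ∧ V ∈ cliffordGroup (n + 1) :=
      ⟨U * (opOfList (n + 1) (forget L))⁻¹,
        by rw [mul_assoc, nonsing_inv_mul _ (isUnit_of_mem_cliffordGroup
          (opOfList_mem_cliffordGroup hL.fits)), mul_one],
        mul_mem_cliffordGroup hU (inv_mem_cliffordGroup (opOfList_mem_cliffordGroup hL.fits))⟩
    have hVZ : V * onWire (n + 1) 0 matZ = onWire (n + 1) n matZ * V := by
      apply (isUnit_opOfList hL.fits).mul_right_cancel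
      rw [mul_assoc, ← hLP, ← mul_assoc, hUP, mul_assoc]
    have hv : IsUnit V := (isUnit_iff_isUnit_det _).2 (isUnit_of_mem_cliffordGroup hV)
    -- `Q` is `X` on the last wire pulled back along `V`. As `V` carries `Z` on wire 0 to `Z` on the
    -- last wire, `Q` anticommutes with the former.
    obtain ⟨Q, hQ, hVQ⟩ := exists_conj_eq hV (onWire_mem_pauliGroup (n + 1) n .X)
    rw [Letter.mat] at hVQ
    obtain ⟨M, hM, hMQ⟩ := exists_isXCircuit (Nat.add_pos_right n one_pos) hQ
      (hv.mul_left_cancel (by rw [← mul_assoc, hVQ, mul_assoc, hVQ, ← mul_assoc,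
        onWire_X_mul_self _ _ hlt, one_mul, mul_one]))
      (hv.mul_left_cancel (by rw [← mul_assoc, hVQ, mul_assoc, hVZ, mul_neg, ← mul_assoc V, hVZ,
        mul_assoc, hVQ, ← mul_assoc, ← mul_assoc, onWire_X_mul_Z _ _ hlt, neg_mul]))
    obtain ⟨W, rfl, hW⟩ : ∃ W, V = W * opOfList (n + 1) (forget M) ∧ W ∈ cliffordGroup (n + 1) :=
      ⟨V * (opOfList (n + 1) (forget M))⁻¹,
        by rw [mul_assoc, nonsing_inv_mul _ (isUnit_of_mem_cliffordGroup
          (opOfList_mem_cliffordGroup hM.fits)), mul_one],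
        mul_mem_cliffordGroup hV (inv_mem_cliffordGroup (opOfList_mem_cliffordGroup hM.fits))⟩
    rw [Nat.add_sub_cancel] at hMQ
    have hWX : W * onWire (n + 1) n matX = onWire (n + 1) n matX * W := by
      apply (isUnit_opOfList hM.fits).mul_right_cancel
      rw [mul_assoc, ← hMQ, ← mul_assoc, hVQ, mul_assoc]
    have hWZ : W * onWire (n + 1) n matZ = onWire (n + 1) n matZ * W := by
      apply (isUnit_opOfList hM.fits).mul_right_cancel
      have := hM.opOfList_Z
      rw [Nat.add_sub_cancel] at this
      rw [mul_assoc, ← this, ← mul_assoc, hVZ, mul_assoc]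
    -- What is left commutes with `X` and `Z` on the last wire, so it is a Clifford operator on the
    -- wires above.
    obtain ⟨T, rfl⟩ := exists_addWire hWX hWZ
    obtain ⟨s, N, hN, rfl⟩ := ih (mem_cliffordGroup_of_addWire hW)
    refine ⟨s, L ++ M ++ N, .succ n L M N hL hM hN, ?_⟩
    rw [addWire_smul, addWire_opOfList hN.fits, forget_append, forget_append, opOfList_append,
      opOfList_append, Algebra.smul_mul_assoc, Algebra.smul_mul_assoc, mul_assoc]

theorem IsNormalFormOf.unique {n : ℕ} {N N' : Circuit} {U : Op n} (h : IsNormalFormOf n N U)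
    (h' : IsNormalFormOf n N' U) : N = N' := by
  obtain ⟨h1, h2⟩ := IsNormalList.unique h.1 h'.1 (h.2.trans h'.2.symm)
  exact Prod.ext h1 h2

theorem exists_isNormalFormOf {n : ℕ} {U : Op n} (hU : U ∈ cliffordGroup n) :
    ∃ N, IsNormalFormOf n N U := by
  obtain ⟨s, N, hN, rfl⟩ := exists_isNormalList hU
  exact ⟨(s, N), hN, rfl⟩

theorem PrimCircuit.op_mem_cliffordGroup {n : ℕ} {c : PrimCircuit} (hc : c.OnWires n) :
    c.op n ∈ cliffordGroup n :=
  smul_mem_cliffordGroup (opOfList_mem_cliffordGroup hc) c.1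

theorem exists_primCircuit {n : ℕ} {U : Op n} (hU : U ∈ cliffordGroup n) :
    ∃ c : PrimCircuit, c.OnWires n ∧ c.op n = U := by
  obtain ⟨N, hN, rfl⟩ := exists_isNormalFormOf hU
  exact ⟨(N.1, forget N.2), hN.fits, rfl⟩

/-- Both circuits rewrite to a normal form of the common operator, and by uniqueness this is the
same list with the same sign; reversing one of the rewritings connects the circuits. -/
theorem equalModulo_iff {n : ℕ} {c d : PrimCircuit} (hc : c.OnWires n) (hd : d.OnWires n) :
    EqualModulo typedRelations n c d ↔ c.op n = d.op n := by
  refine ⟨fun h => h.op_eq, fun h => ?_⟩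
  obtain ⟨N, hN, h1⟩ := exists_normalForm_rewrites hc
  obtain ⟨N', hN', h2⟩ := exists_normalForm_rewrites hd
  rw [← h] at hN'
  obtain rfl := hN.unique hN'
  have h1 := h1.equalModulo
  have h2 := h2.equalModulo
  rw [forget_toCircuit] at h1 h2
  exact h1.trans _ _ _ (h2.symm _ _)

end RealStab

theorem mainTheorem3 (n : ℕ) :
    (∀ U ∈ RealStab.cliffordGroup n, ∃! N : RealStab.Circuit, RealStab.IsNormalFormOf n N U) ∧
    (∀ c : RealStab.PrimCircuit, c.OnWires n →
      ∃ N : RealStab.Circuit, RealStab.IsNormalFormOf n N (c.op n) ∧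
        RealStab.Rewrites RealStab.typedRelations n c.toCircuit N) ∧
    (∀ d : RealStab.Circuit, RealStab.IsDirtyNormal n d →
      ∃ N : RealStab.Circuit, RealStab.IsNormalFormOf n N (d.op n) ∧
        RealStab.Rewrites RealStab.pushRelations n d N) ∧
    ((∀ c : RealStab.PrimCircuit, c.OnWires n → c.op n ∈ RealStab.cliffordGroup n) ∧
      (∀ U ∈ RealStab.cliffordGroup n, ∃ c : RealStab.PrimCircuit, c.OnWires n ∧ c.op n = U) ∧
      (∀ c d : RealStab.PrimCircuit, c.OnWires n → d.OnWires n →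
        (RealStab.EqualModulo RealStab.typedRelations n c d ↔ c.op n = d.op n))) := by
  refine ⟨fun U hU => ?_, fun c hc => RealStab.exists_normalForm_rewrites hc,
    fun d hd => hd.exists_normalForm, fun c hc => RealStab.PrimCircuit.op_mem_cliffordGroup hc,
    fun U hU => RealStab.exists_primCircuit hU, fun c d hc hd => RealStab.equalModulo_iff hc hd⟩
  obtain ⟨N, hN⟩ := RealStab.exists_isNormalFormOf hU
  exact ⟨N, hN, fun N' hN' => hN'.unique hN⟩
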